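/- **Conventions.** $\mathcal{ELIO}_u$-concepts are built from $\top$, concept names $A$ and nominals $\{a\}$ by $C\sqcap D$ and $\exists R.C$, where $R$ is a role name $r$, an inverse role $r^-$, or the universal role $u$; $\mathcal{ELIO}$-concepts are those without $u$. An ontology is a finite set of inclusions $C\sqsubseteq D$ of $\mathcal{ELIO}_u$-concepts; it is in normal form if all of them have one of the forms $\top\sqsubseteq A$, $A_1\sqcap A_2\sqsubseteq B$, $A\sqsubseteq\{a\}$, $\{a\}\sqsubseteq A$, $A\sqsubseteq\exists R.B$, $\exists R.B\sqsubseteq A$ with concept names $A,A_1,A_2,B$. $\|\mathcal O\|$ is the number of symbols of $\mathcal O$, and $\mathrm{sig}(X)$ the set of concept, role and individual names in $X$ ($u$ is not counted). For $\mathcal L\in\{\mathcal{ELIO}_u,\mathcal{ELIO}\}$, an $\mathcal L$-interpolant for $A\sqsubseteq B$ under $\mathcal O_1,\mathcal O_2$ is an $\mathcal L$-concept $D$ with $\mathrm{sig}(D)\subseteq\Sigma:=\mathrm{sig}(\mathcal O_1,A)\cap\mathrm{sig}(\mathcal O_2,B)$ and $\mathcal O_1\cup\mathcal O_2\models A\sqsubseteq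 D$, $\mathcal O_1\cup\mathcal O_2\models D\sqsubseteq B$. An ABox is a possibly infinite set of assertions $\top(x)$, $A(x)$, $\{a\}(x)$, $r(x,y)$ over individual variables; $\mathrm{ind}(\mathcal A)$ is the set of its variables, and $\mathcal O,\mathcal A\models B(x)$ means that $v(x)\in B^{\mathcal I}$ for all models $\mathcal I$ of $\mathcal O$ and all assignments $v$ that satisfy $\mathcal A$ in $\mathcal I$. Its undirected graph joins $x$ and $y$ if $r(x,y)\in\mathcal A$ for some $r$. $\mathcal A$ is tree-shaped if this graph is acyclic, $r(x,y),s(x,y)\in\mathcal A$ imply $r=s$, and $r(x,y)\in\mathcal A$ implies $s(y,x)\notin\mathcal A$ for all $s$; it is tree-shaped modulo $\Gamma$ if this holds after some assertions $r(x,y)$ with $\{a\}(x)\in\mathcal A$ or $\{a\}(y)\in\mathcal A$, $a\in\Gamma$, are dropped. $\mathcal A,x$ is weakly rooted if all individuals are joined to $x$ by an undirected path. The $\mathcal L$-concept corresponding to a pointed ABox $\mathcal A,x$ that is tree-shaped modulo the individual names of $\Sigma$ (and weakly rooted if $\mathcal L=\mathcal{ELIO}$) is the, up to equivalence unique, $\mathcal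 L$-concept $C$ with $\mathrm{sig}(C)\subseteq\Sigma$ such that $d\in C^{\mathcal I}$ iff some assignment $v$ with $v(x)=d$ satisfies $\mathcal A$ in $\mathcal I$, for all $\mathcal I,d$. *Canonical model.* For an ontology $\mathcal O$ in normal form and a concept name $A$, let $\mathrm{cl}$ consist of the subconcepts of concepts in $\mathcal O$, the concepts $\exists R.\{a\}$ with $R$ a role name or inverse role over $\mathrm{sig}(\mathcal O)$ and $a\in\mathrm{sig}(\mathcal O)$, and $A$, $\exists u.A$. A type is a set $\tau\subseteq\mathrm{cl}$ that contains every $C\in\mathrm{cl}$ with $\mathcal O\models\bigsqcap\tau\sqsubseteq C$. Write $\tau\rightsquigarrow_R\tau'$ if $\tau'$ is a maximal type with $\mathcal O\models\bigsqcap\tau\sqsubseteq\exists R.\bigsqcap\tau'$. Let $\tau_B$ and $\tau_a$ be the minimal types that contain $\exists u.A$ and $B$, respectively $\{a\}$; let $S_N=\{\tau_a\mid a\in\mathrm{sig}(\mathcal O)\}$ and $S=S_N\cup\{\tau_B\mid\mathcal O\models A\sqsubseteq\exists u.B\}$. The domain of $\mathcal I_{\mathcal O,A}$ is the set of words $\tau_0R_1\tau_1\cdots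 R_n\tau_n$ with $n\ge 0$, $\tau_0\in S$, $\tau_1,\dots,\tau_n\notin S_N$, each $R_i$ a role name or inverse role, and $\tau_i\rightsquigarrow_{R_{i+1}}\tau_{i+1}$; $a$ denotes $\tau_a$, a word is in $B$ iff $B$ is in its last type, and $r$ consists of the pairs $(w,wr\tau)$, $(wr^-\tau,w)$, $(w,\tau_a)$ if $\exists r.\{a\}$ is in the last type of $w$, and $(\tau_a,w)$ if $\exists r^-.\{a\}$ is. Put $\rho_A=\tau_A$. $\mathcal A^{\Sigma}_{\mathcal O,A}$ is the $\Sigma$-reduct of $\mathcal I_{\mathcal O,A}$, regarded as an ABox that has $\top(d)$ for every element $d$; $\mathcal A^{\downarrow_w\Sigma}_{\mathcal O,A}$ is its sub-ABox weakly rooted in $\rho_A$ (all assertions whose individuals are joined to $\rho_A$ by an undirected path). *Unfolding.* Let $\Gamma$ be the set of individual names of $\Sigma$, and call $x$ nominal if $\{a\}(x)\in\mathcal A$ for some $a\in\Gamma$. The individuals of the undirected unfolding $\mathcal A^*$ are the words $x_0R_1x_1\cdots R_nx_n$ with $n\ge0$, $x_i\in\mathrm{ind}(\mathcal A)$, $x_1,\dots,x_n$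 not nominal, and $R_{i+1}(x_i,x_{i+1})\in\mathcal A$, where $r^-(x,y)$ stands for $r(y,x)$. With $t$ the last letter of $w$, its assertions are $\top(w)$ if $\top(t)\in\mathcal A$; $B(w)$ if $B(t)\in\mathcal A$; $\{a\}(x)$ if $\{a\}(x)\in\mathcal A$ and $a\in\Gamma$; $r(w,wrx)$ and $r(wr^-x,w)$ for all words $wrx$, $wr^-x$ among the individuals; and, for nominal $x$, $r(w,x)$ if $r(t,x)\in\mathcal A$ and $r(x,w)$ if $r(x,t)\in\mathcal A$. The rooted undirected unfolding of $\mathcal A,x$ is the sub-ABox of $\mathcal A^*$ weakly rooted in $x$. $\mathcal A^{\Sigma,*}_{\mathcal O,A}$ is the undirected unfolding of $\mathcal A^{\Sigma}_{\mathcal O,A}$, and $\mathcal A^{\downarrow_w\Sigma,*}_{\mathcal O,A}$ the rooted undirected unfolding of $\mathcal A^{\downarrow_w\Sigma}_{\mathcal O,A},\rho_A$. **Theorem.** There exists a polynomial $p$ such that the following conditions are equivalent for all $\mathcal{ELIO}_u$-ontologies $\mathcal O_1,\mathcal O_2$ in normal form and all concept names $A,B$, where $\Sigma=\mathrm{sig}(\mathcal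 O_1,A)\cap\mathrm{sig}(\mathcal O_2,B)$: 1. an $\mathcal{ELIO}_u$-interpolant for $A\sqsubseteq B$ under $\mathcal O_1,\mathcal O_2$ exists; 2. $\mathcal O_1\cup\mathcal O_2,\mathcal A^{\Sigma}_{\mathcal O_1\cup\mathcal O_2,A}\models B(\rho_A)$; 3. there exists a finite subset $\mathcal A$ of $\mathcal A^{\Sigma,*}_{\mathcal O_1\cup\mathcal O_2,A}$ with $|\mathrm{ind}(\mathcal A)|\le 2^{2^{p(\|\mathcal O_1\cup\mathcal O_2\|)}}$ such that the $\mathcal{ELIO}_u$-concept corresponding to $\mathcal A,\rho_A$ is an $\mathcal{ELIO}_u$-interpolant for $A\sqsubseteq B$ under $\mathcal O_1,\mathcal O_2$. The same equivalences hold (for the same ontologies) if in Points 1 to 3 $\mathcal{ELIO}_u$ is replaced by $\mathcal{ELIO}$, $\mathcal A^{\Sigma}_{\mathcal O_1\cup\mathcal O_2,A}$ by $\mathcal A^{\downarrow_w\Sigma}_{\mathcal O_1\cup\mathcal O_2,A}$, and $\mathcal A^{\Sigma,*}_{\mathcal O_1\cup\mathcal O_2,A}$ by $\mathcal A^{\downarrow_w\Sigma,*}_{\mathcal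 O_1\cup\mathcal O_2,A}$. In Point 3, $\mathcal A$ can be computed in double exponential time, if it exists: for either language there are an algorithm and a polynomial $q$ such that, on every input $\mathcal O_1,\mathcal O_2,A,B$ of length $n$ with $\mathcal O_1,\mathcal O_2$ in normal form, the algorithm stops within $2^{2^{q(n)}}$ steps, and its output is an ABox $\mathcal A$ as in Point 3 whenever there is one. -/

import Mathlib

namespace DescrLogic

/-! ## Concepts, inclusions, ontologies

Concept names, role names and individual names are each indexed by `ℕ`. -/

/-- A role is a role name or an inverse role; the universal role is treated separately. -/
inductive Role : Type
  | name (r : ℕ) : Role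
  | inv (r : ℕ) : Role
deriving DecidableEq

/-- The role name that underlies a role. -/
def Role.base : Role → ℕ
  | .name r => r
  | .inv r => r

/-- `ELIO_u`-concepts; `ex R C` is `∃R.C` and `exU C` is `∃u.C` for the universal role `u`. -/
inductive Concept : Type
  | top : Concept
  | name (A : ℕ) : Concept
  | nom (a : ℕ) : Concept
  | and (C D : Concept) : Concept
  | ex (R : Role) (C : Concept) : Concept
  | exU (C : Concept) : Concept
deriving DecidableEq

/-- Non-logical symbols. The universal role is not one of them. -/
inductive NLSym : Type
  | con (A : ℕ) : NLSym
  | rol (r : ℕ) : NLSym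
  | ind (a : ℕ) : NLSym

/-- A signature is a set of non-logical symbols. -/
abbrev Signature := Set NLSym

/-- The individual names of a signature, `N_I ∩ Σ`. -/
def Signature.indNames (S : Signature) : Set ℕ := {a | NLSym.ind a ∈ S}

def Concept.sig : Concept → Signature
  | .top => ∅
  | .name A => {NLSym.con A}
  | .nom a => {NLSym.ind a}
  | .and C D => C.sig ∪ D.sig
  | .ex R C => {NLSym.rol R.base} ∪ C.sig
  | .exU C => C.sig

/-- The number of symbols of a concept (a name counts as one symbol). -/
def Concept.size : Concept → ℕ
  | .top => 1
  | .name _ => 1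
  | .nom _ => 1
  | .and C D => C.size + D.size + 1
  | .ex _ C => C.size + 2
  | .exU C => C.size + 2

/-- Subconcepts, the concept itself included. -/
def Concept.sub : Concept → Set Concept
  | .top => {.top}
  | .name A => {.name A}
  | .nom a => {.nom a}
  | .and C D => {.and C D} ∪ C.sub ∪ D.sub
  | .ex R C => {.ex R C} ∪ C.sub
  | .exU C => {.exU C} ∪ C.sub

/-- The concept does not use the universal role. -/
def Concept.UFree : Concept → Prop
  | .top => True
  | .name _ => True
  | .nom _ => True
  | .and C D => C.UFree ∧ D.UFree
  | .ex _ C => C.UFree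
  | .exU _ => False

/-- The two languages for interpolants: `ELIO_u` and `ELIO`. -/
inductive Dialect : Type
  | eliou : Dialect
  | elio : Dialect

/-- `C` is a concept of the language. -/
def Dialect.Admits : Dialect → Concept → Prop
  | .eliou, _ => True
  | .elio, C => C.UFree

/-- The concept inclusion `lhs ⊑ rhs`. -/
structure Inclusion : Type where
  lhs : Concept
  rhs : Concept
deriving DecidableEq

def Inclusion.size (c : Inclusion) : ℕ := c.lhs.size + c.rhs.size + 1

/-- An `ELIO_u`-ontology is a finite set of concept inclusions. -/
abbrev Ontology := Finset Inclusion

namespace Ontology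

def sig (O : Ontology) : Signature := {s | ∃ c ∈ O, s ∈ c.lhs.sig ∪ c.rhs.sig}

def size (O : Ontology) : ℕ := ∑ c ∈ O, c.size

/-- `sub(O)`. -/
def sub (O : Ontology) : Set Concept := {C | ∃ c ∈ O, C ∈ c.lhs.sub ∪ c.rhs.sub}

end Ontology

/-- The shapes of concept inclusions that are allowed in normal form. -/
inductive Inclusion.IsNormal : Inclusion → Prop
  | top (A : ℕ) : IsNormal ⟨.top, .name A⟩
  | and (A₁ A₂ B : ℕ) : IsNormal ⟨.and (.name A₁) (.name A₂), .name B⟩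
  | toNom (A a : ℕ) : IsNormal ⟨.name A, .nom a⟩
  | ofNom (a A : ℕ) : IsNormal ⟨.nom a, .name A⟩
  | toEx (A : ℕ) (R : Role) (B : ℕ) : IsNormal ⟨.name A, .ex R (.name B)⟩
  | toExU (A B : ℕ) : IsNormal ⟨.name A, .exU (.name B)⟩
  | ofEx (R : Role) (B A : ℕ) : IsNormal ⟨.ex R (.name B), .name A⟩
  | ofExU (B A : ℕ) : IsNormal ⟨.exU (.name B), .name A⟩

def Ontology.IsNormal (O : Ontology) : Prop := ∀ c ∈ O, c.IsNormal

/-! ## Semantics -/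

/-- Interpretations. The domain is non-empty because individual names denote elements of it. -/
structure Interpretation : Type 1 where
  Dom : Type
  con : ℕ → Set Dom
  rol : ℕ → Dom → Dom → Prop
  ind : ℕ → Dom

namespace Interpretation

def rel (I : Interpretation) : Role → I.Dom → I.Dom → Prop
  | .name r, d, e => I.rol r d e
  | .inv r, d, e => I.rol r e d

/-- The extension `C^I`. -/
def ext (I : Interpretation) : Concept → Set I.Dom
  | .top => Set.univ
  | .name A => I.con A
  | .nom a => {I.ind a}
  | .and C D => I.ext C ∩ I.ext D
  | .ex R C => {d | ∃ e, I.rel R d e ∧ e ∈ I.ext C}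
  | .exU C => {_d | ∃ e, e ∈ I.ext C}

/-- The extension of the conjunction of all members of a set of concepts. -/
def extAll (I : Interpretation) (τ : Set Concept) : Set I.Dom := {d | ∀ C ∈ τ, d ∈ I.ext C}

def IsModel (I : Interpretation) (O : Ontology) : Prop := ∀ c ∈ O, I.ext c.lhs ⊆ I.ext c.rhs

end Interpretation

/-- `O ⊨ C ⊑ D`. -/
def Ontology.Entails (O : Ontology) (C D : Concept) : Prop :=
  ∀ I : Interpretation, I.IsModel O → I.ext C ⊆ I.ext D

/-- `D` is an `L`-interpolant for `C₁ ⊑ C₂` under `O₁, O₂`. -/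
structure IsInterpolant (L : Dialect) (O₁ O₂ : Ontology) (C₁ C₂ D : Concept) : Prop where
  admits : L.Admits D
  sig_subset : D.sig ⊆ (O₁.sig ∪ C₁.sig) ∩ (O₂.sig ∪ C₂.sig)
  left : (O₁ ∪ O₂).Entails C₁ D
  right : (O₁ ∪ O₂).Entails D C₂

/-! ## ABoxes -/

/-- ABox assertions `⊤(x)`, `A(x)`, `{a}(x)`, `r(x,y)` over individual variables from `V`. -/
inductive Assertion (V : Type) : Type
  | top (x : V) : Assertion V
  | con (A : ℕ) (x : V) : Assertion V
  | nom (a : ℕ) (x : V) : Assertion V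
  | rol (r : ℕ) (x y : V) : Assertion V

namespace Assertion

variable {V W : Type}

def vars : Assertion V → Set V
  | .top x => {x}
  | .con _ x => {x}
  | .nom _ x => {x}
  | .rol _ x y => {x, y}

/-- Renaming of individual variables. -/
def map (f : V → W) : Assertion V → Assertion W
  | .top x => .top (f x)
  | .con A x => .con A (f x)
  | .nom a x => .nom a (f x)
  | .rol r x y => .rol r (f x) (f y)

/-- `I, v` satisfies the assertion. -/
def Sat (I : Interpretation) (v : V → I.Dom) : Assertion V → Prop
  | .top _ => True
  | .con A x => v x ∈ I.con A
  | .nom a x => I.ind a = v x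
  | .rol r x y => I.rol r (v x) (v y)

end Assertion

/-- A possibly infinite ABox. -/
abbrev ABox (V : Type) := Set (Assertion V)

namespace ABox

variable {V : Type}

/-- `ind(𝒜)`. -/
def ind (𝒜 : ABox V) : Set V := {x | ∃ α ∈ 𝒜, x ∈ α.vars}

def Sat (I : Interpretation) (v : V → I.Dom) (𝒜 : ABox V) : Prop := ∀ α ∈ 𝒜, α.Sat I v

/-- `I ⊨ 𝒜[x ↦ d]`. -/
def SatAt (I : Interpretation) (𝒜 : ABox V) (x : V) (d : I.Dom) : Prop :=
  ∃ v : V → I.Dom, v x = d ∧ Sat I v 𝒜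

/-- `O, 𝒜 ⊨ B(x)` for a concept name `B`. -/
def Entails (O : Ontology) (𝒜 : ABox V) (B : ℕ) (x : V) : Prop :=
  ∀ I : Interpretation, I.IsModel O → ∀ v : V → I.Dom, Sat I v 𝒜 → v x ∈ I.con B

/-- Adjacency in the undirected graph of `𝒜`, loops included. -/
def Adj (𝒜 : ABox V) (x y : V) : Prop := ∃ r, Assertion.rol r x y ∈ 𝒜 ∨ Assertion.rol r y x ∈ 𝒜

/-- The last condition also excludes assertions `r(x,x)`, so that nothing is lost by using a
simple graph in the first one. -/
structure TreeShaped (𝒜 : ABox V) : Prop where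
  acyclic : (SimpleGraph.fromRel (Adj 𝒜)).IsAcyclic
  unique_role : ∀ r s x y, Assertion.rol r x y ∈ 𝒜 → Assertion.rol s x y ∈ 𝒜 → r = s
  antisymm : ∀ r s x y, Assertion.rol r x y ∈ 𝒜 → Assertion.rol s y x ∉ 𝒜

/-- `𝒜` is tree-shaped after dropping some `r(x,y)` with `{a}(x) ∈ 𝒜` or `{a}(y) ∈ 𝒜`, `a ∈ Γ`. -/
def TreeShapedModulo (𝒜 : ABox V) (Γ : Set ℕ) : Prop :=
  ∃ 𝒟 ⊆ 𝒜,
    (∀ α ∈ 𝒟, ∃ r x y, α = Assertion.rol r x y ∧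
      ∃ a ∈ Γ, Assertion.nom a x ∈ 𝒜 ∨ Assertion.nom a y ∈ 𝒜) ∧
    TreeShaped (𝒜 \ 𝒟)

/-- There is an undirected path from `x` to `y`. -/
def Reach (𝒜 : ABox V) : V → V → Prop := Relation.ReflTransGen (Adj 𝒜)

def WeaklyRooted (𝒜 : ABox V) (x : V) : Prop := ∀ y ∈ ind 𝒜, Reach 𝒜 x y

/-- The sub-ABox of `𝒜` that is weakly rooted in `x`. -/
def rootedPart (𝒜 : ABox V) (x : V) : ABox V := {α ∈ 𝒜 | ∀ y ∈ α.vars, Reach 𝒜 x y}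

end ABox

/-- The `L`-concept `C` over the signature `S` corresponds to the pointed ABox `𝒜, x`: the ABox
is tree-shaped modulo the individual names of `S`, it is weakly rooted if `L` lacks the universal
role, and `C` has the same meaning as `𝒜, x`. (Such a `C` is unique up to equivalence.) -/
structure Corresponds (L : Dialect) (S : Signature) {V : Type} (𝒜 : ABox V) (x : V)
    (C : Concept) : Prop where
  admits : L.Admits C
  sig_subset : C.sig ⊆ S
  mem_ind : x ∈ 𝒜.ind
  treeShaped : 𝒜.TreeShapedModulo S.indNames
  rooted : L = .elio → 𝒜.WeaklyRooted x
  ext_iff : ∀ (I : Interpretation) (d : I.Dom), d ∈ I.ext C ↔ 𝒜.SatAt I x d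

/-- The `S`-reduct of `I`, regarded as an ABox whose individual variables are the elements of the
domain. Every element occurs in it, by means of `⊤(x)`. -/
def Interpretation.reductABox (I : Interpretation) (S : Signature) : ABox I.Dom :=
  {α | match α with
    | .top _ => True
    | .con A x => NLSym.con A ∈ S ∧ x ∈ I.con A
    | .nom a x => NLSym.ind a ∈ S ∧ I.ind a = x
    | .rol r x y => NLSym.rol r ∈ S ∧ I.rol r x y}

/-! ## Words and the undirected unfolding -/

/-- Words `x₀ R₁ x₁ ⋯ Rₙ xₙ` with `n ≥ 0`. -/
inductive Word (X : Type) : Type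
  | base (x : X) : Word X
  | snoc (w : Word X) (R : Role) (x : X) : Word X

namespace Word

variable {X Y : Type}

/-- The last letter. -/
def tail : Word X → X
  | .base x => x
  | .snoc _ _ x => x

def map (f : X → Y) : Word X → Word Y
  | .base x => .base (f x)
  | .snoc w R x => .snoc (w.map f) R (f x)

end Word

namespace ABox

variable {V : Type}

/-- `R(x,y) ∈ 𝒜`, where `r⁻(x,y)` is read as `r(y,x)`. -/
def HasRole (𝒜 : ABox V) : Role → V → V → Prop
  | .name r, x, y => Assertion.rol r x y ∈ 𝒜
  | .inv r, x, y => Assertion.rol r y x ∈ 𝒜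

/-- `{a}(x) ∈ 𝒜` for some `a ∈ Γ`. -/
def IsNominal (𝒜 : ABox V) (Γ : Set ℕ) (x : V) : Prop := ∃ a ∈ Γ, Assertion.nom a x ∈ 𝒜

/-- The words that are the individuals of the undirected unfolding. -/
def IsUnfoldWord (𝒜 : ABox V) (Γ : Set ℕ) : Word V → Prop
  | .base x => x ∈ ind 𝒜
  | .snoc w R x => IsUnfoldWord 𝒜 Γ w ∧ ¬ IsNominal 𝒜 Γ x ∧ HasRole 𝒜 R w.tail x

/-- The assertions of the undirected unfolding. -/
inductive UnfoldFact (𝒜 : ABox V) (Γ : Set ℕ) : Assertion (Word V) → Prop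
  | top (w : Word V) : IsUnfoldWord 𝒜 Γ w → Assertion.top w.tail ∈ 𝒜 →
      UnfoldFact 𝒜 Γ (.top w)
  | con (A : ℕ) (w : Word V) : IsUnfoldWord 𝒜 Γ w → Assertion.con A w.tail ∈ 𝒜 →
      UnfoldFact 𝒜 Γ (.con A w)
  | nom (a : ℕ) (x : V) : a ∈ Γ → Assertion.nom a x ∈ 𝒜 →
      UnfoldFact 𝒜 Γ (.nom a (.base x))
  | child (r : ℕ) (w : Word V) (x : V) : IsUnfoldWord 𝒜 Γ (.snoc w (.name r) x) →
      UnfoldFact 𝒜 Γ (.rol r w (.snoc w (.name r) x))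
  | childInv (r : ℕ) (w : Word V) (x : V) : IsUnfoldWord 𝒜 Γ (.snoc w (.inv r) x) →
      UnfoldFact 𝒜 Γ (.rol r (.snoc w (.inv r) x) w)
  | toNominal (r : ℕ) (w : Word V) (x : V) : IsUnfoldWord 𝒜 Γ w → IsNominal 𝒜 Γ x →
      Assertion.rol r w.tail x ∈ 𝒜 → UnfoldFact 𝒜 Γ (.rol r w (.base x))
  | ofNominal (r : ℕ) (w : Word V) (x : V) : IsUnfoldWord 𝒜 Γ w → IsNominal 𝒜 Γ x →
      Assertion.rol r x w.tail ∈ 𝒜 → UnfoldFact 𝒜 Γ (.rol r (.base x) w)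

/-- The undirected unfolding of `𝒜` modulo `Γ`. -/
def unfold (𝒜 : ABox V) (Γ : Set ℕ) : ABox (Word V) := {α | UnfoldFact 𝒜 Γ α}

/-- The rooted undirected unfolding of `𝒜, x` modulo `Γ`. -/
def rootedUnfold (𝒜 : ABox V) (Γ : Set ℕ) (x : V) : ABox (Word V) :=
  rootedPart (unfold 𝒜 Γ) (.base x)

end ABox

/-! ## The canonical model of an ontology and a concept name -/

section Canonical

variable (O : Ontology) (A : ℕ)

/-- The concepts that types consist of: `sub(O)`, all `∃R.{a}` over the signature of `O`, and
`A`, `∃u.A`. -/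
def typeConcepts : Set Concept :=
  O.sub ∪
    {C | ∃ (R : Role) (a : ℕ), NLSym.rol R.base ∈ O.sig ∧ NLSym.ind a ∈ O.sig ∧
      C = .ex R (.nom a)} ∪
    {.name A, .exU (.name A)}

/-- Types: sets of such concepts that are closed under consequence. -/
def IsType (τ : Set Concept) : Prop :=
  τ ⊆ typeConcepts O A ∧
    ∀ C ∈ typeConcepts O A,
      (∀ I : Interpretation, I.IsModel O → I.extAll τ ⊆ I.ext C) → C ∈ τ

/-- `τ₂` is a maximal type with `O ⊨ τ₁ ⊑ ∃R.τ₂`. -/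
def TypeSucc (R : Role) (τ₁ τ₂ : Set Concept) : Prop :=
  Maximal (fun τ => IsType O A τ ∧
    ∀ I : Interpretation, I.IsModel O → ∀ d ∈ I.extAll τ₁, ∃ e, I.rel R d e ∧ e ∈ I.extAll τ) τ₂

/-- The minimal type that contains `C` and `∃u.A`, for `C` among the concepts that types
consist of. -/
def leastType (C : Concept) : Set Concept :=
  {D ∈ typeConcepts O A | O.Entails (.and C (.exU (.name A))) D}

/-- The types `τ_B` of concept names `B` with `O ⊨ A ⊑ ∃u.B`. -/
def conceptTypes : Set (Set Concept) :=
  {τ | ∃ B : ℕ, O.Entails (.name A) (.exU (.name B)) ∧ τ = leastType O A (.name B)}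

/-- The types `τ_a` of individual names `a` in the signature of `O`. -/
def nominalTypes : Set (Set Concept) :=
  {τ | ∃ a : ℕ, NLSym.ind a ∈ O.sig ∧ τ = leastType O A (.nom a)}

/-- The words that are the elements of the canonical model. -/
def IsCanonicalWord : Word (Set Concept) → Prop
  | .base τ => τ ∈ conceptTypes O A ∪ nominalTypes O A
  | .snoc w R τ => IsCanonicalWord w ∧ τ ∉ nominalTypes O A ∧ TypeSucc O A R w.tail τ

abbrev CanonicalDom : Type := {w : Word (Set Concept) // IsCanonicalWord O A w}

/-- The element `ρ_A`. -/
def canonicalRoot : CanonicalDom O A :=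
  ⟨.base (leastType O A (.name A)), Or.inl ⟨A, fun _ _ d hd => ⟨d, hd⟩, rfl⟩⟩

open Classical in
/-- The canonical model of `O` and `A`. Individual names that do not occur in `O` are irrelevant;
they denote `ρ_A`. -/
noncomputable def canonicalModel : Interpretation where
  Dom := CanonicalDom O A
  con B := {w | .name B ∈ w.1.tail}
  rol r w w' :=
    (∃ τ, w'.1 = .snoc w.1 (.name r) τ) ∨
    (∃ τ, w.1 = .snoc w'.1 (.inv r) τ) ∨
    (∃ a, .ex (.name r) (.nom a) ∈ w.1.tail ∧ w'.1 = .base (leastType O A (.nom a))) ∨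
    (∃ a, .ex (.inv r) (.nom a) ∈ w'.1.tail ∧ w.1 = .base (leastType O A (.nom a)))
  ind a :=
    if h : NLSym.ind a ∈ O.sig then
      ⟨.base (leastType O A (.nom a)), Or.inr ⟨a, h, rfl⟩⟩
    else canonicalRoot O A

/-- The ABox that has to entail `B(ρ_A)`: the `S`-reduct of the canonical model for `ELIO_u`, and
its sub-ABox weakly rooted in `ρ_A` for `ELIO`. -/
noncomputable def canonicalABox (S : Signature) : Dialect → ABox (CanonicalDom O A)
  | .eliou => (canonicalModel O A).reductABox S
  | .elio => ABox.rootedPart ((canonicalModel O A).reductABox S) (canonicalRoot O A)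

/-- Its undirected unfolding for `ELIO_u`, and its rooted undirected unfolding for `ELIO`. -/
noncomputable def unfoldedABox (S : Signature) : Dialect → ABox (Word (CanonicalDom O A))
  | .eliou => (canonicalABox O A S .eliou).unfold S.indNames
  | .elio => (canonicalABox O A S .elio).rootedUnfold S.indNames (canonicalRoot O A)

end Canonical

/-- The common signature of `O₁, A` and `O₂, B`. -/
def commonSig (O₁ O₂ : Ontology) (A B : ℕ) : Signature :=
  (O₁.sig ∪ (Concept.name A).sig) ∩ (O₂.sig ∪ (Concept.name B).sig)

/-- `𝒜` is a finite subset of the (rooted) undirected unfolding with at most `N` individuals, and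
the `L`-concept that corresponds to `𝒜, ρ_A` is an `L`-interpolant for `A ⊑ B` under `O₁, O₂`. -/
structure IsWitness (L : Dialect) (O₁ O₂ : Ontology) (A B N : ℕ)
    (𝒜 : ABox (Word (CanonicalDom (O₁ ∪ O₂) A))) : Prop where
  finite : 𝒜.Finite
  subset : 𝒜 ⊆ unfoldedABox (O₁ ∪ O₂) A (commonSig O₁ O₂ A B) L
  card_le : 𝒜.ind.ncard ≤ N
  interpolant : ∃ C : Concept,
    Corresponds L (commonSig O₁ O₂ A B) 𝒜 (.base (canonicalRoot (O₁ ∪ O₂) A)) C ∧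
      IsInterpolant L O₁ O₂ (.name A) (.name B) C

/-! ## A model of computation with running times

Programs of a WHILE language over binary trees. Copying the value of a variable costs the size of
the value, and any other operation costs one step; hence running times agree with those of
multitape Turing machines up to a polynomial. -/

/-- Binary trees. -/
inductive Data : Type
  | nil : Data
  | cons (l r : Data) : Data

def Data.size : Data → ℕ
  | .nil => 1
  | .cons l r => l.size + r.size + 1

def Data.hd : Data → Data
  | .nil => .nil
  | .cons l _ => l

def Data.tl : Data → Data
  | .nil => .nil
  | .cons _ r => r

/-- The contents of the variables. -/
abbrev Store := ℕ → Data

inductive Expr : Type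
  | var (i : ℕ) : Expr
  | nil : Expr
  | cons (e f : Expr) : Expr
  | hd (e : Expr) : Expr
  | tl (e : Expr) : Expr

namespace Expr

def eval (s : Store) : Expr → Data
  | .var i => s i
  | .nil => .nil
  | .cons e f => .cons (e.eval s) (f.eval s)
  | .hd e => (e.eval s).hd
  | .tl e => (e.eval s).tl

def cost (s : Store) : Expr → ℕ
  | .var i => (s i).size
  | .nil => 1
  | .cons e f => e.cost s + f.cost s + 1
  | .hd e => e.cost s + 1
  | .tl e => e.cost s + 1

end Expr

inductive Prog : Type
  | assign (i : ℕ) (e : Expr) : Prog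
  | seq (P Q : Prog) : Prog
  | cond (i : ℕ) (P Q : Prog) : Prog
  | loop (i : ℕ) (P : Prog) : Prog

/-- `Exec P s n s'`: started with `s`, the program `P` stops with `s'` after `n` steps. `cond i P Q`
executes `P` if variable `i` is not `nil` and `Q` otherwise; `loop i P` repeats `P` as long as
variable `i` is not `nil`. -/
inductive Prog.Exec : Prog → Store → ℕ → Store → Prop
  | assign (i : ℕ) (e : Expr) (s : Store) :
      Exec (.assign i e) s (e.cost s + 1) (Function.update s i (e.eval s))
  | seq {P Q : Prog} {s s' s'' : Store} {m n : ℕ} :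
      Exec P s m s' → Exec Q s' n s'' → Exec (.seq P Q) s (m + n + 1) s''
  | condTrue {i : ℕ} {P Q : Prog} {s s' : Store} {n : ℕ} :
      s i ≠ .nil → Exec P s n s' → Exec (.cond i P Q) s (n + 1) s'
  | condFalse {i : ℕ} {P Q : Prog} {s s' : Store} {n : ℕ} :
      s i = .nil → Exec Q s n s' → Exec (.cond i P Q) s (n + 1) s'
  | loopStop {i : ℕ} {P : Prog} {s : Store} :
      s i = .nil → Exec (.loop i P) s 1 s
  | loopStep {i : ℕ} {P : Prog} {s s' s'' : Store} {m n : ℕ} :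
      s i ≠ .nil → Exec P s m s' → Exec (.loop i P) s' n s'' →
        Exec (.loop i P) s (m + n + 1) s''

/-- With `x` in variable `0` and `nil` in all others, `P` stops after at most `t` steps and leaves
`y` in variable `0`. -/
def Prog.OutputsWithin (P : Prog) (x : Data) (t : ℕ) (y : Data) : Prop :=
  ∃ n ≤ t, ∃ s : Store, P.Exec (Function.update (fun _ => Data.nil) 0 x) n s ∧ s 0 = y

/-! ## Inputs and outputs as binary trees

Names are written in binary. -/

def encBool : Bool → Data
  | false => .nil
  | true => .cons .nil .nil

def encList {α : Type} (f : α → Data) : List α → Data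
  | [] => .nil
  | a :: l => .cons (f a) (encList f l)

def encNat (n : ℕ) : Data := encList encBool n.bits

def encUnary : ℕ → Data
  | 0 => .nil
  | k + 1 => .cons .nil (encUnary k)

/-- A tree labelled with a tag. -/
def encTag (k : ℕ) (t : Data) : Data := .cons (encUnary k) t

def encRole : Role → Data
  | .name r => encTag 0 (encNat r)
  | .inv r => encTag 1 (encNat r)

def encConcept : Concept → Data
  | .top => encTag 0 .nil
  | .name A => encTag 1 (encNat A)
  | .nom a => encTag 2 (encNat a)
  | .and C D => encTag 3 (.cons (encConcept C) (encConcept D))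
  | .ex R C => encTag 4 (.cons (encRole R) (encConcept C))
  | .exU C => encTag 5 (encConcept C)

def encInclusion (c : Inclusion) : Data := .cons (encConcept c.lhs) (encConcept c.rhs)

/-- The input: two ontologies, given as lists of inclusions, and two concept names. -/
def encInput (l₁ l₂ : List Inclusion) (A B : ℕ) : Data :=
  .cons (.cons (encList encInclusion l₁) (encList encInclusion l₂)) (.cons (encNat A) (encNat B))

def encWord {X : Type} (f : X → Data) : Word X → Data
  | .base x => encTag 0 (f x)
  | .snoc w R x => encTag 1 (.cons (encWord f w) (.cons (encRole R) (f x)))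

def encAssertion {V : Type} (f : V → Data) : Assertion V → Data
  | .top x => encTag 0 (f x)
  | .con A x => encTag 1 (.cons (encNat A) (f x))
  | .nom a x => encTag 2 (.cons (encNat a) (f x))
  | .rol r x y => encTag 3 (.cons (encNat r) (.cons (f x) (f y)))

/-- A finite ABox whose individuals are words over words over types, written down with every type
as a list of concepts. -/
abbrev ABoxCode := List (Assertion (Word (Word (List Concept))))

def encABoxCode : ABoxCode → Data :=
  encList (encAssertion (encWord (encWord (encList encConcept))))

/-- The list `c` of written assertions denotes the ABox `𝒜`. -/
def ABoxCode.Denotes (c : ABoxCode) {O : Ontology} {A : ℕ} (𝒜 : ABox (Word (CanonicalDom O A))) :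
    Prop :=
  {α | ∃ β ∈ c, α = β.map (Word.map (Word.map fun l => {C : Concept | C ∈ l}))} =
    Assertion.map (Word.map Subtype.val) '' 𝒜

end DescrLogic

/-! ### Compatible labellings of forests with nominals -/

namespace DescrLogic

/-! An interpolant exists as soon as the part of the canonical model that is visible in Σ forces
`B`. If `D` is an interpolant, it holds at the root of the canonical model. As `D` is positive
existential and uses only Σ, it also holds at the image of the root in every interpretation that
satisfies the ABox of Point 2, and there it implies `B` (`entails_of_interpolant`).

For the converse the witness is explicit: `truncABox`, the restriction of the unfolding to words of
length at most `2 ^ (4 * c + 6)`, where `c` is the number of concepts that types consist of. It is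
finite and tree-shaped modulo nominals, hence expressible by a concept (`exists_corresponds`). This
concept subsumes `A`, because the canonical model maps homomorphically into every model with an
instance of `A` (`exists_hom_canonicalModel`). That it is subsumed by `B` is the heart of the matter
(`entails_truncABox`).

Suppose that a model `I` satisfies the truncation without `B` at the root. Inclusions in normal form
are Horn, so the intersections of types of elements of `I`, with all edges that the ontology
permits, again form a model (`meetModel`). The types of the elements that interpret the truncation
are labels of canonical words that survive many rounds of local checks along edges.
`exists_labelling` turns them into labels of the entire canonical model, or of the part reachable
from the root, that are compatible along all visible edges. This is an assignment into `meetModel`,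
and the label of the root is contained in the original type of the root, so that it lacks `B`; the
ABox of Point 2 does not entail `B` either.

In `exists_labelling` the sets of surviving labels are closed under meets and decrease from round to
round. By a pigeonhole argument there is a long window of rounds in which the labels of nominals do
not change. Nominals receive the least labels of the window; from the roots downward, other words
receive the least label that fits the parent and extends to the tree below. Least labels lie below
all surviving ones, which makes the links to nominals compatible. Labels are computed by a finite
automaton along the word, so statements on long words reduce to short ones.

For the algorithm, the truncation is computed literally. The functions involved are polynomial in
lists of exponential or doubly exponential size, obtained from sublists and bounded words. The
entailments that define types are decided by filtration, a search through all sets of types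
(`Context.Fits.forall_iff`). The output always denotes the truncation (`Input.denotes_output`), and
by the equivalence the truncation is a witness whenever any witness exists. -/

/-- The inverse of a role. -/
def Role.flip : Role → Role
  | .name r => .inv r
  | .inv r => .name r

@[simp] theorem Role.flip_flip (R : Role) : R.flip.flip = R := by cases R <;> rfl

@[simp] theorem Role.base_flip (R : Role) : R.flip.base = R.base := by cases R <;> rfl

/-- The number of steps of a word. -/
def Word.len {X : Type} : Word X → ℕ
  | .base _ => 0
  | .snoc w _ _ => w.len + 1

/-- A decreasing sequence of subsets of a finite set repeats within as many steps as the set has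
elements. -/
theorem exists_stable_of_antitone {α : Type*} (F : ℕ → Set α) {U : Set α} (hU : U.Finite)
    (h0 : F 0 ⊆ U) (hanti : ∀ i, F (i + 1) ⊆ F i) : ∃ j ≤ U.ncard, F (j + 1) = F j := by
  by_contra! hne
  have hsub : ∀ i, F i ⊆ U := fun i => by
    induction i with
    | zero => exact h0
    | succ i ih => exact (hanti i).trans ih
  -- Every strict inclusion costs an element, so the set with index `j` has lost at least `j` of
  -- them; the index `U.ncard + 1` is impossible.
  have key : ∀ j ≤ U.ncard + 1, (F j).ncard + j ≤ U.ncard := by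
    intro j
    induction j with
    | zero => intro _; simpa using Set.ncard_le_ncard h0 hU
    | succ j ih =>
      intro hj
      have h1 := ih (by omega)
      have h2 : F (j + 1) ⊂ F j := (hanti j).ssubset_of_ne (hne j (by omega))
      have h3 := Set.ncard_lt_ncard h2 (hU.subset (hsub j))
      omega
  have := key _ le_rfl
  omega

/-! ## Labelling forests with nominals -/

/-- Words over `X` form a forest with additional links to the roots in `nom`; its elements are to be
labelled with elements of `T` so that the labels are compatible along edges. -/
structure LabelProblem (X T : Type) [SemilatticeInf T] where
  base : Set X
  nom : Set X
  succ : Role → X → X → Prop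
  link : Role → X → X → Prop
  obs : Set Role
  letters : Set X
  comp : Role → T → T → Prop
  loc : X → T → Prop
  nom_base : nom ⊆ base
  link_nom : ∀ {R τ ν}, link R τ ν → ν ∈ nom
  obs_flip : ∀ {R}, R ∈ obs → R.flip ∈ obs
  comp_flip : ∀ {R s t}, comp R s t → comp R.flip t s
  comp_inf : ∀ {R s t s' t'}, comp R s t → comp R s' t' → comp R (s ⊓ s') (t ⊓ t')
  loc_inf : ∀ {τ s t}, loc τ s → loc τ t → loc τ (s ⊓ t)
  letters_finite : letters.Finite
  base_letters : base ⊆ letters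
  succ_letters : ∀ {R τ τ'}, succ R τ τ' → τ' ∈ letters

namespace LabelProblem

variable {X T : Type} [SemilatticeInf T] (D : LabelProblem X T)

def Valid : Word X → Prop
  | .base τ => τ ∈ D.base
  | .snoc w R τ => Valid w ∧ τ ∉ D.nom ∧ D.succ R w.tail τ

theorem Valid.tail_mem {w : Word X} (h : D.Valid w) : w.tail ∈ D.letters := by
  cases w with
  | base τ => exact D.base_letters h
  | snoc w R τ => exact D.succ_letters h.2.2

/-- The cases are: child, parent, link to a nominal, link from a nominal. Edges outside `obs` are
absent, as the reduct to the signature forgets them. -/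
def Edge (R : Role) (w y : Word X) : Prop :=
  R ∈ D.obs ∧ ((∃ τ, y = .snoc w R τ) ∨ (∃ τ, w = .snoc y R.flip τ) ∨
    (∃ ν, D.link R w.tail ν ∧ y = .base ν) ∨ (∃ ν, D.link R.flip y.tail ν ∧ w = .base ν))

/-- The labels of `w` that admit `k` rounds of local checks in words of length at most `N`. -/
def good (N : ℕ) : ℕ → Word X → Set T
  | 0, w => {t | D.loc w.tail t}
  | k + 1, w => {t | t ∈ good N k w ∧ ∀ R y, D.Valid y → y.len ≤ N → D.Edge R w y →
      ∃ t' ∈ good N k y, D.comp R t t'}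

theorem good_succ_subset (N k : ℕ) (w : Word X) : D.good N (k + 1) w ⊆ D.good N k w :=
  fun _ h => h.1

theorem good_anti (N : ℕ) {k l : ℕ} (h : k ≤ l) (w : Word X) : D.good N l w ⊆ D.good N k w := by
  induction h with
  | refl => exact subset_rfl
  | step _ ih => exact (D.good_succ_subset N _ w).trans ih

theorem good_loc {N k : ℕ} {w : Word X} {t : T} (h : t ∈ D.good N k w) : D.loc w.tail t :=
  D.good_anti N (Nat.zero_le k) w h

/-- Both the local condition and the edge condition are closed under meets. This is what makes least
labels available. -/
theorem good_inf {N k : ℕ} {w : Word X} {s t : T} (hs : s ∈ D.good N k w)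
    (ht : t ∈ D.good N k w) : s ⊓ t ∈ D.good N k w := by
  induction k generalizing w s t with
  | zero => exact D.loc_inf hs ht
  | succ k ih =>
    refine ⟨ih hs.1 ht.1, fun R y hy hl he => ?_⟩
    obtain ⟨s', hs', hc⟩ := hs.2 R y hy hl he
    obtain ⟨t', ht', hc'⟩ := ht.2 R y hy hl he
    exact ⟨_, ih hs' ht', D.comp_inf hc hc'⟩

/-- The labels of a root of type `τ` that extend to the tree below it up to depth `j`, if the
nominals are labelled from `H`. -/
def down (H : X → Set T) : ℕ → X → Set T
  | 0, τ => {t | D.loc τ t ∧ ∀ R ν, R ∈ D.obs → D.link R τ ν → ∃ t' ∈ H ν, D.comp R t t'}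
  | j + 1, τ => {t | t ∈ down H j τ ∧ ∀ R τ', R ∈ D.obs → τ' ∉ D.nom → D.succ R τ τ' →
      ∃ t' ∈ down H j τ', D.comp R t t'}

variable (H : X → Set T)

theorem down_zero {j : ℕ} {τ : X} {t : T} (h : t ∈ D.down H j τ) : t ∈ D.down H 0 τ := by
  induction j with
  | zero => exact h
  | succ j ih => exact ih h.1

theorem down_inf (hH : ∀ ν, ∀ s ∈ H ν, ∀ t ∈ H ν, s ⊓ t ∈ H ν) {j : ℕ} {τ : X} {s t : T}
    (hs : s ∈ D.down H j τ) (ht : t ∈ D.down H j τ) : s ⊓ t ∈ D.down H j τ := by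
  induction j generalizing τ s t with
  | zero =>
    refine ⟨D.loc_inf hs.1 ht.1, fun R ν hR hl => ?_⟩
    obtain ⟨s', hs', hc⟩ := hs.2 R ν hR hl
    obtain ⟨t', ht', hc'⟩ := ht.2 R ν hR hl
    exact ⟨_, hH _ _ hs' _ ht', D.comp_inf hc hc'⟩
  | succ j ih =>
    refine ⟨ih hs.1 ht.1, fun R ν hR hn hl => ?_⟩
    obtain ⟨s', hs', hc⟩ := hs.2 R ν hR hn hl
    obtain ⟨t', ht', hc'⟩ := ht.2 R ν hR hn hl
    exact ⟨_, ih hs' ht', D.comp_inf hc hc'⟩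

/-- Counting pairs of a letter and a label lets one depth serve all letters. At this depth a label
has compatible labels at all children without any loss of depth, so that it extends to the infinite
tree. -/
theorem exists_down_stable [Finite T] : ∃ K ≤ D.letters.ncard * Nat.card T,
    ∀ τ ∈ D.letters, D.down H (K + 1) τ = D.down H K τ := by
  have hfin : (D.letters ×ˢ (Set.univ : Set T)).Finite := D.letters_finite.prod Set.finite_univ
  obtain ⟨K, hK, h⟩ := exists_stable_of_antitone
    (fun j => {p : X × T | p.1 ∈ D.letters ∧ p.2 ∈ D.down H j p.1}) hfin
    (fun p hp => ⟨hp.1, trivial⟩) (fun i p hp => ⟨hp.1, hp.2.1⟩)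
  rw [Set.ncard_prod, Set.ncard_univ] at hK
  refine ⟨K, hK, fun τ hτ => Set.Subset.antisymm (fun _ h => h.1) fun t ht => ?_⟩
  have : (τ, t) ∈ {p : X × T | p.1 ∈ D.letters ∧ p.2 ∈ D.down H K p.1} := ⟨hτ, ht⟩
  rw [← h] at this
  exact this.2

open Classical in
/-- The least element of a set, if there is one. -/
noncomputable def leastOf (P : Set T) : Option T := if h : ∃ t, IsLeast P t then some h.choose else none

theorem isLeast_of_leastOf {P : Set T} {t : T} (h : leastOf P = some t) : IsLeast P t := by
  unfold leastOf at h
  split_ifs at h with h'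
  cases h
  exact h'.choose_spec

/-- A minimal element of a set closed under meets is least: its meet with any other element is in
the set and below it. -/
theorem exists_leastOf [Finite T] {P : Set T} (hP : ∀ s ∈ P, ∀ t ∈ P, s ⊓ t ∈ P) {t : T}
    (ht : t ∈ P) : ∃ s, leastOf P = some s ∧ s ≤ t := by
  have : ∃ s, IsLeast P s := by
    obtain ⟨m, hm⟩ := (Set.toFinite P).exists_minimal ⟨t, ht⟩
    exact ⟨m, hm.prop, fun s hs => (hm.le_of_le (hP _ hm.prop _ hs) inf_le_left).trans inf_le_right⟩
  refine ⟨this.choose, by simp [leastOf, this], this.choose_spec.2 ht⟩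

open Classical in
/-- The least label of a word, given the labels of its parent. -/
noncomputable def label (K : ℕ) : Word X → Option T
  | .base τ => if τ ∈ D.nom then leastOf (H τ) else leastOf (D.down H K τ)
  | .snoc w R τ =>
    if R ∈ D.obs then
      (label K w).bind fun t => leastOf {t' ∈ D.down H K τ | D.comp R t t'}
    else leastOf (D.down H K τ)

/-- Every valid word can be replaced by a short one with the same last letter and label. -/
theorem exists_short [Finite T] (K : ℕ) {w : Word X} (hw : D.Valid w) :
    ∃ w', D.Valid w' ∧ w'.len ≤ D.letters.ncard * (Nat.card T + 1) ∧ w'.tail = w.tail ∧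
      D.label H K w' = D.label H K w := by
  have hfin : (D.letters ×ˢ (Set.univ : Set (Option T))).Finite :=
    D.letters_finite.prod Set.finite_univ
  -- The pairs of last letter and label realized by words of length at most `i`. Their complements
  -- decrease, so from some length on nothing new is realized.
  let Q : ℕ → Set (X × Option T) := fun i =>
    {p | ∃ w', D.Valid w' ∧ w'.len ≤ i ∧ w'.tail = p.1 ∧ D.label H K w' = p.2}
  obtain ⟨L, hL, h⟩ := exists_stable_of_antitone
    (fun j => (D.letters ×ˢ (Set.univ : Set (Option T))) \ Q j) hfin Set.sdiff_subset
    (fun i => Set.sdiff_subset_sdiff_right fun p ⟨w', h1, h2, h3⟩ => ⟨w', h1, by omega, h3⟩)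
  rw [Set.ncard_prod, Set.ncard_univ, Finite.card_option] at hL
  have hQ : ∀ w, D.Valid w → w.len ≤ L + 1 → (w.tail, D.label H K w) ∈ Q L := by
    intro w hw hl
    by_contra hn
    have : (w.tail, D.label H K w) ∈ (D.letters ×ˢ (Set.univ : Set (Option T))) \ Q L :=
      ⟨⟨hw.tail_mem, trivial⟩, hn⟩
    rw [← h] at this
    exact this.2 ⟨w, hw, hl, rfl, rfl⟩
  -- The label of a child depends only on the label of its parent and on the last step, so the
  -- parent may be exchanged for a short word with the same pair.
  have key : (w.tail, D.label H K w) ∈ Q L := by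
    induction w with
    | base τ => exact ⟨_, hw, Nat.zero_le _, rfl, rfl⟩
    | snoc w R τ ih =>
      obtain ⟨w', h1, h2, h3, h4⟩ := ih hw.1
      have := hQ (.snoc w' R τ) ⟨h1, hw.2.1, h3 ▸ hw.2.2⟩ (by simpa [Word.len] using h2)
      have h5 : D.label H K (.snoc w' R τ) = D.label H K (.snoc w R τ) := by
        simp only [label, h4]
      rwa [h5] at this
  obtain ⟨w', h1, h2, h3, h4⟩ := key
  exact ⟨w', h1, h2.trans hL, h3, h4⟩

/-- If sufficiently many rounds of local checks are possible in sufficiently short words, then there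
is a labelling of all words that are reachable from `w₀`, and of all words if the checks are possible
everywhere. -/
theorem exists_labelling [Finite T] {N M : ℕ} {w₀ : Word X} {t₀ : T} (hw₀ : D.Valid w₀)
    (hlen : w₀.len = 0) (hN : D.letters.ncard * (2 * Nat.card T + 1) ≤ N)
    (hM : (D.letters.ncard * (2 * Nat.card T + 1) + 2) * (D.letters.ncard * Nat.card T + 1) ≤ M)
    (ht₀ : t₀ ∈ D.good N M w₀) :
    ∃ f : Word X → Option T,
      (∀ w t, D.Valid w → f w = some t → D.loc w.tail t) ∧
      (∀ R w y t, D.Valid w → D.Valid y → D.Edge R w y → f w = some t →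
        ∃ t', f y = some t' ∧ D.comp R t t') ∧
      (∃ t, f w₀ = some t ∧ t ≤ t₀) ∧
      ((∀ w, D.Valid w → w.len ≤ N → (D.good N M w).Nonempty) →
        ∀ w, D.Valid w → ∃ t, f w = some t) := by
  set x := D.letters.ncard with hx
  set m := Nat.card T with hm
  -- The length of the window: at most `x * m` levels of `down`, at most `x * (m + 1)` letters of a
  -- short word, one round for a link to a nominal, and one for the offset in `good_down`.
  set s := x * (2 * m + 1) + 2 with hs
  have hxm : x * (2 * m + 1) = x * m + x * (m + 1) := by ring
  -- a window of rounds in which the labels of nominals do not change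
  obtain ⟨k, hkM, hkstable⟩ : ∃ k, k + s ≤ M ∧ ∀ ν ∈ D.nom,
      D.good N (k + s) (.base ν) = D.good N k (.base ν) := by
    have hfin : (D.letters ×ˢ (Set.univ : Set T)).Finite := D.letters_finite.prod Set.finite_univ
    -- Only every `s`-th round is inspected. The pairs of a nominal and a label can decrease at most
    -- `x * m` times, so one of the first `x * m + 1` windows is constant; hence the product in the
    -- bound on `M`.
    obtain ⟨i, hi, h⟩ := exists_stable_of_antitone
      (fun i => {p : X × T | p.1 ∈ D.nom ∧ p.2 ∈ D.good N (i * s) (.base p.1)}) hfin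
      (fun p hp => ⟨D.base_letters (D.nom_base hp.1), trivial⟩)
      (fun i p hp => ⟨hp.1, D.good_anti N (Nat.mul_le_mul_right s (Nat.le_succ i)) _ hp.2⟩)
    rw [Set.ncard_prod, Set.ncard_univ, ← hx, ← hm] at hi
    refine ⟨i * s, ?_, fun ν hν => Set.Subset.antisymm (D.good_anti N (by omega) _) fun t ht => ?_⟩
    · calc i * s + s = s * (i + 1) := by ring
        _ ≤ s * (x * m + 1) := Nat.mul_le_mul_left _ (by omega)
        _ ≤ M := hM
    · have : (ν, t) ∈ {p : X × T | p.1 ∈ D.nom ∧ p.2 ∈ D.good N (i * s) (.base p.1)} := ⟨hν, ht⟩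
      rw [← h] at this
      have h2 : (i + 1) * s = i * s + s := by ring
      rw [← h2]
      exact this.2
  let H : X → Set T := fun ν => D.good N k (.base ν)
  have hH : ∀ ν, ∀ s ∈ H ν, ∀ t ∈ H ν, s ⊓ t ∈ H ν := fun ν s hs t ht => D.good_inf hs ht
  obtain ⟨K, hK, hst⟩ := D.exists_down_stable H
  rw [← hx, ← hm] at hK
  have hdinf : ∀ τ, ∀ s ∈ D.down H K τ, ∀ t ∈ D.down H K τ, s ⊓ t ∈ D.down H K τ :=
    fun τ s hs t ht => D.down_inf H hH hs ht
  have hcinf : ∀ R t τ, ∀ s₁ ∈ {t' ∈ D.down H K τ | D.comp R t t'},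
      ∀ s₂ ∈ {t' ∈ D.down H K τ | D.comp R t t'}, s₁ ⊓ s₂ ∈ {t' ∈ D.down H K τ | D.comp R t t'} :=
    fun R t τ s₁ h₁ s₂ h₂ => ⟨hdinf τ _ h₁.1 _ h₂.1, by
      simpa using D.comp_inf h₁.2 h₂.2⟩
  -- One round more than levels is needed, since level `0` of `down` already checks the links to
  -- nominals.
  have good_down : ∀ j w, D.Valid w → w.len + j ≤ N → D.good N (k + j + 1) w ⊆ D.down H j w.tail := by
    intro j
    induction j with
    | zero =>
      intro w hw hl t ht
      refine ⟨D.good_loc ht, fun R ν hR hlink => ?_⟩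
      exact ht.2 R (.base ν) (D.nom_base (D.link_nom hlink)) (Nat.zero_le _)
        ⟨hR, .inr (.inr (.inl ⟨ν, hlink, rfl⟩))⟩
    | succ j ih =>
      intro w hw hl t ht
      refine ⟨ih w hw (by omega) ht.1, fun R τ' hR hn hsucc => ?_⟩
      obtain ⟨t', ht', hc⟩ := ht.2 R (.snoc w R τ') ⟨hw, hn, hsucc⟩ (by simp only [Word.len]; omega)
        ⟨hR, .inl ⟨τ', rfl⟩⟩
      exact ⟨t', ih (.snoc w R τ') ⟨hw, hn, hsucc⟩ (by simp only [Word.len]; omega) ht', hc⟩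
  -- This uses that the window is constant: labels in `H ν` survive `s` further rounds, enough for
  -- `K` levels below `ν`.
  have H_down : ∀ ν ∈ D.nom, H ν ⊆ D.down H K ν := by
    intro ν hν t ht
    have h1 : t ∈ D.good N (k + s) (.base ν) := by rw [hkstable ν hν]; exact ht
    exact good_down K (.base ν) (D.nom_base hν) (by simp only [Word.len]; omega)
      (D.good_anti N (by omega) _ h1)
  have label_down : ∀ w t, D.label H K w = some t → t ∈ D.down H K w.tail := by
    intro w t h
    cases w with
    | base τ =>
      unfold label at h
      split_ifs at h with hn
      · exact H_down τ hn (isLeast_of_leastOf h).1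
      · exact (isLeast_of_leastOf h).1
    | snoc w R τ =>
      unfold label at h
      split_ifs at h with hn
      · obtain ⟨a, -, h⟩ := Option.bind_eq_some_iff.1 h
        exact (isLeast_of_leastOf h).1.1
      · exact (isLeast_of_leastOf h).1
  have child : ∀ w t R τ, D.Valid w → D.label H K w = some t → R ∈ D.obs → τ ∉ D.nom →
      D.succ R w.tail τ → ∃ t' ∈ D.down H K τ, D.comp R t t' := by
    intro w t R τ hw h hR hn hsucc
    have h1 := label_down w t h
    rw [← hst _ hw.tail_mem] at h1
    exact h1.2 R τ hR hn hsucc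
  -- Computed labels exist and lie below all surviving ones; every letter of the word costs one
  -- round. In the inductive step `t` is compatible with a surviving label `p` of the parent, and
  -- some `t₁` with the computed label `d ≤ p`. Then `t ⊓ t₁` is compatible with `p ⊓ d = d`, hence
  -- a candidate for the least label.
  have label_le : ∀ w, D.Valid w → w.len + K ≤ N → ∀ t ∈ D.good N (k + K + 1 + w.len) w,
      ∃ t', D.label H K w = some t' ∧ t' ≤ t := by
    intro w
    induction w with
    | base τ =>
      intro hw hl t ht
      by_cases hn : τ ∈ D.nom
      · simp only [label, hn, if_true]
        exact exists_leastOf (hH τ) (D.good_anti N (by omega) _ ht)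
      · simp only [label, hn, if_false]
        exact exists_leastOf (hdinf τ) (good_down K (.base τ) hw (by simpa [Word.len] using hl) ht)
    | snoc w R τ ih =>
      intro hw hl t ht
      simp only [Word.len] at hl ht
      have htd : t ∈ D.down H K τ :=
        good_down K (.snoc w R τ) hw (by simp only [Word.len]; omega) (D.good_anti N (by omega) _ ht)
      by_cases hR : R ∈ D.obs
      · obtain ⟨p, hp, hc⟩ := ht.2 R.flip w hw.1 (by omega)
          ⟨D.obs_flip hR, .inr (.inl ⟨τ, by simp⟩)⟩
        obtain ⟨d, hd, hdp⟩ := ih hw.1 (by omega) p hp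
        obtain ⟨t₁, ht₁, hc₁⟩ := child w d R τ hw.1 hd hR hw.2.1 hw.2.2
        have hc' : D.comp R p t := by simpa using D.comp_flip hc
        have hc₂ := D.comp_inf hc' hc₁
        rw [inf_eq_right.2 hdp] at hc₂
        obtain ⟨u, hu, hut⟩ := exists_leastOf (hcinf R d τ) (t := t ⊓ t₁)
          ⟨hdinf τ _ htd _ ht₁, hc₂⟩
        refine ⟨u, ?_, hut.trans inf_le_left⟩
        simp only [label, hR, if_true, hd, Option.bind_some]
        exact hu
      · simp only [label, hR, if_false]
        exact exists_leastOf (hdinf τ) htd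
  -- A nominal has links from words of any length, beyond the reach of the local checks. The short
  -- word with the same last letter and label is within reach and has the same link.
  have label_of_nonempty : ∀ w, D.Valid w → ∀ ν, ∀ h ∈ H ν, ∀ R, R ∈ D.obs → D.link R w.tail ν →
      ∃ t p, D.label H K w = some t ∧ t ≤ p ∧ D.comp R p h := by
    intro w hw ν h hh R hR hlink
    obtain ⟨w', hw', hl', htail, hlab⟩ := D.exists_short H K hw
    rw [← hx, ← hm] at hl'
    have hνn := D.link_nom hlink
    have h1 : h ∈ D.good N (k + s) (.base ν) := by rw [hkstable ν hνn]; exact hh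
    have hs' : k + s = (k + s - 1) + 1 := by omega
    rw [hs'] at h1
    obtain ⟨p, hp, hc⟩ := h1.2 R.flip w' hw' (by omega)
      ⟨D.obs_flip hR, .inr (.inr (.inr ⟨ν, by simpa [htail] using hlink, rfl⟩))⟩
    obtain ⟨t, ht, htp⟩ := label_le w' hw' (by omega) p (D.good_anti N (by omega) _ hp)
    exact ⟨t, p, by rw [← hlab, ht], htp, by simpa using D.comp_flip hc⟩
  have link_comp : ∀ w, D.Valid w → ∀ ν R, R ∈ D.obs → D.link R w.tail ν → (H ν).Nonempty →
      ∃ t h, D.label H K w = some t ∧ D.label H K (.base ν) = some h ∧ D.comp R t h := by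
    intro w hw ν R hR hlink ⟨h₀, hh₀⟩
    obtain ⟨h, hh, -⟩ := exists_leastOf (hH ν) hh₀
    have hhm := (isLeast_of_leastOf hh)
    obtain ⟨t, p, ht, htp, hc⟩ := label_of_nonempty w hw ν h hhm.1 R hR hlink
    obtain ⟨h', hh', hc'⟩ := (D.down_zero H (label_down w t ht)).2 R ν hR hlink
    -- The label `h` of the nominal is compatible with some `p ≥ t`, and `t` with some `h' ≥ h`. The
    -- meet of these two edges joins `t` to `h`.
    have hc₂ := D.comp_inf hc hc'
    rw [inf_eq_right.2 htp, inf_eq_left.2 (hhm.2 hh')] at hc₂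
    exact ⟨t, h, ht, by simp only [label, D.link_nom hlink, if_true, hh], hc₂⟩
  refine ⟨D.label H K, fun w t hw h => (D.down_zero H (label_down w t h)).1, ?_, ?_, ?_⟩
  · rintro R w y t hw hy ⟨hR, ⟨τ, rfl⟩ | ⟨τ, rfl⟩ | ⟨ν, hlink, rfl⟩ | ⟨ν, hlink, rfl⟩⟩ hlab
    · obtain ⟨t', ht', hc⟩ := child w t R τ hw hlab hR hy.2.1 hy.2.2
      obtain ⟨u, hu, -⟩ := exists_leastOf (hcinf R t τ) ⟨ht', hc⟩
      refine ⟨u, ?_, (isLeast_of_leastOf hu).1.2⟩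
      simp only [label, hR, if_true, hlab, Option.bind_some]
      exact hu
    · have hR' := D.obs_flip hR
      simp only [label, hR', if_true] at hlab
      obtain ⟨a, ha, h⟩ := Option.bind_eq_some_iff.1 hlab
      exact ⟨a, ha, by simpa using D.comp_flip (isLeast_of_leastOf h).1.2⟩
    · obtain ⟨h', hh', -⟩ := (D.down_zero H (label_down w t hlab)).2 R ν hR hlink
      obtain ⟨t', h, h1, h2, h3⟩ := link_comp w hw ν R hR hlink ⟨h', hh'⟩
      rw [hlab] at h1
      cases h1
      exact ⟨h, h2, h3⟩
    · have hν := D.link_nom hlink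
      have hmem : t ∈ H ν := by
        simp only [label, hν, if_true] at hlab
        exact (isLeast_of_leastOf hlab).1
      obtain ⟨t', h, h1, h2, h3⟩ := link_comp y hy ν R.flip (D.obs_flip hR) hlink ⟨t, hmem⟩
      rw [hlab] at h2
      cases h2
      exact ⟨t', h1, by simpa using D.comp_flip h3⟩
  · exact label_le w₀ hw₀ (by omega) t₀ (D.good_anti N (by omega) _ ht₀)
  · intro hall w hw
    obtain ⟨w', hw', hl', -, hlab⟩ := D.exists_short H K hw
    rw [← hx, ← hm] at hl'
    obtain ⟨t, ht⟩ := hall w' hw' (by omega)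
    obtain ⟨t', ht', -⟩ := label_le w' hw' (by omega) t (D.good_anti N (by omega) _ ht)
    exact ⟨t', by rw [← hlab, ht']⟩

end LabelProblem
end DescrLogic

/-! ### Types, the universal property of the canonical model, and meets of types -/

namespace DescrLogic

/-! ## Subconcepts and signatures -/

theorem Concept.mem_sub_self (C : Concept) : C ∈ C.sub := by cases C <;> simp [Concept.sub]

theorem Concept.sub_trans {C D E : Concept} (h : C ∈ D.sub) (h' : D ∈ E.sub) : C ∈ E.sub := by
  induction E with
  | top | name _ | nom _ => cases h'; exact h
  | and E F ihE ihF =>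
    rcases h' with (h' | h') | h'
    · cases h'; exact h
    · exact .inl (.inr (ihE h'))
    · exact .inr (ihF h')
  | ex R E ih | exU E ih =>
    rcases h' with h' | h'
    · cases h'; exact h
    · exact .inr (ih h')

theorem Concept.sig_mono {C D : Concept} (h : C ∈ D.sub) : C.sig ⊆ D.sig := by
  induction D with
  | top | name _ | nom _ => cases h; exact subset_rfl
  | and E F ihE ihF =>
    rcases h with (h | h) | h
    · cases h; exact subset_rfl
    · exact (ihE h).trans Set.subset_union_left
    · exact (ihF h).trans Set.subset_union_right
  | ex R E ih =>
    rcases h with h | h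
    · cases h; exact subset_rfl
    · exact (ih h).trans Set.subset_union_right
  | exU E ih =>
    rcases h with h | h
    · cases h; exact subset_rfl
    · exact ih h

theorem Concept.name_mem_sub {C : Concept} {B : ℕ} (h : NLSym.con B ∈ C.sig) :
    Concept.name B ∈ C.sub := by
  induction C with
  | top => cases h
  | nom a => cases h
  | name X => cases h; rfl
  | and E F ihE ihF =>
    rcases h with h | h
    · exact .inl (.inr (ihE h))
    · exact .inr (ihF h)
  | ex R E ih =>
    rcases h with h | h
    · cases h
    · exact .inr (ih h)
  | exU E ih => exact .inr (ih h)

theorem Concept.nom_mem_sub {C : Concept} {a : ℕ} (h : NLSym.ind a ∈ C.sig) :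
    Concept.nom a ∈ C.sub := by
  induction C with
  | top => cases h
  | name a => cases h
  | nom X => cases h; rfl
  | and E F ihE ihF =>
    rcases h with h | h
    · exact .inl (.inr (ihE h))
    · exact .inr (ihF h)
  | ex R E ih =>
    rcases h with h | h
    · cases h
    · exact .inr (ih h)
  | exU E ih => exact .inr (ih h)

theorem Concept.ex_mem_sub {C : Concept} {r : ℕ} (h : NLSym.rol r ∈ C.sig) :
    ∃ R D, R.base = r ∧ Concept.ex R D ∈ C.sub := by
  induction C with
  | top => cases h
  | name a => cases h
  | nom X => cases h
  | and E F ihE ihF =>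
    rcases h with h | h
    · obtain ⟨R, D, h1, h2⟩ := ihE h
      exact ⟨R, D, h1, .inl (.inr h2)⟩
    · obtain ⟨R, D, h1, h2⟩ := ihF h
      exact ⟨R, D, h1, .inr h2⟩
  | ex R E ih =>
    rcases h with h | h
    · cases h; exact ⟨R, E, rfl, .inl rfl⟩
    · obtain ⟨R, D, h1, h2⟩ := ih h
      exact ⟨R, D, h1, .inr h2⟩
  | exU E ih =>
    obtain ⟨R, D, h1, h2⟩ := ih h
    exact ⟨R, D, h1, .inr h2⟩

theorem Concept.sub_finite (C : Concept) : C.sub.Finite := by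
  induction C with
  | top | name _ | nom _ => exact Set.finite_singleton _
  | and E F ihE ihF => exact ((Set.finite_singleton _).union ihE).union ihF
  | ex R E ih | exU E ih => exact (Set.finite_singleton _).union ih

namespace Ontology

variable {O : Ontology}

theorem mem_sub_lhs {c : Inclusion} (h : c ∈ O) : c.lhs ∈ O.sub :=
  ⟨c, h, .inl c.lhs.mem_sub_self⟩

theorem mem_sub_rhs {c : Inclusion} (h : c ∈ O) : c.rhs ∈ O.sub :=
  ⟨c, h, .inr c.rhs.mem_sub_self⟩

theorem sub_closed {C D : Concept} (h : C ∈ O.sub) (h' : D ∈ C.sub) : D ∈ O.sub := by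
  obtain ⟨c, hc, h | h⟩ := h
  · exact ⟨c, hc, .inl (Concept.sub_trans h' h)⟩
  · exact ⟨c, hc, .inr (Concept.sub_trans h' h)⟩

theorem sig_of_sub {C : Concept} (h : C ∈ O.sub) : C.sig ⊆ O.sig := by
  obtain ⟨c, hc, h | h⟩ := h
  · exact fun s hs => ⟨c, hc, .inl (Concept.sig_mono h hs)⟩
  · exact fun s hs => ⟨c, hc, .inr (Concept.sig_mono h hs)⟩

theorem con_mem_sig {B : ℕ} : NLSym.con B ∈ O.sig ↔ Concept.name B ∈ O.sub := by
  refine ⟨?_, fun h => sig_of_sub h rfl⟩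
  rintro ⟨c, hc, h | h⟩
  · exact ⟨c, hc, .inl (Concept.name_mem_sub h)⟩
  · exact ⟨c, hc, .inr (Concept.name_mem_sub h)⟩

theorem ind_mem_sig {a : ℕ} : NLSym.ind a ∈ O.sig ↔ Concept.nom a ∈ O.sub := by
  refine ⟨?_, fun h => sig_of_sub h rfl⟩
  rintro ⟨c, hc, h | h⟩
  · exact ⟨c, hc, .inl (Concept.nom_mem_sub h)⟩
  · exact ⟨c, hc, .inr (Concept.nom_mem_sub h)⟩

theorem rol_mem_sig {r : ℕ} : NLSym.rol r ∈ O.sig ↔ ∃ R C, R.base = r ∧ Concept.ex R C ∈ O.sub := by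
  constructor
  · rintro ⟨c, hc, h | h⟩
    · obtain ⟨R, C, h1, h2⟩ := Concept.ex_mem_sub h
      exact ⟨R, C, h1, c, hc, .inl h2⟩
    · obtain ⟨R, C, h1, h2⟩ := Concept.ex_mem_sub h
      exact ⟨R, C, h1, c, hc, .inr h2⟩
  · rintro ⟨R, C, rfl, h⟩
    exact sig_of_sub h (.inl rfl)

theorem sub_finite (O : Ontology) : O.sub.Finite := by
  refine (O.finite_toSet.biUnion fun c _ => c.lhs.sub_finite.union c.rhs.sub_finite).subset ?_
  rintro C ⟨c, hc, h⟩
  exact Set.mem_biUnion hc h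

end Ontology

section TypeConcepts

variable {O : Ontology} {A : ℕ}

theorem name_mem_typeConcepts : Concept.name A ∈ typeConcepts O A := .inr (.inl rfl)

theorem exU_mem_typeConcepts : Concept.exU (.name A) ∈ typeConcepts O A := .inr (.inr rfl)

theorem sub_subset_typeConcepts : O.sub ⊆ typeConcepts O A := fun _ h => .inl (.inl h)

theorem ex_nom_mem_typeConcepts {R : Role} {a : ℕ} (hR : NLSym.rol R.base ∈ O.sig)
    (ha : NLSym.ind a ∈ O.sig) : Concept.ex R (.nom a) ∈ typeConcepts O A :=
  .inl (.inr ⟨R, a, hR, ha, rfl⟩)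

theorem nom_mem_typeConcepts {a : ℕ} (ha : NLSym.ind a ∈ O.sig) :
    Concept.nom a ∈ typeConcepts O A :=
  sub_subset_typeConcepts (Ontology.ind_mem_sig.1 ha)

theorem typeConcepts_closed {C D : Concept} (h : C ∈ typeConcepts O A) (h' : D ∈ C.sub) :
    D ∈ typeConcepts O A := by
  rcases h with (h | ⟨R, a, hR, ha, rfl⟩) | rfl | rfl
  · exact sub_subset_typeConcepts (Ontology.sub_closed h h')
  · rcases h' with h' | h'
    · cases h'; exact ex_nom_mem_typeConcepts hR ha
    · cases h'; exact nom_mem_typeConcepts ha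
  · cases h'; exact name_mem_typeConcepts
  · rcases h' with h' | h'
    · cases h'; exact exU_mem_typeConcepts
    · cases h'; exact name_mem_typeConcepts

theorem sig_of_mem_typeConcepts {C : Concept} (h : C ∈ typeConcepts O A) :
    C.sig ⊆ O.sig ∪ {NLSym.con A} := by
  rcases h with (h | ⟨R, a, hR, ha, rfl⟩) | rfl | rfl
  · exact (Ontology.sig_of_sub h).trans Set.subset_union_left
  · rintro s (rfl | rfl)
    · exact .inl hR
    · exact .inl ha
  · rintro s rfl; exact .inr rfl
  · rintro s rfl; exact .inr rfl

theorem nom_mem_typeConcepts_iff {a : ℕ} :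
    Concept.nom a ∈ typeConcepts O A ↔ NLSym.ind a ∈ O.sig := by
  refine ⟨fun h => ?_, nom_mem_typeConcepts⟩
  rcases sig_of_mem_typeConcepts h (rfl : NLSym.ind a ∈ (Concept.nom a).sig) with h | h
  · exact h
  · cases h

end TypeConcepts

/-! ## Interpretations -/

theorem Interpretation.rel_flip (I : Interpretation) {R : Role} {d e : I.Dom} :
    I.rel R.flip d e ↔ I.rel R e d := by cases R <;> rfl

/-- The interpretation with one element that satisfies everything over `S`. -/
def unitModel (S : Signature) : Interpretation where
  Dom := Unit
  con B := {_d | NLSym.con B ∈ S}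
  rol r _ _ := NLSym.rol r ∈ S
  ind _ := ()

/-- The one-point interpretation is a model of every ontology over `S` but is empty on all other
symbols. Hence entailed restrictions cannot introduce role names or concept names from outside. -/
theorem mem_ext_unitModel {S : Signature} {C : Concept} (h : C.sig ⊆ S) (d : (unitModel S).Dom) :
    d ∈ (unitModel S).ext C := by
  induction C generalizing d with
  | top => trivial
  | name B => exact h rfl
  | nom a => rfl
  | and C D ihC ihD =>
    exact ⟨ihC (Set.subset_union_left.trans h) d, ihD (Set.subset_union_right.trans h) d⟩
  | ex R C ih =>
    refine ⟨(), ?_, ih (Set.subset_union_right.trans h) ()⟩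
    have : NLSym.rol R.base ∈ S := h (.inl rfl)
    cases R <;> exact this
  | exU C ih => exact ⟨d, ih h d⟩

theorem unitModel_isModel {S : Signature} {O : Ontology} (h : O.sig ⊆ S) :
    (unitModel S).IsModel O := fun _ hc d _ =>
  mem_ext_unitModel ((Ontology.sig_of_sub (Ontology.mem_sub_rhs hc)).trans h) d

/-! ## Types -/

section Types

variable {O : Ontology} {A : ℕ}

/-- The least type that contains a set of concepts. -/
def typeClosure (O : Ontology) (A : ℕ) (τ : Set Concept) : Set Concept :=
  {C ∈ typeConcepts O A | ∀ I : Interpretation, I.IsModel O → I.extAll τ ⊆ I.ext C}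

theorem extAll_typeClosure {I : Interpretation} (hI : I.IsModel O) {τ : Set Concept} {d : I.Dom}
    (hd : d ∈ I.extAll τ) : d ∈ I.extAll (typeClosure O A τ) := fun _ hC => hC.2 I hI hd

theorem typeClosure_isType (τ : Set Concept) : IsType O A (typeClosure O A τ) :=
  ⟨fun _ h => h.1, fun _ hC h => ⟨hC, fun I hI _ hd => h I hI (extAll_typeClosure hI hd)⟩⟩

theorem subset_typeClosure {τ : Set Concept} (h : τ ⊆ typeConcepts O A) :
    τ ⊆ typeClosure O A τ := fun C hC => ⟨h hC, fun _ _ _ hd => hd C hC⟩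

theorem leastType_eq (C : Concept) : leastType O A C = typeClosure O A {C, .exU (.name A)} := by
  ext D
  refine and_congr_right fun _ => forall₂_congr fun I _ => ?_
  constructor
  · exact fun h d hd => h ⟨hd _ (.inl rfl), hd _ (.inr rfl)⟩
  · rintro h d ⟨h1, h2⟩
    exact h (by rintro _ (rfl | rfl) <;> assumption)

theorem leastType_isType (C : Concept) : IsType O A (leastType O A C) := by
  rw [leastType_eq]; exact typeClosure_isType _

theorem mem_leastType {C : Concept} (hC : C ∈ typeConcepts O A) : C ∈ leastType O A C :=
  ⟨hC, fun _ _ _ hd => hd.1⟩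

theorem exU_mem_leastType (C : Concept) : Concept.exU (.name A) ∈ leastType O A C :=
  ⟨exU_mem_typeConcepts, fun _ _ _ hd => hd.2⟩

theorem extAll_leastType {I : Interpretation} (hI : I.IsModel O) {C : Concept} {d e : I.Dom}
    (hd : d ∈ I.ext C) (he : e ∈ I.con A) : d ∈ I.extAll (leastType O A C) :=
  fun _ hD => hD.2 I hI ⟨hd, ⟨e, he⟩⟩

/-- By maximality: if every successor of type `τ₂` satisfies `C`, then the closure of `τ₂ ∪ {C}` is
also a type that is guaranteed at a successor, so it is no larger than `τ₂`. -/
theorem TypeSucc.mem {R : Role} {τ₁ τ₂ : Set Concept} (h : TypeSucc O A R τ₁ τ₂) {C : Concept}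
    (hC : C ∈ typeConcepts O A)
    (h' : ∀ I : Interpretation, I.IsModel O → ∀ d ∈ I.extAll τ₁, ∀ e, I.rel R d e →
      e ∈ I.extAll τ₂ → e ∈ I.ext C) : C ∈ τ₂ := by
  have hsub : τ₂ ∪ {C} ⊆ typeConcepts O A :=
    Set.union_subset h.prop.1.1 (Set.singleton_subset_iff.2 hC)
  refine h.le_of_ge (y := typeClosure O A (τ₂ ∪ {C})) ⟨typeClosure_isType _, ?_⟩
    (Set.subset_union_left.trans (subset_typeClosure hsub)) (subset_typeClosure hsub (.inr rfl))
  intro I hI d hd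
  obtain ⟨e, hde, he⟩ := h.prop.2 I hI d hd
  refine ⟨e, hde, extAll_typeClosure hI ?_⟩
  rintro D (hD | rfl)
  · exact he D hD
  · exact h' I hI d hd e hde he

theorem typeConcepts_finite (O : Ontology) (A : ℕ) : (typeConcepts O A).Finite := by
  have h2 : ((fun C => match C with | .ex R _ => R | _ => Role.name 0) '' O.sub : Set Role).Finite :=
    O.sub_finite.image _
  refine (O.sub_finite.union ?_).union (Set.toFinite _)
  refine (((h2.union (h2.image Role.flip)).prod O.sub_finite).image
    fun p : Role × Concept => Concept.ex p.1 p.2).subset ?_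
  rintro _ ⟨R, a, hR, ha, rfl⟩
  refine ⟨(R, .nom a), ⟨?_, Ontology.ind_mem_sig.1 ha⟩, rfl⟩
  obtain ⟨R', C, hb, hC⟩ := Ontology.rol_mem_sig.1 hR
  have : R = R' ∨ R = R'.flip := by
    cases R <;> cases R' <;> simp_all [Role.base, Role.flip]
  rcases this with rfl | rfl
  · exact .inl ⟨_, hC, rfl⟩
  · exact .inr ⟨R', ⟨_, hC, rfl⟩, rfl⟩

/-- There are finitely many types, so the closure of `σ` extends to a maximal one that is still
guaranteed. -/
theorem exists_typeSucc {R : Role} {τ σ : Set Concept} (hσ : σ ⊆ typeConcepts O A)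
    (h : ∀ I : Interpretation, I.IsModel O → ∀ d ∈ I.extAll τ, ∃ e, I.rel R d e ∧ e ∈ I.extAll σ) :
    ∃ τ', σ ⊆ τ' ∧ TypeSucc O A R τ τ' := by
  have hfin : {τ' | IsType O A τ' ∧ ∀ I : Interpretation, I.IsModel O → ∀ d ∈ I.extAll τ,
      ∃ e, I.rel R d e ∧ e ∈ I.extAll τ'}.Finite :=
    (typeConcepts_finite O A).finite_subsets.subset fun _ h => h.1.1
  obtain ⟨m, hm, hmax⟩ := hfin.exists_le_maximal (a := typeClosure O A σ)
    ⟨typeClosure_isType σ, fun I hI d hd => by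
      obtain ⟨e, hde, he⟩ := h I hI d hd
      exact ⟨e, hde, extAll_typeClosure hI he⟩⟩
  exact ⟨m, (subset_typeClosure hσ).trans hm, hmax⟩

/-- The one-point model over the signature of `O` and `A` satisfies `τ₁`, and it has an `R`-edge
only if the role name belongs to the signature. -/
theorem TypeSucc.rol_mem {R : Role} {τ₁ τ₂ : Set Concept} (h : TypeSucc O A R τ₁ τ₂)
    (h₁ : τ₁ ⊆ typeConcepts O A) : NLSym.rol R.base ∈ O.sig := by
  obtain ⟨e, he, -⟩ := h.prop.2 _ (unitModel_isModel Set.subset_union_left) ()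
    fun C hC => mem_ext_unitModel (sig_of_mem_typeConcepts (h₁ hC)) ()
  have : NLSym.rol R.base ∈ O.sig ∪ {NLSym.con A} := by cases R <;> exact he
  simpa using this

/-- By the one-point model again. Hence the types `τ_B` among the roots come from finitely many `B`,
which the algorithm can search. -/
theorem name_mem_typeConcepts_of_entails {B : ℕ} (h : O.Entails (.name A) (.exU (.name B))) :
    Concept.name B ∈ typeConcepts O A := by
  obtain ⟨e, he⟩ := h (unitModel (O.sig ∪ {NLSym.con A}))
    (unitModel_isModel Set.subset_union_left) (mem_ext_unitModel (by simp [Concept.sig]) ())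
  rcases he with he | he
  · exact sub_subset_typeConcepts (Ontology.con_mem_sig.1 he)
  · cases he; exact name_mem_typeConcepts

end Types

/-! ## The canonical model -/

section Canonical

variable {O : Ontology} {A : ℕ}

theorem IsCanonicalWord.isType {w : Word (Set Concept)} (h : IsCanonicalWord O A w) :
    IsType O A w.tail := by
  cases w with
  | base τ =>
    rcases h with ⟨B, -, rfl⟩ | ⟨a, -, rfl⟩ <;> exact leastType_isType _
  | snoc w R τ => exact h.2.2.prop.1

theorem IsCanonicalWord.exU_mem {w : Word (Set Concept)} (h : IsCanonicalWord O A w) :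
    Concept.exU (.name A) ∈ w.tail := by
  induction w with
  | base τ =>
    rcases h with ⟨B, -, rfl⟩ | ⟨a, -, rfl⟩ <;> exact exU_mem_leastType _
  | snoc w R τ ih =>
    exact h.2.2.mem exU_mem_typeConcepts fun I hI d hd e _ _ => hd _ (ih h.1)

/-- All types of canonical words are realized in any model with an instance of `A`. This is the
consistency on which nominals and the universal role rely. -/
theorem IsCanonicalWord.nonempty {w : Word (Set Concept)} (h : IsCanonicalWord O A w)
    {I : Interpretation} (hI : I.IsModel O) {e : I.Dom} (he : e ∈ I.con A) :
    (I.extAll w.tail).Nonempty := by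
  induction w with
  | base τ =>
    rcases h with ⟨B, hB, rfl⟩ | ⟨a, -, rfl⟩
    · obtain ⟨d, hd⟩ := hB I hI he
      exact ⟨d, extAll_leastType hI hd he⟩
    · exact ⟨I.ind a, extAll_leastType hI rfl he⟩
  | snoc w R τ ih =>
    obtain ⟨d, hd⟩ := ih h.1
    obtain ⟨e, -, he⟩ := h.2.2.prop.2 I hI d hd
    exact ⟨e, he⟩

/-- In a model with an instance of `A` the type is realized, necessarily at the individual `a`; so
all its members hold at `a` and it equals `τ_a`. Nominal types occur only as first letters, so the
word has no other letter. -/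
theorem IsCanonicalWord.eq_of_nom_mem {w : Word (Set Concept)} (h : IsCanonicalWord O A w) {a : ℕ}
    (ha : Concept.nom a ∈ w.tail) : w = .base (leastType O A (.nom a)) := by
  have hsig : NLSym.ind a ∈ O.sig := nom_mem_typeConcepts_iff.1 (h.isType.1 ha)
  have htail : w.tail = leastType O A (.nom a) := by
    ext D
    constructor
    · refine fun hD => ⟨h.isType.1 hD, fun I hI d hd => ?_⟩
      obtain ⟨hd1, e, he⟩ := hd
      obtain ⟨d', hd'⟩ := h.nonempty hI he
      have h1 : d' = I.ind a := hd' _ ha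
      have h2 : d = I.ind a := hd1
      rw [h2, ← h1]
      exact hd' D hD
    · exact fun hD => h.isType.2 D hD.1 fun I hI d hd => hD.2 I hI ⟨hd _ ha, hd _ h.exU_mem⟩
  cases w with
  | base τ => exact congrArg _ htail
  | snoc w R τ => exact absurd ⟨a, hsig, htail⟩ h.2.1

theorem canonicalModel_rel {R : Role} {w y : CanonicalDom O A} :
    (canonicalModel O A).rel R w y ↔
      (∃ τ, y.1 = .snoc w.1 R τ) ∨ (∃ τ, w.1 = .snoc y.1 R.flip τ) ∨
      (∃ a, .ex R (.nom a) ∈ w.1.tail ∧ y.1 = .base (leastType O A (.nom a))) ∨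
      (∃ a, .ex R.flip (.nom a) ∈ y.1.tail ∧ w.1 = .base (leastType O A (.nom a))) := by
  cases R with
  | name r => rfl
  | inv r =>
    change (_ ∨ _ ∨ _ ∨ _) ↔ _
    have key : ∀ p q r s : Prop, (q ∨ p ∨ s ∨ r) ↔ (p ∨ q ∨ r ∨ s) := by tauto
    exact key _ _ _ _

theorem canonicalModel_ind {a : ℕ} (h : NLSym.ind a ∈ O.sig) :
    ((canonicalModel O A).ind a).1 = .base (leastType O A (.nom a)) := by
  simp [canonicalModel, h]

/-- Types are closed under consequence, which settles the propositional inclusions. For `∃R.B ⊑ A'`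
along an edge to the parent, maximality of the successor type puts `A'` into the type of the child.
-/
theorem canonicalModel_isModel (hO : O.IsNormal) : (canonicalModel O A).IsModel O := by
  intro c hc w hw
  have hl := sub_subset_typeConcepts (A := A) (Ontology.mem_sub_lhs hc)
  have hr := sub_subset_typeConcepts (A := A) (Ontology.mem_sub_rhs hc)
  have step : ∀ {C D : Concept}, c = ⟨C, D⟩ → ∀ {I : Interpretation}, I.IsModel O →
      I.ext C ⊆ I.ext D := by
    rintro C D rfl I hI; exact hI _ hc
  have hT := w.2.isType
  have hA := w.2.exU_mem
  cases hO c hc with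
  | top A' => exact hT.2 _ hr fun I hI d _ => step rfl hI trivial
  | and A₁ A₂ B =>
    exact hT.2 _ hr fun I hI d hd => step rfl hI ⟨hd _ hw.1, hd _ hw.2⟩
  | toNom A' a =>
    have h : Concept.nom a ∈ w.1.tail := hT.2 _ hr fun I hI d hd => step rfl hI (hd _ hw)
    have ha := nom_mem_typeConcepts_iff.1 hr
    exact Subtype.ext ((w.2.eq_of_nom_mem h).trans (canonicalModel_ind ha).symm)
  | ofNom a A' =>
    have ha := nom_mem_typeConcepts_iff.1 hl
    have h : Concept.nom a ∈ w.1.tail := by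
      cases hw
      rw [canonicalModel_ind ha]
      exact mem_leastType hl
    exact hT.2 _ hr fun I hI d hd => step rfl hI (hd _ h)
  | toEx A' R B =>
    have hB : Concept.name B ∈ typeConcepts O A :=
      typeConcepts_closed hr (.inr (Concept.mem_sub_self _))
    obtain ⟨τ, hτ, hsucc⟩ := exists_typeSucc (R := R) (τ := w.1.tail) (σ := {.name B})
      (Set.singleton_subset_iff.2 hB) (fun I hI d hd => by
        obtain ⟨e, h1, h2⟩ := step rfl hI (hd _ hw)
        exact ⟨e, h1, by rintro _ rfl; exact h2⟩)
    have hBτ : Concept.name B ∈ τ := hτ rfl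
    -- A nominal successor type gives no new word. The edge then leads to the nominal itself, and it
    -- is present because types also decide the concepts `∃R.{a}`.
    by_cases hn : τ ∈ nominalTypes O A
    · have ⟨a, ha, hτa⟩ := hn
      refine ⟨⟨.base τ, .inr hn⟩, canonicalModel_rel.2 (.inr (.inr (.inl ⟨a, ?_, congrArg _ hτa⟩))), hBτ⟩
      refine hT.2 _ (ex_nom_mem_typeConcepts (hsucc.rol_mem hT.1) ha) fun I hI d hd => ?_
      obtain ⟨e, h1, h2⟩ := hsucc.prop.2 I hI d hd
      exact ⟨e, h1, h2 _ (hτa ▸ mem_leastType (nom_mem_typeConcepts ha))⟩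
    · exact ⟨⟨.snoc w.1 R τ, w.2, hn, hsucc⟩, canonicalModel_rel.2 (.inl ⟨τ, rfl⟩), hBτ⟩
  | toExU A' B =>
    have hBe : O.Entails (.name A) (.exU (.name B)) := fun I hI d hd => by
      obtain ⟨e, he⟩ := w.2.nonempty hI hd
      obtain ⟨e', he'⟩ := step rfl hI (he _ hw)
      exact ⟨e', he'⟩
    exact ⟨⟨.base (leastType O A (.name B)), .inl ⟨B, hBe, rfl⟩⟩,
      mem_leastType (name_mem_typeConcepts_of_entails hBe)⟩
  | ofEx R B A' =>
    obtain ⟨y, hwy, hy⟩ := hw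
    rcases canonicalModel_rel.1 hwy with ⟨τ, h⟩ | ⟨τ, h⟩ | ⟨a, h, h'⟩ | ⟨a, h, h'⟩
    · have hyv := y.2
      rw [h] at hyv
      refine hT.2 _ hr fun I hI d hd => ?_
      obtain ⟨e, h1, h2⟩ := hyv.2.2.prop.2 I hI d hd
      refine step rfl hI ⟨e, h1, h2 _ ?_⟩
      have : Concept.name B ∈ y.1.tail := hy
      rwa [h] at this
    · have hwv := w.2
      rw [h] at hwv
      change _ ∈ w.1.tail
      rw [h]
      refine hwv.2.2.mem hr fun I hI d hd e hde he => step rfl hI ⟨d, ?_, hd _ hy⟩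
      exact I.rel_flip.1 hde
    · refine hT.2 _ hr fun I hI d hd => ?_
      obtain ⟨e, h1, h2⟩ := hd _ h
      obtain ⟨f, hf⟩ := hd _ hA
      have : Concept.name B ∈ y.1.tail := hy
      rw [h'] at this
      exact step rfl hI ⟨e, h1, this.2 I hI ⟨h2, f, hf⟩⟩
    -- Here `w` is the nominal and the edge is recorded at `y`. The type of `y` is realized by some
    -- `z`, which the edge joins to the individual `a`.
    · change _ ∈ w.1.tail
      rw [h']
      refine ⟨hr, fun I hI d hd => ?_⟩
      obtain ⟨hd1, e, he⟩ := hd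
      obtain ⟨z, hz⟩ := y.2.nonempty hI he
      obtain ⟨z', h1, h2⟩ := hz _ h
      cases hd1
      cases h2
      exact step rfl hI ⟨z, I.rel_flip.1 h1, hz _ hy⟩
  | ofExU B A' =>
    obtain ⟨y, hy⟩ := hw
    refine hT.2 _ hr fun I hI d hd => ?_
    obtain ⟨f, hf⟩ := hd _ hA
    obtain ⟨z, hz⟩ := y.2.nonempty hI hf
    exact step rfl hI ⟨z, hz _ hy⟩

theorem canonicalRoot_mem : canonicalRoot O A ∈ (canonicalModel O A).con A :=
  mem_leastType name_mem_typeConcepts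

/-- The canonical model maps homomorphically into every model with an element in `A`. -/
theorem exists_hom_canonicalModel {I : Interpretation} (hI : I.IsModel O) {d : I.Dom}
    (hd : d ∈ I.con A) : ∃ h : CanonicalDom O A → I.Dom, h (canonicalRoot O A) = d ∧
      (∀ w, h w ∈ I.extAll w.1.tail) ∧
      (∀ r w y, (canonicalModel O A).rol r w y → I.rol r (h w) (h y)) ∧
      ∀ a, NLSym.ind a ∈ O.sig → h ((canonicalModel O A).ind a) = I.ind a := by
  classical
  -- The root goes to `d`, other first letters to any element of their type, and later letters to
  -- successors provided by `TypeSucc`. The default `d` is never needed on canonical words.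
  let g : Word (Set Concept) → I.Dom := fun w => Word.rec (motive := fun _ => I.Dom)
    (fun τ => if τ = leastType O A (.name A) then d else
      if h : ∃ e, e ∈ I.extAll τ then h.choose else d)
    (fun _ R τ e => if h : ∃ e', I.rel R e e' ∧ e' ∈ I.extAll τ then h.choose else d) w
  have hg : ∀ w, IsCanonicalWord O A w → g w ∈ I.extAll w.tail := by
    intro w
    induction w with
    | base τ =>
      intro hw
      by_cases h : τ = leastType O A (.name A)
      · simp only [g, h, if_true]
        exact extAll_leastType hI hd hd
      · have hne : ∃ e, e ∈ I.extAll τ := hw.nonempty hI hd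
        simp only [g, h, if_false, dif_pos hne]
        exact hne.choose_spec
    | snoc w R τ ih =>
      intro hw
      have hne : ∃ e', I.rel R (g w) e' ∧ e' ∈ I.extAll τ := hw.2.2.prop.2 I hI _ (ih hw.1)
      have : g (.snoc w R τ) = hne.choose := by
        change (if h : ∃ e', I.rel R (g w) e' ∧ e' ∈ I.extAll τ then h.choose else d) = _
        rw [dif_pos hne]
      rw [this]
      exact hne.choose_spec.2
  have hgR : ∀ w R τ, IsCanonicalWord O A (.snoc w R τ) → I.rel R (g w) (g (.snoc w R τ)) := by
    intro w R τ hw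
    have hne : ∃ e', I.rel R (g w) e' ∧ e' ∈ I.extAll τ := hw.2.2.prop.2 I hI _ (hg w hw.1)
    have : g (.snoc w R τ) = hne.choose := by
      change (if h : ∃ e', I.rel R (g w) e' ∧ e' ∈ I.extAll τ then h.choose else d) = _
      rw [dif_pos hne]
    rw [this]
    exact hne.choose_spec.1
  have hga : ∀ a, NLSym.ind a ∈ O.sig → g (.base (leastType O A (.nom a))) = I.ind a :=
    fun a ha => hg (.base _) (.inr ⟨a, ha, rfl⟩) _ (mem_leastType (nom_mem_typeConcepts ha))
  refine ⟨fun w => g w.1, by simp [g, canonicalRoot], fun w => hg w.1 w.2, ?_, fun a ha => ?_⟩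
  · rintro r w y (⟨τ, h⟩ | ⟨τ, h⟩ | ⟨a, h, h'⟩ | ⟨a, h, h'⟩)
    · have := y.2
      rw [h] at this
      have e1 := hgR _ _ _ this
      rw [← h] at e1
      exact e1
    · have := w.2
      rw [h] at this
      have e1 := hgR _ _ _ this
      rw [← h] at e1
      exact e1
    · obtain ⟨e, h1, h2⟩ := hg _ w.2 _ h
      cases h2
      have := nom_mem_typeConcepts_iff.1 (typeConcepts_closed (w.2.isType.1 h) (.inr rfl))
      rw [← hga a this, ← h'] at h1
      exact h1
    · obtain ⟨e, h1, h2⟩ := hg _ y.2 _ h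
      cases h2
      have := nom_mem_typeConcepts_iff.1 (typeConcepts_closed (y.2.isType.1 h) (.inr rfl))
      rw [← hga a this, ← h'] at h1
      exact h1
  · simp only [canonicalModel_ind ha]
    exact hga a ha

end Canonical

/-! ## The model of intersections of types -/

section Meet

variable (I : Interpretation) (Y : Set Concept)

/-- The members of `Y` that all elements of `S` satisfy. -/
def meetType (S : Set I.Dom) : Set Concept := {C ∈ Y | S ⊆ I.ext C}

/-- The intersections of non-empty families of types of elements of `I`. -/
def MeetType : Type := {τ : Set Concept // ∃ S : Set I.Dom, S.Nonempty ∧ τ = meetType I Y S}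

variable {I Y}

/-- What all elements of `S` and all elements of `S'` satisfy is what all elements of `S ∪ S'`
satisfy. -/
instance : SemilatticeInf (MeetType I Y) :=
  { (inferInstance : PartialOrder {τ : Set Concept // ∃ S : Set I.Dom, S.Nonempty ∧ τ = meetType I Y S}) with
    inf := fun s t => ⟨s.1 ∩ t.1, by
      obtain ⟨s, S, hS, rfl⟩ := s
      obtain ⟨t, S', -, rfl⟩ := t
      refine ⟨S ∪ S', hS.inl, ?_⟩
      ext C
      simp only [meetType, Set.mem_inter_iff, Set.mem_ofPred_eq, Set.union_subset_iff]
      tauto⟩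
    inf_le_left := fun _ _ => Set.inter_subset_left
    inf_le_right := fun _ _ => Set.inter_subset_right
    le_inf := fun _ _ _ h h' => Set.subset_inter h h' }

theorem MeetType.finite (hY : Y.Finite) : Finite (MeetType I Y) := by
  have := hY.finite_subsets.to_subtype
  exact Finite.of_injective (β := {τ | τ ⊆ Y})
    (fun s => ⟨s.1, by obtain ⟨s, S, -, rfl⟩ := s; exact fun C hC => hC.1⟩)
    fun s t h => Subtype.ext (Subtype.mk.inj h)

theorem MeetType.card_le (hY : Y.Finite) : Nat.card (MeetType I Y) ≤ 2 ^ Y.ncard := by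
  have hc : ({τ | τ ⊆ Y} : Set (Set Concept)).ncard = 2 ^ Y.ncard := Set.ncard_powerset Y hY
  have := hY.finite_subsets.to_subtype
  rw [← hc, ← Nat.card_coe_set_eq]
  exact Nat.card_le_card_of_injective (β := {τ | τ ⊆ Y})
    (fun s => ⟨s.1, by obtain ⟨s, S, -, rfl⟩ := s; exact fun C hC => hC.1⟩)
    fun s t h => Subtype.ext (Subtype.mk.inj h)

/-- The type of an element. -/
def elemType (Y : Set Concept) (d : I.Dom) : MeetType I Y :=
  ⟨meetType I Y {d}, {d}, Set.singleton_nonempty d, rfl⟩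

theorem mem_elemType {d : I.Dom} {C : Concept} : C ∈ (elemType Y d).1 ↔ C ∈ Y ∧ d ∈ I.ext C := by
  simp [elemType, meetType]

/-- An `R`-edge from `s` to `t` respects the inclusions `∃R.X ⊑ Z` and `∃R⁻.X ⊑ Z` of `O`. -/
def Compatible (O : Ontology) (R : Role) (s t : Set Concept) : Prop :=
  (∀ X Z, ⟨.ex R (.name X), .name Z⟩ ∈ O → .name X ∈ t → .name Z ∈ s) ∧
    ∀ X Z, ⟨.ex R.flip (.name X), .name Z⟩ ∈ O → .name X ∈ s → .name Z ∈ t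

theorem Compatible.flip {O : Ontology} {R : Role} {s t : Set Concept} (h : Compatible O R s t) :
    Compatible O R.flip t s := ⟨h.2, by simpa using h.1⟩

theorem Compatible.inter {O : Ontology} {R : Role} {s t s' t' : Set Concept}
    (h : Compatible O R s t) (h' : Compatible O R s' t') : Compatible O R (s ∩ s') (t ∩ t') :=
  ⟨fun X Z hc hX => ⟨h.1 X Z hc hX.1, h'.1 X Z hc hX.2⟩,
    fun X Z hc hX => ⟨h.2 X Z hc hX.1, h'.2 X Z hc hX.2⟩⟩

variable (O : Ontology) (I Y)

/-- The model whose elements are the intersections of types, with all edges that `O` permits. -/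
def meetModel : Interpretation where
  Dom := MeetType I Y
  con X := {s | .name X ∈ s.1}
  rol r s t := Compatible O (.name r) s.1 t.1
  ind a := elemType Y (I.ind a)

variable {O I Y}

theorem meetModel_rel {R : Role} {s t : MeetType I Y} :
    (meetModel I Y O).rel R s t ↔ Compatible O R s.1 t.1 := by
  cases R with
  | name r => rfl
  | inv r => exact ⟨fun h => Compatible.flip (R := .name r) h, fun h => Compatible.flip h⟩

theorem compatible_elemType (hI : I.IsModel O) (hY : ∀ B, .name B ∈ O.sub → .name B ∈ Y) {R : Role}
    {d e : I.Dom} (h : I.rel R d e) : Compatible O R (elemType Y d).1 (elemType Y e).1 := by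
  constructor
  · intro X Z hc hX
    exact mem_elemType.2 ⟨hY Z (Ontology.mem_sub_rhs hc), hI _ hc ⟨e, h, (mem_elemType.1 hX).2⟩⟩
  · intro X Z hc hX
    exact mem_elemType.2 ⟨hY Z (Ontology.mem_sub_rhs hc),
      hI _ hc ⟨d, I.rel_flip.2 h, (mem_elemType.1 hX).2⟩⟩

/-- The family is non-empty and contained in the singleton of the individual `a`, so it is this
singleton. -/
theorem MeetType.eq_of_nom_mem {s : MeetType I Y} {a : ℕ} (h : .nom a ∈ s.1) :
    s = elemType Y (I.ind a) := by
  obtain ⟨_, S, hS, rfl⟩ := s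
  have : S = {I.ind a} := hS.subset_singleton_iff.1 h.2
  exact Subtype.ext (by simp [elemType, this])

/-- Inclusions in normal form are Horn and thus survive intersections. For `A' ⊑ ∃R.B` a witness is
chosen for every member of the family, and the witnesses form the family of the successor; `∃R.B ⊑
A'` holds since only compatible pairs are edges. -/
theorem meetModel_isModel (hO : O.IsNormal) (hI : I.IsModel O)
    (hYn : ∀ B, .name B ∈ O.sub → .name B ∈ Y) (hYa : ∀ a, .nom a ∈ O.sub → .nom a ∈ Y) :
    (meetModel I Y O).IsModel O := by
  intro c hc s hs
  have hl := (Ontology.mem_sub_lhs hc)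
  have hr := (Ontology.mem_sub_rhs hc)
  have step : ∀ {C D : Concept}, c = ⟨C, D⟩ → I.ext C ⊆ I.ext D := by
    rintro C D rfl; exact hI _ hc
  obtain ⟨σ, S, hS, rfl⟩ := s
  cases hO c hc with
  | top A' => exact ⟨hYn _ hr, fun d _ => step rfl trivial⟩
  | and A₁ A₂ B => exact ⟨hYn _ hr, fun d hd => step rfl ⟨hs.1.2 hd, hs.2.2 hd⟩⟩
  | toNom A' a =>
    exact MeetType.eq_of_nom_mem (a := a) ⟨hYa _ hr, fun d hd => step rfl (hs.2 hd)⟩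
  | ofNom a A' =>
    have hs' : (⟨meetType I Y S, S, hS, rfl⟩ : MeetType I Y) = elemType Y (I.ind a) := hs
    rw [hs']
    exact mem_elemType.2 ⟨hYn _ hr, step rfl rfl⟩
  | toEx A' R B =>
    have hB : Concept.name B ∈ O.sub := Ontology.sub_closed hr (.inr (Concept.mem_sub_self _))
    -- Outside `S` the choice does not matter.
    have hex : ∀ d : I.Dom, ∃ e, d ∈ S → I.rel R d e ∧ e ∈ I.con B := fun d => by
      by_cases hd : d ∈ S
      · obtain ⟨e, he⟩ := step rfl (hs.2 hd)
        exact ⟨e, fun _ => he⟩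
      · exact ⟨d, fun h => absurd h hd⟩
    choose e he using hex
    refine ⟨⟨meetType I Y (e '' S), e '' S, hS.image e, rfl⟩, meetModel_rel.2 ⟨?_, ?_⟩, hYn _ hB, ?_⟩
    · intro X Z hc' hX
      exact ⟨hYn _ (Ontology.mem_sub_rhs hc'),
        fun d hd => hI _ hc' ⟨e d, (he d hd).1, hX.2 ⟨d, hd, rfl⟩⟩⟩
    · rintro X Z hc' hX
      refine ⟨hYn _ (Ontology.mem_sub_rhs hc'), ?_⟩
      rintro _ ⟨d, hd, rfl⟩
      exact hI _ hc' ⟨d, I.rel_flip.2 (he d hd).1, hX.2 hd⟩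
    · rintro _ ⟨d, hd, rfl⟩
      exact (he d hd).2
  | toExU A' B =>
    have hB : Concept.name B ∈ O.sub := Ontology.sub_closed hr (.inr (Concept.mem_sub_self _))
    obtain ⟨d, hd⟩ := hS
    obtain ⟨e, he⟩ := step rfl (hs.2 hd)
    exact ⟨elemType Y e, mem_elemType.2 ⟨hYn _ hB, he⟩⟩
  | ofEx R B A' =>
    obtain ⟨t, hst, ht⟩ := hs
    exact (meetModel_rel.1 hst).1 _ _ hc ht
  | ofExU B A' =>
    obtain ⟨⟨_, S', ⟨e, he⟩, rfl⟩, ht⟩ := hs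
    exact ⟨hYn _ hr, fun d _ => step rfl ⟨e, ht.2 he⟩⟩

end Meet

end DescrLogic

/-! ### Finite tree-shaped ABoxes as concepts -/

namespace DescrLogic

/-! ## The concept of a finite part of an unfolding -/

open Classical in
/-- The conjunction of a finite set of concepts. -/
noncomputable def conj (s : Set Concept) : Concept :=
  if h : s.Finite then h.toFinset.toList.foldr .and .top else .top

theorem mem_ext_conj {s : Set Concept} (hs : s.Finite) {I : Interpretation} {d : I.Dom} :
    d ∈ I.ext (conj s) ↔ ∀ C ∈ s, d ∈ I.ext C := by
  have key : ∀ l : List Concept, d ∈ I.ext (l.foldr .and .top) ↔ ∀ C ∈ l, d ∈ I.ext C := by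
    intro l
    induction l with
    | nil => simp [Interpretation.ext]
    | cons C l ih =>
      rw [List.foldr_cons, List.forall_mem_cons, ← ih]
      rfl
  rw [conj, dif_pos hs, key]
  simp

theorem conj_sig {s : Set Concept} {S : Signature} (h : ∀ C ∈ s, C.sig ⊆ S) :
    (conj s).sig ⊆ S := by
  unfold conj
  split_ifs with hs
  · have key : ∀ l : List Concept, (∀ C ∈ l, C.sig ⊆ S) → (l.foldr Concept.and .top).sig ⊆ S := by
      intro l
      induction l with
      | nil => intro _; exact Set.empty_subset _
      | cons C l ih =>
        intro h
        exact Set.union_subset (h C (by simp)) (ih fun D hD => h D (by simp [hD]))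
    exact key _ (by simpa using h)
  · exact Set.empty_subset _

theorem conj_uFree {s : Set Concept} (h : ∀ C ∈ s, C.UFree) : (conj s).UFree := by
  unfold conj
  split_ifs with hs
  · have key : ∀ l : List Concept, (∀ C ∈ l, C.UFree) → (l.foldr Concept.and .top).UFree := by
      intro l
      induction l with
      | nil => intro _; trivial
      | cons C l ih =>
        intro h
        exact ⟨h C (by simp), ih fun D hD => h D (by simp [hD])⟩
    exact key _ (by simpa using h)
  · trivial

theorem conj_admits {L : Dialect} {s : Set Concept} (h : ∀ C ∈ s, L.Admits C) :
    L.Admits (conj s) := by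
  cases L with
  | eliou => trivial
  | elio => exact conj_uFree h

theorem Dialect.admits_of_uFree (L : Dialect) {C : Concept} (h : C.UFree) : L.Admits C := by
  cases L with
  | eliou => trivial
  | elio => exact h

/-- The symbol of an assertion. -/
def Assertion.code {V : Type} : Assertion V → ℕ
  | .top _ => 0
  | .con A _ => A
  | .nom a _ => a
  | .rol r _ _ => r

namespace ABox

variable {V : Type} {𝒞 : ABox V} {Γ : Set ℕ} {𝒲 : Set (Word V)}

/-- The part of the unfolding that lives on the words in `𝒲`. -/
def unfoldOn (𝒞 : ABox V) (Γ : Set ℕ) (𝒲 : Set (Word V)) : ABox (Word V) :=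
  {α ∈ unfold 𝒞 Γ | ∀ y ∈ α.vars, y ∈ 𝒲}

theorem fact_of_snoc {w : Word V} {R : Role} {x : V} (h : IsUnfoldWord 𝒞 Γ (.snoc w R x)) :
    HasRole (unfold 𝒞 Γ) R w (.snoc w R x) := by
  cases R with
  | name r => exact .child r w x h
  | inv r => exact .childInv r w x h

/-- Concepts that describe a word without its successors. -/
def localConcepts (𝒜 : ABox (Word V)) (w : Word V) : Set Concept :=
  {C | (∃ A, .con A w ∈ 𝒜 ∧ C = .name A) ∨ (∃ a, .nom a w ∈ 𝒜 ∧ C = .nom a) ∨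
    (∃ R x a, HasRole 𝒜 R w (.base x) ∧ .nom a (.base x) ∈ 𝒜 ∧ C = .ex R (.nom a))}

theorem localConcepts_finite {𝒜 : ABox (Word V)} (h : 𝒜.Finite) (w : Word V) :
    (localConcepts 𝒜 w).Finite := by
  have hc := h.image Assertion.code
  refine ((hc.image Concept.name).union ((hc.image Concept.nom).union
    ((hc.image2 (fun r a => Concept.ex (.name r) (.nom a)) hc).union
      (hc.image2 (fun r a => Concept.ex (.inv r) (.nom a)) hc)))).subset ?_
  rintro C (⟨A, hA, rfl⟩ | ⟨a, ha, rfl⟩ | ⟨R, x, a, hR, ha, rfl⟩)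
  · exact .inl ⟨A, ⟨_, hA, rfl⟩, rfl⟩
  · exact .inr (.inl ⟨a, ⟨_, ha, rfl⟩, rfl⟩)
  · cases R with
    | name r => exact .inr (.inr (.inl ⟨r, ⟨_, hR, rfl⟩, a, ⟨_, ha, rfl⟩, rfl⟩))
    | inv r => exact .inr (.inr (.inr ⟨r, ⟨_, hR, rfl⟩, a, ⟨_, ha, rfl⟩, rfl⟩))

/-- The concept that describes the tree of words in `𝒲` below a word, up to depth `k`. -/
noncomputable def treeConcept (𝒜 : ABox (Word V)) (𝒲 : Set (Word V)) : ℕ → Word V → Concept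
  | 0, w => conj (localConcepts 𝒜 w)
  | k + 1, w => conj (localConcepts 𝒜 w ∪
      {C | ∃ R x, .snoc w R x ∈ 𝒲 ∧ C = .ex R (treeConcept 𝒜 𝒲 k (.snoc w R x))})

theorem children_finite (h𝒲 : 𝒲.Finite) (F : Word V → Concept) (w : Word V) :
    {C : Concept | ∃ R x, .snoc w R x ∈ 𝒲 ∧ C = .ex R (F (.snoc w R x))}.Finite := by
  refine (h𝒲.image fun w' => match w' with
    | .base _ => Concept.top
    | .snoc w R x => .ex R (F (.snoc w R x))).subset ?_
  rintro C ⟨R, x, h, rfl⟩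
  exact ⟨_, h, rfl⟩

theorem treeConcept_local {𝒜 : ABox (Word V)} (h𝒜 : 𝒜.Finite) (h𝒲 : 𝒲.Finite) {k : ℕ}
    {w : Word V} {I : Interpretation} {d : I.Dom} (hd : d ∈ I.ext (treeConcept 𝒜 𝒲 k w))
    {C : Concept} (hC : C ∈ localConcepts 𝒜 w) : d ∈ I.ext C := by
  cases k with
  | zero => exact (mem_ext_conj (localConcepts_finite h𝒜 w)).1 hd C hC
  | succ k =>
    exact (mem_ext_conj ((localConcepts_finite h𝒜 w).union (children_finite h𝒲 _ w))).1 hd C (.inl hC)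

theorem treeConcept_child {𝒜 : ABox (Word V)} (h𝒜 : 𝒜.Finite) (h𝒲 : 𝒲.Finite) {k : ℕ}
    {w : Word V} {R : Role} {x : V} {I : Interpretation} {d : I.Dom}
    (hd : d ∈ I.ext (treeConcept 𝒜 𝒲 (k + 1) w)) (h : .snoc w R x ∈ 𝒲) :
    ∃ e, I.rel R d e ∧ e ∈ I.ext (treeConcept 𝒜 𝒲 k (.snoc w R x)) :=
  (mem_ext_conj ((localConcepts_finite h𝒜 w).union (children_finite h𝒲 _ w))).1 hd
    (.ex R (treeConcept 𝒜 𝒲 k (.snoc w R x))) (.inr ⟨R, x, h, rfl⟩)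

theorem treeConcept_sig {𝒜 : ABox (Word V)} {S : Signature}
    (hcon : ∀ A w, .con A w ∈ 𝒜 → NLSym.con A ∈ S)
    (hnom : ∀ a w, .nom a w ∈ 𝒜 → NLSym.ind a ∈ S)
    (hrol : ∀ R w w', HasRole 𝒜 R w w' → NLSym.rol R.base ∈ S)
    (hsnoc : ∀ w R x, .snoc w R x ∈ 𝒲 → HasRole 𝒜 R w (.snoc w R x)) (k : ℕ) (w : Word V) :
    (treeConcept 𝒜 𝒲 k w).sig ⊆ S := by
  have hloc : ∀ w, ∀ C ∈ localConcepts 𝒜 w, C.sig ⊆ S := by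
    rintro w C (⟨A, hA, rfl⟩ | ⟨a, ha, rfl⟩ | ⟨R, x, a, hR, ha, rfl⟩)
    · exact Set.singleton_subset_iff.2 (hcon _ _ hA)
    · exact Set.singleton_subset_iff.2 (hnom _ _ ha)
    · exact Set.union_subset (Set.singleton_subset_iff.2 (hrol _ _ _ hR))
        (Set.singleton_subset_iff.2 (hnom _ _ ha))
  induction k generalizing w with
  | zero => exact conj_sig (hloc w)
  | succ k ih =>
    refine conj_sig ?_
    rintro C (hC | ⟨R, x, h, rfl⟩)
    · exact hloc w C hC
    · exact Set.union_subset (Set.singleton_subset_iff.2 (hrol _ _ _ (hsnoc _ _ _ h))) (ih _)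

theorem treeConcept_uFree (𝒜 : ABox (Word V)) (𝒲 : Set (Word V)) (k : ℕ) (w : Word V) :
    (treeConcept 𝒜 𝒲 k w).UFree := by
  have hloc : ∀ w, ∀ C ∈ localConcepts 𝒜 w, C.UFree := by
    rintro w C (⟨A, hA, rfl⟩ | ⟨a, ha, rfl⟩ | ⟨R, x, a, hR, ha, rfl⟩) <;> trivial
  induction k generalizing w with
  | zero => exact conj_uFree (hloc w)
  | succ k ih =>
    refine conj_uFree ?_
    rintro C (hC | ⟨R, x, h, rfl⟩)
    · exact hloc w C hC
    · exact ih _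

theorem Sat.rel {W : Type} {𝒜 : ABox W} {I : Interpretation} {v : W → I.Dom} (h : Sat I v 𝒜)
    {R : Role} {x y : W} (hR : HasRole 𝒜 R x y) : I.rel R (v x) (v y) := by
  cases R <;> exact h _ hR

theorem mem_treeConcept_of_sat {𝒜 : ABox (Word V)} (h𝒜 : 𝒜.Finite) (h𝒲 : 𝒲.Finite)
    (hsnoc : ∀ w R x, .snoc w R x ∈ 𝒲 → HasRole 𝒜 R w (.snoc w R x)) {I : Interpretation}
    {v : Word V → I.Dom} (hv : Sat I v 𝒜) (k : ℕ) (w : Word V) :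
    v w ∈ I.ext (treeConcept 𝒜 𝒲 k w) := by
  have hloc : ∀ w, ∀ C ∈ localConcepts 𝒜 w, v w ∈ I.ext C := by
    rintro w C (⟨A, hA, rfl⟩ | ⟨a, ha, rfl⟩ | ⟨R, x, a, hR, ha, rfl⟩)
    · exact hv _ hA
    · exact (hv _ ha).symm
    · exact ⟨_, hv.rel hR, (hv _ ha).symm⟩
  induction k generalizing w with
  | zero => exact (mem_ext_conj (localConcepts_finite h𝒜 w)).2 (hloc w)
  | succ k ih =>
    refine (mem_ext_conj ((localConcepts_finite h𝒜 w).union (children_finite h𝒲 _ w))).2 ?_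
    rintro C (hC | ⟨R, x, h, rfl⟩)
    · exact hloc w C hC
    · exact ⟨_, hv.rel (hsnoc _ _ _ h), ih _⟩

/-- The assignment is chosen from the roots downward: at a word `w` the tree concept of the
remaining depth `N - w.len` holds, and its existential restrictions provide values for the children.
-/
theorem exists_sat_of_treeConcept (hfin : (unfoldOn 𝒞 Γ 𝒲).Finite) (h𝒲 : 𝒲.Finite)
    (hpre : ∀ w R x, .snoc w R x ∈ 𝒲 → w ∈ 𝒲) {N : ℕ} (hN : ∀ w ∈ 𝒲, w.len ≤ N)
    {I : Interpretation} {e : V → I.Dom}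
    (he : ∀ b, .base b ∈ 𝒲 → e b ∈ I.ext (treeConcept (unfoldOn 𝒞 Γ 𝒲) 𝒲 N (.base b))) :
    ∃ v : Word V → I.Dom, (∀ b, v (.base b) = e b) ∧ Sat I v (unfoldOn 𝒞 Γ 𝒲) := by
  classical
  set 𝒜 := unfoldOn 𝒞 Γ 𝒲 with h𝒜
  let v : Word V → I.Dom := fun w => Word.rec (motive := fun _ => I.Dom) e
    (fun w R x d => if h : ∃ e', I.rel R d e' ∧
      e' ∈ I.ext (treeConcept 𝒜 𝒲 (N - (w.len + 1)) (.snoc w R x)) then h.choose else d) w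
  have hsnoc : ∀ w R x, .snoc w R x ∈ 𝒲 → v w ∈ I.ext (treeConcept 𝒜 𝒲 (N - w.len) w) →
      I.rel R (v w) (v (.snoc w R x)) ∧
        v (.snoc w R x) ∈ I.ext (treeConcept 𝒜 𝒲 (N - (w.len + 1)) (.snoc w R x)) := by
    intro w R x hw hvw
    have hl := hN _ hw
    simp only [Word.len] at hl
    have hk : N - w.len = N - (w.len + 1) + 1 := by omega
    rw [hk] at hvw
    have hne := treeConcept_child hfin h𝒲 hvw hw
    have : v (.snoc w R x) = hne.choose := by
      change (if h : ∃ e', I.rel R (v w) e' ∧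
        e' ∈ I.ext (treeConcept 𝒜 𝒲 (N - (w.len + 1)) (.snoc w R x)) then h.choose else v w) = _
      rw [dif_pos hne]
    rw [this]
    exact hne.choose_spec
  have hmem : ∀ w ∈ 𝒲, v w ∈ I.ext (treeConcept 𝒜 𝒲 (N - w.len) w) := by
    intro w
    induction w with
    | base b => exact he b
    | snoc w R x ih => exact fun hw => (hsnoc w R x hw (ih (hpre _ _ _ hw))).2
  have hloc : ∀ w ∈ 𝒲, ∀ C ∈ localConcepts 𝒜 w, v w ∈ I.ext C :=
    fun w hw C hC => treeConcept_local hfin h𝒲 (hmem w hw) hC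
  have hnomv : ∀ a w, .nom a w ∈ 𝒜 → v w = I.ind a := fun a w h =>
    hloc w (h.2 _ rfl) (.nom a) (.inr (.inl ⟨a, h, rfl⟩))
  refine ⟨v, fun _ => rfl, ?_⟩
  rintro α ⟨hα, hvars⟩
  have hαmem : α ∈ 𝒜 := ⟨hα, hvars⟩
  cases hα with
  | top w _ _ => trivial
  | con A w hw h => exact hloc w (hvars _ rfl) (.name A) (.inl ⟨A, hαmem, rfl⟩)
  | nom a x ha h => exact (hnomv a _ hαmem).symm
  | child r w x h =>
    have hw := hvars (.snoc w (.name r) x) (.inr rfl)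
    exact (hsnoc w _ x hw (hmem w (hpre _ _ _ hw))).1
  | childInv r w x h =>
    have hw := hvars (.snoc w (.inv r) x) (.inl rfl)
    exact (hsnoc w _ x hw (hmem w (hpre _ _ _ hw))).1
  -- A link to a nominal crosses trees, but the local concepts contain `∃r.{a}`, and the value of
  -- the nominal is forced to be the individual `a`.
  | toNominal r w x hw hx h =>
    obtain ⟨a, ha, hax⟩ := hx
    have hnom : Assertion.nom a (.base x) ∈ 𝒜 := ⟨.nom a x ha hax, by
      rintro y rfl; exact hvars _ (.inr rfl)⟩
    obtain ⟨e', h1, h2⟩ := hloc w (hvars _ (.inl rfl)) (.ex (.name r) (.nom a))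
      (.inr (.inr ⟨.name r, x, a, hαmem, hnom, rfl⟩))
    cases h2
    rw [← hnomv a _ hnom] at h1
    exact h1
  | ofNominal r w x hw hx h =>
    obtain ⟨a, ha, hax⟩ := hx
    have hnom : Assertion.nom a (.base x) ∈ 𝒜 := ⟨.nom a x ha hax, by
      rintro y rfl; exact hvars _ (.inl rfl)⟩
    obtain ⟨e', h1, h2⟩ := hloc w (hvars _ (.inr rfl)) (.ex (.inv r) (.nom a))
      (.inr (.inr ⟨.inv r, x, a, hαmem, hnom, rfl⟩))
    cases h2
    rw [← hnomv a _ hnom] at h1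
    exact h1

/-- A concept that says that `C` holds somewhere, respectively at the end of a path. -/
theorem exists_link {W : Type} {𝒜 : ABox W} {S : Signature} (L : Dialect)
    (hrol : ∀ R w w', HasRole 𝒜 R w w' → NLSym.rol R.base ∈ S) {x y : W}
    (h : L = .elio → Reach 𝒜 x y) {C : Concept} (hC : L.Admits C) (hCS : C.sig ⊆ S) :
    ∃ C', L.Admits C' ∧ C'.sig ⊆ S ∧
      (∀ (I : Interpretation) (v : W → I.Dom), Sat I v 𝒜 → v y ∈ I.ext C → v x ∈ I.ext C') ∧
      ∀ (I : Interpretation) (d : I.Dom), d ∈ I.ext C' → (I.ext C).Nonempty := by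
  cases L with
  | eliou => exact ⟨.exU C, trivial, hCS, fun I v _ h => ⟨_, h⟩, fun I d ⟨e, he⟩ => ⟨e, he⟩⟩
  | elio =>
    induction h rfl using Relation.ReflTransGen.head_induction_on with
    | refl => exact ⟨C, hC, hCS, fun I v _ h => h, fun I d h => ⟨d, h⟩⟩
    | head hadj _ ih =>
      rename_i z z' hr
      obtain ⟨C', h1, h2, h3, h4⟩ := ih fun _ => hr
      obtain ⟨R, hR⟩ : ∃ R, HasRole 𝒜 R z z' := by
        obtain ⟨r, h | h⟩ := hadj
        · exact ⟨.name r, h⟩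
        · exact ⟨.inv r, h⟩
      exact ⟨.ex R C', h1, Set.union_subset (Set.singleton_subset_iff.2 (hrol _ _ _ hR)) h2,
        fun I v hv h => ⟨_, hv.rel hR, h3 I v hv h⟩, fun I d ⟨e, _, he⟩ => h4 I e he⟩

/-- `w` is a prefix of a word. -/
def IsPrefix {X : Type} (w : Word X) : Word X → Prop
  | .base x => w = .base x
  | .snoc z R x => w = .snoc z R x ∨ IsPrefix w z

theorem IsPrefix.len_le {X : Type} {w z : Word X} (h : IsPrefix w z) : w.len ≤ z.len := by
  induction z with
  | base x => rw [h]
  | snoc z R x ih =>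
    rcases h with rfl | h
    · exact le_rfl
    · exact (ih h).trans (Nat.le_succ _)

theorem isPrefix_refl {X : Type} (w : Word X) : IsPrefix w w := by
  cases w with
  | base x => rfl
  | snoc z R x => exact .inl rfl

/-- A graph on words that only joins words with their immediate prefixes is acyclic. -/
theorem isAcyclic_of_prefix {X : Type} {G : SimpleGraph (Word X)}
    (hG : ∀ w z, G.Adj w z → (∃ R x, z = .snoc w R x) ∨ ∃ R x, w = .snoc z R x) : G.IsAcyclic := by
  rw [SimpleGraph.isAcyclic_iff_forall_adj_isBridge]
  have key : ∀ w R x, ¬ (G.deleteEdges {s(w, .snoc w R x)}).Reachable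
      (.snoc w R x) w := by
    intro w R x hreach
    -- The words with prefix `w R x` can only be left over the edge to `w`, which is deleted.
    have inv : ∀ z, (G.deleteEdges {s(w, .snoc w R x)}).Reachable (.snoc w R x) z →
        IsPrefix (.snoc w R x) z := by
      rintro z ⟨p⟩
      suffices ∀ u, (G.deleteEdges {s(w, .snoc w R x)}).Walk u z →
          IsPrefix (.snoc w R x) u → IsPrefix (.snoc w R x) z from this _ p (isPrefix_refl _)
      clear p
      intro u q
      induction q with
      | nil => exact id
      | cons hadj _ ih =>
        rename_i a b c _
        refine fun ha => ih ?_
        obtain ⟨h1, h2⟩ := SimpleGraph.deleteEdges_adj.1 hadj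
        rcases hG _ _ h1 with ⟨R', x', rfl⟩ | ⟨R', x', rfl⟩
        · exact .inr ha
        · rcases ha with ha | ha
          · exfalso
            cases ha
            exact h2 Sym2.eq_swap
          · exact ha
    have := (inv w hreach).len_le
    simp [Word.len] at this
  intro w z hadj
  rw [SimpleGraph.isBridge_iff]
  rcases hG _ _ hadj with ⟨R, x, rfl⟩ | ⟨R, x, rfl⟩
  · exact fun h => key w R x h.symm
  · intro h
    rw [Sym2.eq_swap] at h
    exact key z R x h

/-- After the links to nominals are dropped, every edge joins a word to its immediate prefix, and
the longer word records the role and the direction. So there are neither cycles nor multiple edges.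
-/
theorem unfoldOn_treeShapedModulo : TreeShapedModulo (unfoldOn 𝒞 Γ 𝒲) Γ := by
  refine ⟨{α ∈ unfoldOn 𝒞 Γ 𝒲 | ∃ r w x, (α = .rol r w (.base x) ∨ α = .rol r (.base x) w) ∧
    IsNominal 𝒞 Γ x}, fun α h => h.1, ?_, ?_⟩
  · rintro α ⟨hα, r, w, x, h, a, ha, hax⟩
    rcases h with rfl | rfl
    · exact ⟨r, w, _, rfl, a, ha, .inr ⟨.nom a x ha hax, by rintro y rfl; exact hα.2 _ (.inr rfl)⟩⟩
    · exact ⟨r, _, w, rfl, a, ha, .inl ⟨.nom a x ha hax, by rintro y rfl; exact hα.2 _ (.inl rfl)⟩⟩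
  · set 𝒟 := {α ∈ unfoldOn 𝒞 Γ 𝒲 | ∃ r w x, (α = .rol r w (.base x) ∨ α = .rol r (.base x) w) ∧
      IsNominal 𝒞 Γ x} with h𝒟
    have key : ∀ r w z, Assertion.rol r w z ∈ unfoldOn 𝒞 Γ 𝒲 \ 𝒟 →
        (∃ x, z = .snoc w (.name r) x) ∨ ∃ x, w = .snoc z (.inv r) x := by
      rintro r w z ⟨⟨h, hv⟩, hn⟩
      cases h with
      | child _ _ x _ => exact .inl ⟨x, rfl⟩
      | childInv _ _ x _ => exact .inr ⟨x, rfl⟩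
      | toNominal _ _ x hw hx hr =>
        exact absurd ⟨⟨.toNominal _ _ x hw hx hr, hv⟩, r, w, x, .inl rfl, hx⟩ hn
      | ofNominal _ _ x hw hx hr =>
        exact absurd ⟨⟨.ofNominal _ _ x hw hx hr, hv⟩, r, z, x, .inr rfl, hx⟩ hn
    have len_ne : ∀ {w z : Word V} {R R' : Role} {x x' : V}, z = .snoc w R x → w ≠ .snoc z R' x' := by
      rintro w z R R' x x' rfl h
      have := congrArg Word.len h
      simp only [Word.len] at this
      omega
    refine ⟨isAcyclic_of_prefix fun w z hadj => ?_, fun r s w z h h' => ?_, fun r s w z h h' => ?_⟩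
    · rw [SimpleGraph.fromRel_adj] at hadj
      obtain ⟨-, ⟨r, h | h⟩ | ⟨r, h | h⟩⟩ := hadj <;> rcases key _ _ _ h with ⟨x, h⟩ | ⟨x, h⟩
      all_goals first | exact .inl ⟨_, _, h⟩ | exact .inr ⟨_, _, h⟩
    · rcases key _ _ _ h with ⟨x, h⟩ | ⟨x, h⟩ <;> rcases key _ _ _ h' with ⟨x', h'⟩ | ⟨x', h'⟩
      · cases h.symm.trans h'; rfl
      · exact absurd h' (len_ne h)
      · exact absurd h (len_ne h')
      · cases h.symm.trans h'; rfl
    · rcases key _ _ _ h with ⟨x, h⟩ | ⟨x, h⟩ <;> rcases key _ _ _ h' with ⟨x', h'⟩ | ⟨x', h'⟩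
      · exact absurd h' (len_ne h)
      · cases h.symm.trans h'
      · cases h.symm.trans h'
      · exact absurd h' (len_ne h)

/-- The concept says that the tree of `x₀` holds here and that the tree of every other root is
realized somewhere; without the universal role the latter is said along a path. It need not be
realized at the end of this particular path, since trees of different roots are joined only through
nominals, whose values are fixed. So the trees can be assigned independently. -/
theorem exists_corresponds (L : Dialect) {S : Signature} (h𝒲 : 𝒲.Finite)
    (hfin : (unfoldOn 𝒞 S.indNames 𝒲).Finite) (hun : ∀ w ∈ 𝒲, IsUnfoldWord 𝒞 S.indNames w)
    (hpre : ∀ w R x, .snoc w R x ∈ 𝒲 → w ∈ 𝒲) {x₀ : V} (hx₀ : .base x₀ ∈ 𝒲)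
    (htop : Assertion.top x₀ ∈ 𝒞) (hcon : ∀ A x, .con A x ∈ 𝒞 → NLSym.con A ∈ S)
    (hrol : ∀ R x y, HasRole 𝒞 R x y → NLSym.rol R.base ∈ S)
    (hroot : L = .elio → ∀ w ∈ 𝒲, Reach (unfoldOn 𝒞 S.indNames 𝒲) (.base x₀) w) :
    ∃ C, Corresponds L S (unfoldOn 𝒞 S.indNames 𝒲) (.base x₀) C := by
  classical
  set 𝒜 := unfoldOn 𝒞 S.indNames 𝒲 with h𝒜
  obtain ⟨N, hN⟩ : ∃ N, ∀ w ∈ 𝒲, w.len ≤ N := by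
    obtain ⟨N, hN⟩ := (h𝒲.image Word.len).bddAbove
    exact ⟨N, fun w hw => hN ⟨w, hw, rfl⟩⟩
  have hconA : ∀ A w, .con A w ∈ 𝒜 → NLSym.con A ∈ S := by
    rintro A w ⟨h, -⟩
    cases h with | con _ _ _ h => exact hcon _ _ h
  have hnomA : ∀ a w, .nom a w ∈ 𝒜 → NLSym.ind a ∈ S := by
    rintro A w ⟨h, -⟩
    cases h with | nom _ _ h _ => exact h
  have hrolA' : ∀ r w w', Assertion.rol r w w' ∈ 𝒜 → NLSym.rol r ∈ S := by
    rintro r w w' ⟨h, -⟩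
    cases h with
    | child _ _ x h => exact hrol (.name r) _ _ h.2.2
    | childInv _ _ x h => exact hrol (.inv r) _ _ h.2.2
    | toNominal _ _ x _ _ h => exact hrol (.name r) _ _ h
    | ofNominal _ _ x _ _ h => exact hrol (.name r) _ _ h
  have hrolA : ∀ R w w', HasRole 𝒜 R w w' → NLSym.rol R.base ∈ S := by
    rintro (r | r) w w' h
    · exact hrolA' _ _ _ h
    · exact hrolA' _ _ _ h
  have hsnoc : ∀ w R x, .snoc w R x ∈ 𝒲 → HasRole 𝒜 R w (.snoc w R x) := by
    rintro w (r | r) x h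
    · exact ⟨.child r w x (hun _ h), by rintro y (rfl | rfl); exacts [hpre _ _ _ h, h]⟩
    · exact ⟨.childInv r w x (hun _ h), by rintro y (rfl | rfl); exacts [h, hpre _ _ _ h]⟩
  have htree : ∀ w, (treeConcept 𝒜 𝒲 N w).sig ⊆ S :=
    treeConcept_sig hconA hnomA hrolA hsnoc N
  have hlink : ∀ b : V, ∃ C', .base b ∈ 𝒲 → L.Admits C' ∧ C'.sig ⊆ S ∧
      (∀ (I : Interpretation) (v : Word V → I.Dom), Sat I v 𝒜 →
        v (.base b) ∈ I.ext (treeConcept 𝒜 𝒲 N (.base b)) → v (.base x₀) ∈ I.ext C') ∧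
      ∀ (I : Interpretation) (d : I.Dom), d ∈ I.ext C' →
        (I.ext (treeConcept 𝒜 𝒲 N (.base b))).Nonempty := fun b => by
    by_cases hb : Word.base b ∈ 𝒲
    · obtain ⟨C', h⟩ := exists_link (𝒜 := 𝒜) (S := S) L hrolA (x := .base x₀) (y := .base b)
        (fun hL => hroot hL _ hb) (L.admits_of_uFree (treeConcept_uFree 𝒜 𝒲 N (.base b))) (htree _)
      exact ⟨C', fun _ => h⟩
    · exact ⟨.top, fun h => absurd h hb⟩
  choose link hlink using hlink
  have hbfin : {b | Word.base b ∈ 𝒲}.Finite :=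
    h𝒲.preimage (f := Word.base) fun _ _ _ _ h => Word.base.inj h
  have hlfin : (link '' {b | Word.base b ∈ 𝒲}).Finite := hbfin.image link
  refine ⟨.and (treeConcept 𝒜 𝒲 N (.base x₀)) (conj (link '' {b | Word.base b ∈ 𝒲})), ?_, ?_, ?_, ?_,
    ?_, ?_⟩
  · have h1 : L.Admits (conj (link '' {b | Word.base b ∈ 𝒲})) := conj_admits (by
      rintro _ ⟨b, hb, rfl⟩; exact (hlink b hb).1)
    cases L with
    | eliou => trivial
    | elio => exact ⟨treeConcept_uFree _ _ _ _, h1⟩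
  · refine Set.union_subset (htree _) (conj_sig ?_)
    rintro _ ⟨b, hb, rfl⟩; exact (hlink b hb).2.1
  · exact ⟨.top (.base x₀), ⟨.top _ (hun _ hx₀) htop, by rintro y rfl; exact hx₀⟩, rfl⟩
  · exact unfoldOn_treeShapedModulo
  · rintro hL w ⟨α, hα, hw⟩
    exact hroot hL w (hα.2 _ hw)
  · intro I d
    constructor
    · rintro ⟨h1, h2⟩
      rw [mem_ext_conj hlfin] at h2
      have hex : ∀ b : V, ∃ e, .base b ∈ 𝒲 → e ∈ I.ext (treeConcept 𝒜 𝒲 N (.base b)) := fun b => by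
        by_cases hb : Word.base b ∈ 𝒲
        · obtain ⟨e, he⟩ := (hlink b hb).2.2.2 I d (h2 _ ⟨b, hb, rfl⟩)
          exact ⟨e, fun _ => he⟩
        · exact ⟨d, fun h => absurd h hb⟩
      choose e he using hex
      -- The root `x₀` must be sent to the given `d`, all other roots to arbitrary realizations of
      -- their trees.
      obtain ⟨v, hv, hsat⟩ := exists_sat_of_treeConcept (e := fun b => if b = x₀ then d else e b)
        hfin h𝒲 hpre hN (fun b hb => by
          by_cases h : b = x₀
          · simpa [h] using h1
          · simpa [h] using he b hb)
      exact ⟨v, by simp [hv], hsat⟩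
    · rintro ⟨v, rfl, hv⟩
      have htv := mem_treeConcept_of_sat hfin h𝒲 hsnoc hv N
      refine ⟨htv _, (mem_ext_conj hlfin).2 ?_⟩
      rintro _ ⟨b, hb, rfl⟩
      exact (hlink b hb).2.2.1 I v hv (htv _)

end ABox
end DescrLogic

/-! ### Truncations and the equivalence of the three points -/

namespace DescrLogic

/-! ## Truncations of the unfolded canonical model -/

/-- All letters of the word lie in `F` and all roles in `Q`. -/
def Word.Over {X : Type} (F : Set X) (Q : Set Role) : Word X → Prop
  | .base x => x ∈ F
  | .snoc w R x => w.Over F Q ∧ R ∈ Q ∧ x ∈ F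

theorem Word.Over.tail_mem {X : Type} {F : Set X} {Q : Set Role} {w : Word X} (h : w.Over F Q) :
    w.tail ∈ F := by
  cases w with
  | base x => exact h
  | snoc w R x => exact h.2.2

theorem finite_words {X : Type} {F : Set X} {Q : Set Role} (hF : F.Finite) (hQ : Q.Finite) (n : ℕ) :
    {w : Word X | w.len ≤ n ∧ w.Over F Q}.Finite ∧
      {w : Word X | w.len ≤ n ∧ w.Over F Q}.ncard ≤ (F.ncard * (Q.ncard + 1) + 1) ^ (n + 1) := by
  induction n with
  | zero =>
    have h : {w : Word X | w.len ≤ 0 ∧ w.Over F Q} ⊆ Word.base '' F := by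
      rintro (x | ⟨w, R, x⟩) ⟨h1, h2⟩
      · exact ⟨x, h2, rfl⟩
      · simp [Word.len] at h1
    refine ⟨(hF.image _).subset h, (Set.ncard_le_ncard h (hF.image _)).trans
      ((Set.ncard_image_le hF).trans ?_)⟩
    rw [zero_add, pow_one]
    exact (Nat.le_mul_of_pos_right _ (Nat.succ_pos _)).trans (Nat.le_succ _)
  | succ n ih =>
    obtain ⟨ih1, ih2⟩ := ih
    set P := {w : Word X | w.len ≤ n ∧ w.Over F Q} with hP
    have hfin : (P ×ˢ (Q ×ˢ F)).Finite := ih1.prod (hQ.prod hF)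
    have h : {w : Word X | w.len ≤ n + 1 ∧ w.Over F Q} ⊆ Word.base '' F ∪
        (fun p : Word X × (Role × X) => Word.snoc p.1 p.2.1 p.2.2) '' (P ×ˢ (Q ×ˢ F)) := by
      rintro (x | ⟨w, R, x⟩) ⟨h1, h2⟩
      · exact .inl ⟨x, h2, rfl⟩
      · exact .inr ⟨(w, (R, x)), ⟨⟨by simpa [Word.len] using h1, h2.1⟩, h2.2.1, h2.2.2⟩, rfl⟩
    have hfin' := (hF.image Word.base).union
      (hfin.image fun p : Word X × (Role × X) => Word.snoc p.1 p.2.1 p.2.2)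
    refine ⟨hfin'.subset h, (Set.ncard_le_ncard h hfin').trans ((Set.ncard_union_le _ _).trans
      ((Nat.add_le_add (Set.ncard_image_le hF) (Set.ncard_image_le hfin)).trans ?_))⟩
    rw [Set.ncard_prod, Set.ncard_prod]
    -- There are `F.ncard` one-letter words and at most `b ^ (n + 1) * (Q.ncard * F.ncard)`
    -- extensions; together they fit into one more factor `b`.
    set b := F.ncard * (Q.ncard + 1) + 1 with hb
    have h1 : 1 ≤ b ^ (n + 1) := Nat.one_le_pow _ _ (by omega)
    calc F.ncard + P.ncard * (Q.ncard * F.ncard)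
        ≤ F.ncard * b ^ (n + 1) + b ^ (n + 1) * (Q.ncard * F.ncard) := by
          gcongr
          exact Nat.le_mul_of_pos_right _ h1
      _ = b ^ (n + 1) * (F.ncard * (Q.ncard + 1)) := by ring
      _ ≤ b ^ (n + 1) * b := by gcongr; omega
      _ = b ^ (n + 1 + 1) := by ring

namespace ABox

variable {V : Type} {𝒞 : ABox V} {Γ : Set ℕ} {𝒲 : Set (Word V)}

theorem HasRole.adj {𝒜 : ABox V} {R : Role} {x y : V} (h : HasRole 𝒜 R x y) : Adj 𝒜 x y := by
  cases R with
  | name r => exact ⟨r, .inl h⟩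
  | inv r => exact ⟨r, .inr h⟩

theorem Adj.hasRole {𝒜 : ABox V} {x y : V} (h : Adj 𝒜 x y) : ∃ R, HasRole 𝒜 R x y := by
  obtain ⟨r, h | h⟩ := h
  · exact ⟨.name r, h⟩
  · exact ⟨.inv r, h⟩

theorem Adj.symm {𝒜 : ABox V} {x y : V} (h : Adj 𝒜 x y) : Adj 𝒜 y x := by
  obtain ⟨r, h⟩ := h
  exact ⟨r, h.symm⟩

theorem hasRole_flip {𝒜 : ABox V} {R : Role} {x y : V} : HasRole 𝒜 R.flip x y ↔ HasRole 𝒜 R y x := by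
  cases R <;> rfl

/-- The words in `𝒲` that occur in the part of the ABox that is admitted for the language. -/
def select (𝒞 : ABox V) (Γ : Set ℕ) (𝒲 : Set (Word V)) (x₀ : V) : Dialect → Set (Word V)
  | .eliou => 𝒲
  | .elio => {w ∈ 𝒲 | Reach (unfoldOn 𝒞 Γ 𝒲) (.base x₀) w}

theorem select_subset (L : Dialect) {x₀ : V} : select 𝒞 Γ 𝒲 x₀ L ⊆ 𝒲 := by
  cases L with
  | eliou => exact subset_rfl
  | elio => exact fun w h => h.1

theorem root_mem_select (L : Dialect) {x₀ : V} (h : .base x₀ ∈ 𝒲) :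
    .base x₀ ∈ select 𝒞 Γ 𝒲 x₀ L := by
  cases L with
  | eliou => exact h
  | elio => exact ⟨h, .refl⟩

theorem mem_select_of_hasRole (L : Dialect) {x₀ : V} {R : Role} {w z : Word V}
    (hw : w ∈ select 𝒞 Γ 𝒲 x₀ L) (hz : z ∈ 𝒲) (h : HasRole (unfold 𝒞 Γ) R w z) :
    z ∈ select 𝒞 Γ 𝒲 x₀ L := by
  cases L with
  | eliou => exact hz
  | elio =>
    have hw' := hw.1
    refine ⟨hz, hw.2.tail ?_⟩
    cases R with
    | name r => exact ⟨r, .inl ⟨h, by rintro y (rfl | rfl) <;> assumption⟩⟩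
    | inv r => exact ⟨r, .inr ⟨h, by rintro y (rfl | rfl) <;> assumption⟩⟩

theorem hasRole_unfoldOn {R : Role} {w z : Word V} (hw : w ∈ 𝒲) (hz : z ∈ 𝒲)
    (h : HasRole (unfold 𝒞 Γ) R w z) : HasRole (unfoldOn 𝒞 Γ 𝒲) R w z := by
  cases R with
  | name r => exact ⟨h, by rintro y (rfl | rfl) <;> assumption⟩
  | inv r => exact ⟨h, by rintro y (rfl | rfl) <;> assumption⟩

theorem select_prefix (L : Dialect) {x₀ : V} (hun : ∀ w ∈ 𝒲, IsUnfoldWord 𝒞 Γ w)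
    (hpre : ∀ w R x, .snoc w R x ∈ 𝒲 → w ∈ 𝒲) {w : Word V} {R : Role} {x : V}
    (h : .snoc w R x ∈ select 𝒞 Γ 𝒲 x₀ L) : w ∈ select 𝒞 Γ 𝒲 x₀ L := by
  have h' := select_subset L h
  exact mem_select_of_hasRole L (R := R.flip) h (hpre _ _ _ h')
    (hasRole_flip.2 (fact_of_snoc (hun _ h')))

/-- The words on a path from the root are themselves reachable, so the path survives the restriction
to selected words. -/
theorem reach_select {x₀ : V} {w : Word V} (h : w ∈ select 𝒞 Γ 𝒲 x₀ .elio) :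
    Reach (unfoldOn 𝒞 Γ (select 𝒞 Γ 𝒲 x₀ .elio)) (.base x₀) w := by
  obtain ⟨h1, h2⟩ := h
  induction h2 with
  | refl => exact .refl
  | tail hr hadj ih =>
    rename_i y z
    obtain ⟨R, hR⟩ := hadj.hasRole
    have hyz : y ∈ 𝒲 ∧ HasRole (unfold 𝒞 Γ) R y z := by
      cases R with
      | name r => exact ⟨hR.2 _ (.inl rfl), hR.1⟩
      | inv r => exact ⟨hR.2 _ (.inr rfl), hR.1⟩
    have hy : y ∈ select 𝒞 Γ 𝒲 x₀ .elio := ⟨hyz.1, hr⟩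
    have hz : z ∈ select 𝒞 Γ 𝒲 x₀ .elio := ⟨h1, hr.tail hadj⟩
    exact (ih hyz.1).tail (hasRole_unfoldOn hy hz hyz.2).adj

theorem hasRole_unfold_tail {R : Role} {w z : Word V} (h : HasRole (unfold 𝒞 Γ) R w z) :
    HasRole 𝒞 R w.tail z.tail := by
  have key : ∀ {r : ℕ} {w z : Word V}, UnfoldFact 𝒞 Γ (.rol r w z) →
      Assertion.rol r w.tail z.tail ∈ 𝒞 := by
    intro r w z h
    cases h with
    | child _ _ x h => exact h.2.2
    | childInv _ _ x h => exact h.2.2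
    | toNominal _ _ x _ _ h => exact h
    | ofNominal _ _ x _ _ h => exact h
  cases R <;> exact key h

theorem reach_tail {w z : Word V} (h : Reach (unfold 𝒞 Γ) w z) : Reach 𝒞 w.tail z.tail := by
  induction h with
  | refl => exact .refl
  | tail _ hadj ih =>
    obtain ⟨R, hR⟩ := hadj.hasRole
    exact ih.tail (hasRole_unfold_tail hR).adj

theorem Reach.mono {𝒜 ℬ : ABox V} (h : 𝒜 ⊆ ℬ) {x y : V} (hxy : Reach 𝒜 x y) : Reach ℬ x y :=
  Relation.ReflTransGen.mono (fun _ _ ⟨r, hr⟩ => ⟨r, hr.imp (@h _) (@h _)⟩) _ _ hxy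

theorem isUnfoldWord_rootedPart {x₀ : V} {w : Word V} (hw : IsUnfoldWord 𝒞 Γ w)
    (htop : ∀ x, Assertion.top x ∈ 𝒞) (h : Reach 𝒞 x₀ w.tail) :
    IsUnfoldWord (rootedPart 𝒞 x₀) Γ w := by
  induction w with
  | base x => exact ⟨.top x, ⟨htop x, by rintro y rfl; exact h⟩, rfl⟩
  | snoc w R x ih =>
    obtain ⟨h1, h2, h3⟩ := hw
    have hx : Reach 𝒞 x₀ x := h
    have hwt : Reach 𝒞 x₀ w.tail := hx.tail h3.adj.symm
    refine ⟨ih h1 hwt, fun ⟨a, ha, ha'⟩ => h2 ⟨a, ha, ha'.1⟩, ?_⟩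
    cases R with
    | name r => exact ⟨h3, by rintro y (rfl | rfl) <;> assumption⟩
    | inv r => exact ⟨h3, by rintro y (rfl | rfl) <;> assumption⟩

theorem mem_unfold_rootedPart {x₀ : V} {α : Assertion (Word V)} (hα : α ∈ unfold 𝒞 Γ)
    (htop : ∀ x, Assertion.top x ∈ 𝒞) (h : ∀ w ∈ α.vars, Reach 𝒞 x₀ w.tail) :
    α ∈ unfold (rootedPart 𝒞 x₀) Γ := by
  have hun : ∀ w ∈ α.vars, IsUnfoldWord 𝒞 Γ w → IsUnfoldWord (rootedPart 𝒞 x₀) Γ w :=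
    fun w hw hw' => isUnfoldWord_rootedPart hw' htop (h w hw)
  cases hα with
  | top w hw ht => exact .top w (hun w rfl hw) ⟨ht, by rintro y rfl; exact h w rfl⟩
  | con A w hw ht => exact .con A w (hun w rfl hw) ⟨ht, by rintro y rfl; exact h w rfl⟩
  | nom a x ha hx => exact .nom a x ha ⟨hx, by rintro y rfl; exact h _ rfl⟩
  | child r w x hw => exact .child r w x (hun _ (.inr rfl) hw)
  | childInv r w x hw => exact .childInv r w x (hun _ (.inl rfl) hw)
  | toNominal r w x hw hx hr =>
    have h1 := h _ (.inl rfl)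
    have h2 : Reach 𝒞 x₀ x := h _ (.inr rfl)
    obtain ⟨a, ha, hax⟩ := hx
    exact .toNominal r w x (hun _ (.inl rfl) hw)
      ⟨a, ha, hax, by rintro y rfl; exact h2⟩ ⟨hr, by rintro y (rfl | rfl) <;> assumption⟩
  | ofNominal r w x hw hx hr =>
    have h1 := h _ (.inr rfl)
    have h2 : Reach 𝒞 x₀ x := h _ (.inl rfl)
    obtain ⟨a, ha, hax⟩ := hx
    exact .ofNominal r w x (hun _ (.inr rfl) hw)
      ⟨a, ha, hax, by rintro y rfl; exact h2⟩ ⟨hr, by rintro y (rfl | rfl) <;> assumption⟩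

/-- Two orders of restriction are reconciled: the truncation selects reachable words in the
unfolding of the whole reduct, whereas the rooted unfolding starts from the rooted part of the
reduct. Last letters of reachable words are reachable in the reduct, so nothing is lost. -/
theorem select_subset_rootedUnfold {x₀ : V} (htop : ∀ x, Assertion.top x ∈ 𝒞) :
    unfoldOn 𝒞 Γ (select 𝒞 Γ 𝒲 x₀ .elio) ⊆ rootedUnfold (rootedPart 𝒞 x₀) Γ x₀ := by
  have htail : ∀ w ∈ select 𝒞 Γ 𝒲 x₀ .elio, Reach 𝒞 x₀ w.tail := fun w hw =>
    reach_tail (hw.2.mono fun _ h => h.1)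
  have hsub : unfoldOn 𝒞 Γ (select 𝒞 Γ 𝒲 x₀ .elio) ⊆ unfold (rootedPart 𝒞 x₀) Γ :=
    fun α hα => mem_unfold_rootedPart hα.1 htop fun w hw => htail w (hα.2 w hw)
  exact fun α hα => ⟨hsub hα, fun w hw => (reach_select (hα.2 w hw)).mono hsub⟩

end ABox

section Truncation

variable (O : Ontology) (A : ℕ) (S : Signature)

/-- The reduct of the canonical model to `S`. -/
noncomputable def reduct : ABox (CanonicalDom O A) := (canonicalModel O A).reductABox S

/-- The words of length at most `N` of the unfolding, over canonical words of length at most `N`. -/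
def truncWords (N : ℕ) : Set (Word (CanonicalDom O A)) :=
  {w | ABox.IsUnfoldWord (reduct O A S) S.indNames w ∧ w.len ≤ N ∧
    w.Over {x | x.1.len ≤ N} Set.univ}

/-- The length at which the unfolding is truncated. -/
noncomputable def truncBound : ℕ := 2 ^ (4 * (typeConcepts O A).ncard + 6)

/-- The selected words of bounded length. -/
noncomputable def selWords (L : Dialect) : Set (Word (CanonicalDom O A)) :=
  ABox.select (reduct O A S) S.indNames (truncWords O A S (truncBound O A)) (canonicalRoot O A) L

/-- The truncation of the (rooted) undirected unfolding. -/
noncomputable def truncABox (L : Dialect) : ABox (Word (CanonicalDom O A)) :=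
  ABox.unfoldOn (reduct O A S) S.indNames (selWords O A S L)

variable {O A S}

open ABox

theorem top_mem_reduct (x : CanonicalDom O A) : Assertion.top x ∈ reduct O A S := trivial

theorem nom_mem_reduct {a : ℕ} {x : CanonicalDom O A} :
    Assertion.nom a x ∈ reduct O A S ↔ NLSym.ind a ∈ S ∧ (canonicalModel O A).ind a = x := Iff.rfl

theorem hasRole_reduct {R : Role} {x y : CanonicalDom O A} :
    HasRole (reduct O A S) R x y ↔ NLSym.rol R.base ∈ S ∧ (canonicalModel O A).rel R x y := by
  cases R <;> rfl

theorem mem_ind_reduct (x : CanonicalDom O A) : x ∈ ind (reduct O A S) :=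
  ⟨.top x, top_mem_reduct x, rfl⟩

theorem isUnfoldWord_of_mem_truncWords {N : ℕ} {w : Word (CanonicalDom O A)}
    (h : w ∈ truncWords O A S N) : IsUnfoldWord (reduct O A S) S.indNames w := h.1

theorem truncWords_prefix {N : ℕ} (w : Word (CanonicalDom O A)) (R : Role) (x : CanonicalDom O A)
    (h : .snoc w R x ∈ truncWords O A S N) : w ∈ truncWords O A S N :=
  ⟨h.1.1, (Nat.le_succ _).trans h.2.1, h.2.2.1⟩

theorem base_mem_truncWords {N : ℕ} {x : CanonicalDom O A} (h : x.1.len ≤ N) :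
    .base x ∈ truncWords O A S N := ⟨mem_ind_reduct x, Nat.zero_le _, h⟩

/-- The elements of the canonical model that occur in the ABox for the language `L`. -/
def Occurs (O : Ontology) (A : ℕ) (S : Signature) (L : Dialect) (x : CanonicalDom O A) : Prop :=
  L = .elio → Reach (reduct O A S) (canonicalRoot O A) x

theorem mem_canonicalABox {L : Dialect} {α : Assertion (CanonicalDom O A)} :
    α ∈ canonicalABox O A S L ↔ α ∈ reduct O A S ∧ ∀ x ∈ α.vars, Occurs O A S L x := by
  cases L with
  | eliou => exact ⟨fun h => ⟨h, fun _ _ hL => by cases hL⟩, fun h => h.1⟩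
  | elio => exact ⟨fun h => ⟨h.1, fun x hx _ => h.2 x hx⟩, fun h => ⟨h.1, fun x hx => h.2 x hx rfl⟩⟩

theorem Occurs.step {L : Dialect} {x y : CanonicalDom O A} (hx : Occurs O A S L x) {R : Role}
    (h : HasRole (reduct O A S) R x y) : Occurs O A S L y := fun hL => (hx hL).tail h.adj

theorem hasRole_canonicalABox {L : Dialect} {x y : CanonicalDom O A} (hx : Occurs O A S L x)
    {R : Role} (h : HasRole (reduct O A S) R x y) : HasRole (canonicalABox O A S L) R x y := by
  have hy := hx.step h
  cases R with
  | name r => exact mem_canonicalABox.2 ⟨h, by rintro z (rfl | rfl) <;> assumption⟩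
  | inv r => exact mem_canonicalABox.2 ⟨h, by rintro z (rfl | rfl) <;> assumption⟩

/-- Concepts of the language over `S` carry over from the canonical model. -/
theorem mem_ext_of_sat_canonicalABox {L : Dialect} {I : Interpretation}
    {v : CanonicalDom O A → I.Dom} (hv : Sat I v (canonicalABox O A S L)) {D : Concept}
    (hL : L.Admits D) (hD : D.sig ⊆ S) {x : CanonicalDom O A} (hx : Occurs O A S L x)
    (h : x ∈ (canonicalModel O A).ext D) : v x ∈ I.ext D := by
  have hsub : ∀ {C D : Concept}, L.Admits (.and C D) → L.Admits C ∧ L.Admits D := by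
    intro C D h
    cases L with
    | eliou => exact ⟨trivial, trivial⟩
    | elio => exact h
  induction D generalizing x with
  | top => trivial
  | name X =>
    exact hv (.con X x) (mem_canonicalABox.2 ⟨⟨hD rfl, h⟩, by rintro y rfl; exact hx⟩)
  | nom a =>
    have := hv (.nom a x) (mem_canonicalABox.2 ⟨⟨hD rfl, h.symm⟩, by rintro y rfl; exact hx⟩)
    exact this.symm
  | and C D ihC ihD =>
    exact ⟨ihC (hsub hL).1 (Set.subset_union_left.trans hD) hx h.1,
      ihD (hsub hL).2 (Set.subset_union_right.trans hD) hx h.2⟩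
  | ex R C ih =>
    obtain ⟨y, hxy, hy⟩ := h
    have hr : HasRole (reduct O A S) R x y := hasRole_reduct.2 ⟨hD (.inl rfl), hxy⟩
    have hL' : L.Admits C := by
      cases L with
      | eliou => trivial
      | elio => exact hL
    exact ⟨v y, hv.rel (hasRole_canonicalABox hx hr),
      ih hL' (Set.subset_union_right.trans hD) (hx.step hr) hy⟩
  | exU C ih =>
    cases L with
    | eliou =>
      obtain ⟨y, hy⟩ := h
      exact ⟨v y, ih trivial hD (fun h => by cases h) hy⟩
    | elio => exact absurd hL id

/-- Point 1 implies Point 2: the interpolant holds at the root of the canonical model, and the ABox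
retains all that `D` can express there. -/
theorem entails_of_interpolant {L : Dialect} {B : ℕ} (hO : O.IsNormal) {D : Concept}
    (hL : L.Admits D) (hD : D.sig ⊆ S) (h₁ : O.Entails (.name A) D) (h₂ : O.Entails D (.name B)) :
    ABox.Entails O (canonicalABox O A S L) B (canonicalRoot O A) := fun I hI _ hv =>
  h₂ I hI (mem_ext_of_sat_canonicalABox hv hL hD (fun _ => .refl)
    (h₁ _ (canonicalModel_isModel hO) canonicalRoot_mem))

theorem sat_unfold_tail {V : Type} {𝒞 : ABox V} {Γ : Set ℕ} {I : Interpretation} {v : V → I.Dom}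
    (hv : Sat I v 𝒞) : Sat I (fun w : Word V => v w.tail) (unfold 𝒞 Γ) := by
  intro α hα
  cases hα with
  | top w _ _ => trivial
  | con X w _ h => exact hv _ h
  | nom a x _ h => exact hv _ h
  | child r w x h => exact hv _ h.2.2
  | childInv r w x h => exact hv _ h.2.2
  | toNominal r w x _ _ h => exact hv _ h
  | ofNominal r w x _ _ h => exact hv _ h

/-- Every word is sent to the image of its last letter under the homomorphism from the canonical
model. -/
theorem satAt_unfold {I : Interpretation} (hI : I.IsModel O) (hS : S.indNames ⊆ O.sig.indNames)
    {d : I.Dom} (hd : d ∈ I.con A) {𝒜 : ABox (Word (CanonicalDom O A))}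
    (h𝒜 : 𝒜 ⊆ unfold (reduct O A S) S.indNames) : SatAt I 𝒜 (.base (canonicalRoot O A)) d := by
  obtain ⟨h, h1, h2, h3, h4⟩ := exists_hom_canonicalModel hI hd
  refine ⟨fun w => h w.tail, h1, fun α hα => sat_unfold_tail ?_ α (h𝒜 hα)⟩
  rintro (x | ⟨X, x⟩ | ⟨a, x⟩ | ⟨r, x, y⟩) hα
  · trivial
  · exact h2 x _ hα.2
  · obtain ⟨ha, rfl⟩ := hα
    exact (h4 a (hS ha)).symm
  · exact h3 _ _ _ hα.2

/-! ### Size -/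

theorem roles_finite_card : {R : Role | NLSym.rol R.base ∈ O.sig}.Finite ∧
    {R : Role | NLSym.rol R.base ∈ O.sig}.ncard ≤ 2 * O.sub.ncard := by
  set F : Set Role := (fun C : Concept => match C with | .ex R _ => R | _ => Role.name 0) '' O.sub
    with hF
  have h2 : F.Finite := O.sub_finite.image _
  have hsub : {R : Role | NLSym.rol R.base ∈ O.sig} ⊆ F ∪ Role.flip '' F := by
    intro R hR
    obtain ⟨R', C, hb, hC⟩ := Ontology.rol_mem_sig.1 hR
    have : R = R' ∨ R = R'.flip := by
      cases R <;> cases R' <;> simp_all [Role.base, Role.flip]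
    rcases this with rfl | rfl
    · exact .inl ⟨_, hC, rfl⟩
    · exact .inr ⟨R', ⟨_, hC, rfl⟩, rfl⟩
  have hfin := h2.union (h2.image Role.flip)
  refine ⟨hfin.subset hsub, (Set.ncard_le_ncard hsub hfin).trans ((Set.ncard_union_le _ _).trans ?_)⟩
  have h3 : F.ncard ≤ O.sub.ncard := Set.ncard_image_le O.sub_finite
  have h4 := Set.ncard_image_le (f := Role.flip) h2
  omega

theorem Concept.ncard_sub_le (C : Concept) : C.sub.ncard ≤ C.size := by
  induction C with
  | top | name _ | nom _ => exact (Set.ncard_singleton _).le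
  | and C D ihC ihD =>
    refine (Set.ncard_union_le _ _).trans ?_
    have := Set.ncard_union_le {Concept.and C D} C.sub
    rw [Set.ncard_singleton] at this
    simp only [Concept.size]
    omega
  | ex R C ih =>
    refine (Set.ncard_union_le _ _).trans ?_
    rw [Set.ncard_singleton]
    simp only [Concept.size]
    omega
  | exU C ih =>
    refine (Set.ncard_union_le _ _).trans ?_
    rw [Set.ncard_singleton]
    simp only [Concept.size]
    omega

theorem Ontology.ncard_sub_le (O : Ontology) : O.sub.ncard ≤ O.size := by
  classical
  have h : O.sub = ⋃ c ∈ O, (c.lhs.sub ∪ c.rhs.sub) := by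
    ext C; simp [Ontology.sub]
  rw [h]
  unfold Ontology.size
  induction O using Finset.induction_on with
  | empty => simp
  | insert c O hc ih =>
    rw [Finset.set_biUnion_insert, Finset.sum_insert hc]
    refine (Set.ncard_union_le _ _).trans (Nat.add_le_add ?_ (ih ?_))
    · refine (Set.ncard_union_le _ _).trans ?_
      have h1 := c.lhs.ncard_sub_le
      have h2 := c.rhs.ncard_sub_le
      simp only [Inclusion.size]
      omega
    · ext C; simp [Ontology.sub]

theorem ncard_typeConcepts_le (O : Ontology) (A : ℕ) :
    (typeConcepts O A).ncard ≤ O.size + 2 * O.size * O.size + 2 := by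
  have hn := O.ncard_sub_le
  obtain ⟨hr1, hr2⟩ := roles_finite_card (O := O)
  have hfin := (hr1.prod O.sub_finite)
  have hsub : typeConcepts O A ⊆ (O.sub ∪ (fun p : Role × Concept => Concept.ex p.1 p.2) ''
      ({R : Role | NLSym.rol R.base ∈ O.sig} ×ˢ O.sub)) ∪ {.name A, .exU (.name A)} := by
    refine Set.union_subset_union_left _ (Set.union_subset_union_right _ ?_)
    rintro _ ⟨R, a, hR, ha, rfl⟩
    exact ⟨(R, .nom a), ⟨hR, Ontology.ind_mem_sig.1 ha⟩, rfl⟩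
  refine (Set.ncard_le_ncard hsub ((O.sub_finite.union (hfin.image _)).union
    (Set.toFinite _))).trans ((Set.ncard_union_le _ _).trans ?_)
  refine Nat.add_le_add ((Set.ncard_union_le _ _).trans (Nat.add_le_add hn ?_)) ?_
  · refine (Set.ncard_image_le hfin).trans ?_
    rw [Set.ncard_prod]
    gcongr
    omega
  · rw [Set.ncard_pair]; simp

theorem canonicalWord_over {w : Word (Set Concept)} (h : IsCanonicalWord O A w) :
    w.Over {τ | τ ⊆ typeConcepts O A} {R | NLSym.rol R.base ∈ O.sig} := by
  induction w with
  | base τ => exact h.isType.1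
  | snoc w R τ ih => exact ⟨ih h.1, h.2.2.rol_mem h.1.isType.1, h.isType.1⟩

theorem truncWords_over (hS : S ⊆ O.sig ∪ {NLSym.con A}) {N : ℕ} {w : Word (CanonicalDom O A)}
    (h : w ∈ truncWords O A S N) : w.Over {x | x.1.len ≤ N} {R | NLSym.rol R.base ∈ O.sig} := by
  obtain ⟨h1, -, h2⟩ := h
  induction w with
  | base x => exact h2
  | snoc w R x ih =>
    refine ⟨ih h1.1 h2.1, ?_, h2.2.2⟩
    rcases hS (hasRole_reduct.1 h1.2.2).1 with h | h
    · exact h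
    · cases h

/-- Here `x` counts types, `q` roles, `b₁` canonical words and `b₂` words of the unfolding. Words
over words raise the base twice to the power `N + 1`, so the binary logarithm of `b₂` is polynomial
in `N`; it is at most `N ^ 5 = 2 ^ (20 * c + 30)`. -/
theorem ncard_le_of_counts {c s b₁ b₂ q x N : ℕ} (hN : N = 2 ^ (4 * c + 6)) (hx : x ≤ 2 ^ c)
    (hq : q ≤ 2 * c) (h₁ : b₁ ≤ (x * (q + 1) + 1) ^ (N + 1))
    (h₂ : b₂ ≤ (b₁ * (q + 1) + 1) ^ (N + 1)) (hs : c ≤ s) : b₂ ≤ 2 ^ 2 ^ (20 * s + 30) := by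
  have hc : c < 2 ^ c := Nat.lt_two_pow_self
  have hq1 : q + 1 ≤ 2 ^ (c + 1) := by rw [pow_succ]; omega
  have e1 : x * (q + 1) + 1 ≤ 2 ^ (2 * c + 2) := by
    have : x * (q + 1) ≤ 2 ^ c * 2 ^ (c + 1) := Nat.mul_le_mul hx hq1
    have h1 : 1 ≤ 2 ^ c * 2 ^ (c + 1) := Nat.one_le_iff_ne_zero.2 (by positivity)
    have h2 : 2 ^ (2 * c + 2) = 2 * (2 ^ c * 2 ^ (c + 1)) := by ring
    omega
  have e2 : b₁ ≤ 2 ^ ((2 * c + 2) * (N + 1)) := by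
    rw [pow_mul]; exact h₁.trans (Nat.pow_le_pow_left e1 _)
  have e3 : b₁ * (q + 1) + 1 ≤ 2 ^ ((2 * c + 2) * (N + 1) + (c + 2)) := by
    have : b₁ * (q + 1) ≤ 2 ^ ((2 * c + 2) * (N + 1)) * 2 ^ (c + 1) := Nat.mul_le_mul e2 hq1
    have h1 : 1 ≤ 2 ^ ((2 * c + 2) * (N + 1)) * 2 ^ (c + 1) := Nat.one_le_iff_ne_zero.2 (by positivity)
    have h2 : 2 ^ ((2 * c + 2) * (N + 1) + (c + 2)) =
      2 * (2 ^ ((2 * c + 2) * (N + 1)) * 2 ^ (c + 1)) := by ring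
    omega
  have e4 : b₂ ≤ 2 ^ (((2 * c + 2) * (N + 1) + (c + 2)) * (N + 1)) := by
    rw [pow_mul]; exact h₂.trans (Nat.pow_le_pow_left e3 _)
  refine e4.trans (Nat.pow_le_pow_right (by norm_num) ?_)
  have hN4 : 2 * c + 2 ≤ N := by
    have : 2 ^ (4 * c + 6) = 2 ^ c * (2 ^ (3 * c) * 64) := by ring
    have h3 : 1 ≤ 2 ^ (3 * c) := Nat.one_le_two_pow
    nlinarith
  have hN1 : 2 ≤ N := by omega
  calc ((2 * c + 2) * (N + 1) + (c + 2)) * (N + 1)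
      ≤ (N * (N + N) + N) * (N + N) := by
        gcongr <;> omega
    _ ≤ N ^ 5 := by
        have h4 : N * (N + N) + N ≤ N ^ 3 + N ^ 3 := by nlinarith [Nat.mul_le_mul hN1 hN1]
        have h5 : (N ^ 3 + N ^ 3) * (N + N) = N ^ 4 * 4 := by ring
        have h6 : 4 ≤ N := by rw [hN]; calc 4 = 2 ^ 2 := rfl
                                _ ≤ _ := Nat.pow_le_pow_right (by norm_num) (by omega)
        calc (N * (N + N) + N) * (N + N) ≤ (N ^ 3 + N ^ 3) * (N + N) := by gcongr
          _ = N ^ 4 * 4 := h5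
          _ ≤ N ^ 4 * N := by gcongr
          _ = N ^ 5 := by ring
    _ = 2 ^ ((4 * c + 6) * 5) := by rw [hN, ← pow_mul]
    _ ≤ 2 ^ (20 * s + 30) := Nat.pow_le_pow_right (by norm_num) (by omega)

/-- The polynomial in the exponent of the bound on the number of individuals. -/
noncomputable def sizePoly : Polynomial ℕ :=
  20 * (Polynomial.X + 2 * Polynomial.X * Polynomial.X + 2) + 30

theorem truncWords_finite_card (hS : S ⊆ O.sig ∪ {NLSym.con A}) :
    (truncWords O A S (truncBound O A)).Finite ∧
      (truncWords O A S (truncBound O A)).ncard ≤ 2 ^ 2 ^ sizePoly.eval O.size := by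
  set N := truncBound O A with hN
  set Q := {R : Role | NLSym.rol R.base ∈ O.sig} with hQ
  obtain ⟨hQ1, hQ2⟩ := roles_finite_card (O := O)
  have hcl := typeConcepts_finite O A
  obtain ⟨f1, c1⟩ := finite_words hcl.finite_subsets hQ1 N
  have hx : {τ | τ ⊆ typeConcepts O A}.ncard = 2 ^ (typeConcepts O A).ncard :=
    Set.ncard_powerset _ hcl
  have hF : ((Subtype.val : CanonicalDom O A → _) '' {x | x.1.len ≤ N}) ⊆
      {w | w.len ≤ N ∧ w.Over {τ | τ ⊆ typeConcepts O A} Q} := by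
    rintro _ ⟨x, hx, rfl⟩
    exact ⟨hx, canonicalWord_over x.2⟩
  have f2 : {x : CanonicalDom O A | x.1.len ≤ N}.Finite :=
    (f1.subset hF).of_finite_image Subtype.val_injective.injOn
  have c2 : {x : CanonicalDom O A | x.1.len ≤ N}.ncard ≤ _ :=
    (Set.ncard_image_of_injective _ Subtype.val_injective).symm.le.trans
      ((Set.ncard_le_ncard hF f1).trans c1)
  obtain ⟨f3, c3⟩ := finite_words f2 hQ1 N
  have hsub : truncWords O A S N ⊆ {w | w.len ≤ N ∧ w.Over {x : CanonicalDom O A | x.1.len ≤ N} Q} :=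
    fun w hw => ⟨hw.2.1, truncWords_over hS hw⟩
  refine ⟨f3.subset hsub, (Set.ncard_le_ncard hsub f3).trans ?_⟩
  have hsc : O.sub.ncard ≤ (typeConcepts O A).ncard :=
    Set.ncard_le_ncard sub_subset_typeConcepts hcl
  have hev : sizePoly.eval O.size = 20 * (O.size + 2 * O.size * O.size + 2) + 30 := by
    simp [sizePoly]
  rw [hev]
  exact ncard_le_of_counts (s := O.size + 2 * O.size * O.size + 2) rfl hx.le (by omega) c2 c3
    (ncard_typeConcepts_le O A)

/-- The number of rounds required by `exists_labelling`, for `2 ^ c` letters and `m` labels. This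
determines the value of `truncBound`. -/
theorem ncard_bound {c m : ℕ} (hm : m ≤ 2 ^ (c + 1)) :
    (2 ^ c * (2 * m + 1) + 2) * (2 ^ c * m + 1) ≤ 2 ^ (4 * c + 6) := by
  have h1 : 1 ≤ 2 ^ c := Nat.one_le_two_pow
  have e : 2 ^ (c + 1) = 2 * 2 ^ c := by ring
  have e2 : 2 ^ (4 * c + 6) = 8 * (2 ^ c * 2 ^ c) * (8 * (2 ^ c * 2 ^ c)) := by ring
  rw [e2]
  have h2 : 2 ^ c * m ≤ 2 ^ c * (2 * 2 ^ c) := Nat.mul_le_mul_left _ (e ▸ hm)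
  have h3 : 2 ^ c ≤ 2 ^ c * 2 ^ c := Nat.le_mul_of_pos_right _ h1
  apply Nat.mul_le_mul
  · nlinarith
  · nlinarith

/-! ### Entailment is witnessed by the truncation -/

/-- The labelling problem for the canonical model. -/
noncomputable def labelProblem (O : Ontology) (A : ℕ) (S : Signature) (I : Interpretation)
    (Y : Set Concept) : LabelProblem (Set Concept) (MeetType I Y) where
  base := conceptTypes O A ∪ nominalTypes O A
  nom := nominalTypes O A
  succ := TypeSucc O A
  link R τ ν := ∃ a, NLSym.ind a ∈ O.sig ∧ .ex R (.nom a) ∈ τ ∧ ν = leastType O A (.nom a)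
  obs := {R | NLSym.rol R.base ∈ S}
  letters := {τ | τ ⊆ typeConcepts O A}
  comp R s t := Compatible O R s.1 t.1
  loc τ t := (∀ X, NLSym.con X ∈ S → .name X ∈ τ → .name X ∈ t.1) ∧
    ∀ a, NLSym.ind a ∈ S → τ = leastType O A (.nom a) → .nom a ∈ t.1
  nom_base := Set.subset_union_right
  link_nom := by rintro R τ ν ⟨a, ha, -, rfl⟩; exact ⟨a, ha, rfl⟩
  obs_flip := by intro R h; simpa using h
  comp_flip := Compatible.flip
  comp_inf := Compatible.inter
  loc_inf := fun h h' => ⟨fun X hX hτ => ⟨h.1 X hX hτ, h'.1 X hX hτ⟩,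
    fun a ha hτ => ⟨h.2 a ha hτ, h'.2 a ha hτ⟩⟩
  letters_finite := (typeConcepts_finite O A).finite_subsets
  base_letters := by
    rintro τ (⟨B, -, rfl⟩ | ⟨a, -, rfl⟩) <;> exact (leastType_isType _).1
  succ_letters := fun h => h.prop.1.1

theorem labelProblem_valid {I : Interpretation} {Y : Set Concept} {w : Word (Set Concept)} :
    (labelProblem O A S I Y).Valid w ↔ IsCanonicalWord O A w := by
  induction w with
  | base τ => rfl
  | snoc w R τ ih => exact and_congr_left fun _ => ih

theorem labelProblem_edge {I : Interpretation} {Y : Set Concept} {R : Role} {x y : CanonicalDom O A} :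
    (labelProblem O A S I Y).Edge R x.1 y.1 ↔ HasRole (reduct O A S) R x y := by
  rw [hasRole_reduct, canonicalModel_rel]
  have key : ∀ {R : Role} {x : CanonicalDom O A} {z : Word (Set Concept)},
      (∃ ν, (labelProblem O A S I Y).link R x.1.tail ν ∧ z = .base ν) ↔
      ∃ a, .ex R (.nom a) ∈ x.1.tail ∧ z = .base (leastType O A (.nom a)) := by
    intro R x z
    constructor
    · rintro ⟨ν, ⟨a, -, h, rfl⟩, rfl⟩; exact ⟨a, h, rfl⟩
    · rintro ⟨a, h, rfl⟩
      exact ⟨_, ⟨a, nom_mem_typeConcepts_iff.1 (typeConcepts_closed (x.2.isType.1 h) (.inr rfl)), h,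
        rfl⟩, rfl⟩
  unfold LabelProblem.Edge
  rw [key, key]
  rfl

/-- An element whose last type is `τ_a` is the one-letter word `τ_a`, by
`IsCanonicalWord.eq_of_nom_mem`. -/
theorem nominal_iff (hS : S.indNames ⊆ O.sig.indNames) {a : ℕ} (ha : NLSym.ind a ∈ S)
    {x : CanonicalDom O A} : Assertion.nom a x ∈ reduct O A S ↔ x.1.tail = leastType O A (.nom a) := by
  have ha' : NLSym.ind a ∈ O.sig := hS ha
  rw [nom_mem_reduct]
  constructor
  · rintro ⟨-, rfl⟩
    rw [canonicalModel_ind ha']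
    rfl
  · intro h
    refine ⟨ha, Subtype.ext ?_⟩
    rw [canonicalModel_ind ha']
    exact (x.2.eq_of_nom_mem (h ▸ mem_leastType (nom_mem_typeConcepts ha'))).symm

/-- By contraposition: an assignment of the truncation into a model `I` without `B` at the root
provides labels that survive `N` rounds. The labelling obtained from them is an assignment of the
full ABox into `meetModel` without `B` at the root. -/
theorem entails_truncABox (hO : O.IsNormal) (hS : S ⊆ O.sig ∪ {NLSym.con A}) {L : Dialect} {B : ℕ}
    (h : ABox.Entails O (canonicalABox O A S L) B (canonicalRoot O A)) :
    ABox.Entails O (truncABox O A S L) B (.base (canonicalRoot O A)) := by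
  intro I hI v hv
  by_contra hB
  have hSi : S.indNames ⊆ O.sig.indNames := fun a ha => by
    rcases hS ha with h | h
    · exact h
    · cases h
  set N := truncBound O A with hN
  -- The name `B` need not occur in `O`, so it is added; hence the exponent `c + 1` in the bound on
  -- the number of labels.
  set Y : Set Concept := insert (.name B) (typeConcepts O A) with hY
  have hYfin : Y.Finite := (typeConcepts_finite O A).insert _
  have hYn : ∀ X, .name X ∈ O.sub → .name X ∈ Y := fun X hX => .inr (sub_subset_typeConcepts hX)
  have hYa : ∀ a, .nom a ∈ O.sub → .nom a ∈ Y := fun X hX => .inr (sub_subset_typeConcepts hX)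
  have := MeetType.finite (I := I) hYfin
  set D := labelProblem O A S I Y with hD
  have hYS : ∀ X, NLSym.con X ∈ S → .name X ∈ Y := fun X hX => by
    rcases hS hX with h | h
    · exact hYn X (Ontology.con_mem_sig.1 h)
    · cases h; exact .inr name_mem_typeConcepts
  have hfact : ∀ {α : Assertion (Word (CanonicalDom O A))}, α ∈ unfold (reduct O A S) S.indNames →
      (∀ y ∈ α.vars, y ∈ selWords O A S L) → α.Sat I v := fun hα hvars => hv _ ⟨hα, hvars⟩
  -- Different copies of a canonical element may have different types in `I`, but each of them is a
  -- good label. A round of checks moves to a neighbour in the unfolding, so a word of length `l`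
  -- leaves `N - l` rounds.
  have hgood : ∀ k, ∀ w ∈ selWords O A S L, w.len + k ≤ N →
      elemType Y (v w) ∈ D.good N k w.tail.1 := by
    intro k
    induction k with
    | zero =>
      intro w hw hl
      have hwt := select_subset L hw
      constructor
      · intro X hX hXw
        exact mem_elemType.2 ⟨hYS X hX,
          hfact (.con X w hwt.1 ⟨hX, hXw⟩) (by rintro y rfl; exact hw)⟩
      · intro a ha htail
        have hnom := (nominal_iff hSi ha).2 htail
        cases w with
        | snoc w R x => exact absurd ⟨a, ha, hnom⟩ hwt.1.2.1
        | base x =>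
          refine mem_elemType.2 ⟨hYa _ (Ontology.ind_mem_sig.1 (hSi ha)), ?_⟩
          exact (hfact (.nom a x ha hnom) (by rintro y rfl; exact hw)).symm
    | succ k ih =>
      intro w hw hl
      refine ⟨ih w hw (by omega), fun R y hy hyl hedge => ?_⟩
      have hwt := select_subset L hw
      let y' : CanonicalDom O A := ⟨y, labelProblem_valid.1 hy⟩
      have hr : HasRole (reduct O A S) R w.tail y' := labelProblem_edge.1 hedge
      -- A step to a nominal ends in a one-letter word; every other step, also back to the parent,
      -- appends a letter.
      obtain ⟨z, hz, hzl, hzt, hwz⟩ : ∃ z ∈ truncWords O A S N, z.len + k ≤ N ∧ z.tail = y' ∧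
          HasRole (unfold (reduct O A S) S.indNames) R w z := by
        by_cases hnom : IsNominal (reduct O A S) S.indNames y'
        · refine ⟨.base y', base_mem_truncWords hyl, by simp only [Word.len]; omega, rfl, ?_⟩
          cases R with
          | name r => exact .toNominal r w y' hwt.1 hnom hr
          | inv r => exact .ofNominal r w y' hwt.1 hnom hr
        · have hun : IsUnfoldWord (reduct O A S) S.indNames (.snoc w R y') := ⟨hwt.1, hnom, hr⟩
          exact ⟨.snoc w R y', ⟨hun, by simp only [Word.len]; omega, hwt.2.2, trivial, hyl⟩,
            by simp only [Word.len]; omega, rfl, fact_of_snoc hun⟩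
      have hzs := mem_select_of_hasRole L hw hz hwz
      refine ⟨elemType Y (v z), ?_, ?_⟩
      · have := ih z hzs hzl
        rwa [hzt] at this
      · exact compatible_elemType hI hYn (hv.rel (hasRole_unfoldOn hw hzs hwz))
  have hrootw : Word.base (canonicalRoot O A) ∈ truncWords O A S N :=
    base_mem_truncWords (Nat.zero_le _)
  have hroot := hgood N _ (root_mem_select L hrootw) (by simp [Word.len])
  have hletters : D.letters.ncard = 2 ^ (typeConcepts O A).ncard :=
    Set.ncard_powerset _ (typeConcepts_finite O A)
  have hm : Nat.card (MeetType I Y) ≤ 2 ^ ((typeConcepts O A).ncard + 1) :=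
    (MeetType.card_le hYfin).trans (Nat.pow_le_pow_right (by norm_num) (Set.ncard_insert_le _ _))
  have hbound := ncard_bound hm
  rw [← hletters] at hbound
  obtain ⟨f, f1, f2, ⟨t, f3, f3'⟩, f4⟩ := D.exists_labelling (N := N) (M := N)
    (labelProblem_valid.2 (canonicalRoot O A).2) rfl
    (by
      refine le_trans ?_ hbound
      refine le_trans ?_ (Nat.le_mul_of_pos_right _ (Nat.succ_pos _))
      omega) hbound hroot
  -- With the universal role, every short canonical word is a one-letter word of the truncation and
  -- thus has a good label. Without it, labels propagate along a path from the root.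
  have hocc : ∀ x, Occurs O A S L x → ∃ t, f x.1 = some t := by
    intro x hx
    cases L with
    | eliou =>
      refine f4 (fun w hw hl => ?_) x.1 (labelProblem_valid.2 x.2)
      exact ⟨_, hgood N (.base ⟨w, labelProblem_valid.1 hw⟩) (base_mem_truncWords hl)
        (by simp [Word.len])⟩
    | elio =>
      have hx' := hx rfl
      clear hx
      induction hx' with
      | refl => exact ⟨t, f3⟩
      | tail _ hadj ih =>
        rename_i y z _
        obtain ⟨s, hs⟩ := ih
        obtain ⟨R, hR⟩ := hadj.hasRole
        obtain ⟨t', ht', -⟩ := f2 R y.1 z.1 s (labelProblem_valid.2 y.2) (labelProblem_valid.2 z.2)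
          (labelProblem_edge.2 hR) hs
        exact ⟨t', ht'⟩
  -- The default concerns only elements that do not occur in the ABox.
  let v' : CanonicalDom O A → (meetModel I Y O).Dom := fun x =>
    (f x.1).getD (elemType Y (v (.base (canonicalRoot O A))))
  have hv' : ∀ x t, f x.1 = some t → v' x = t := fun x t ht => by
    simp only [v', ht, Option.getD_some]
    rfl
  have hsat : Sat (meetModel I Y O) v' (canonicalABox O A S L) := by
    intro α hα
    obtain ⟨hα, hocc'⟩ := mem_canonicalABox.1 hα
    cases α with
    | top x => trivial
    | con X x =>
      obtain ⟨t, ht⟩ := hocc x (hocc' x rfl)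
      change _ ∈ (v' x).1
      rw [hv' x t ht]
      exact (f1 _ t (labelProblem_valid.2 x.2) ht).1 X hα.1 hα.2
    | nom a x =>
      obtain ⟨t, ht⟩ := hocc x (hocc' x rfl)
      change _ = v' x
      rw [hv' x t ht]
      exact (MeetType.eq_of_nom_mem ((f1 _ t (labelProblem_valid.2 x.2) ht).2 a hα.1
        ((nominal_iff hSi hα.1).1 hα))).symm
    | rol r x y =>
      obtain ⟨t, ht⟩ := hocc x (hocc' x (.inl rfl))
      obtain ⟨t', ht', hc⟩ := f2 (.name r) x.1 y.1 t (labelProblem_valid.2 x.2)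
        (labelProblem_valid.2 y.2) (labelProblem_edge.2 hα) ht
      change Compatible O _ (v' x).1 (v' y).1
      rw [hv' x t ht, hv' y t' ht']
      exact hc
  have hfin := h _ (meetModel_isModel hO hI hYn hYa) v' hsat
  rw [hv' _ t f3] at hfin
  -- The label of the root lies below the type of its value in `I`, so `B` in the label would mean
  -- `B` in `I`.
  exact hB (mem_elemType.1 (f3' hfin)).2

/-! ### The truncation as a witness -/

theorem truncABox_subset (L : Dialect) : truncABox O A S L ⊆ unfoldedABox O A S L := by
  cases L with
  | eliou => exact fun α hα => hα.1
  | elio => exact select_subset_rootedUnfold top_mem_reduct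

theorem signature_finite (O : Ontology) : O.sig.Finite := by
  have hc : ∀ C : Concept, C.sig.Finite := fun C => by
    induction C with
    | top => exact Set.finite_empty
    | name _ | nom _ => exact Set.finite_singleton _
    | and C D ihC ihD => exact ihC.union ihD
    | ex R C ih => exact (Set.finite_singleton _).union ih
    | exU C ih => exact ih
  refine (O.finite_toSet.biUnion fun c _ => (hc c.lhs).union (hc c.rhs)).subset ?_
  rintro s ⟨c, hc, h⟩
  exact Set.mem_biUnion hc h

theorem truncABox_finite (hS : S ⊆ O.sig ∪ {NLSym.con A}) (L : Dialect) :
    (truncABox O A S L).Finite := by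
  have hW : (selWords O A S L).Finite := (truncWords_finite_card hS).1.subset (select_subset L)
  have hSf : S.Finite := ((signature_finite O).union (Set.finite_singleton _)).subset hS
  have hc : (NLSym.con ⁻¹' S).Finite := hSf.preimage fun _ _ _ _ h => NLSym.con.inj h
  have hi : (NLSym.ind ⁻¹' S).Finite := hSf.preimage fun _ _ _ _ h => NLSym.ind.inj h
  have hr : (NLSym.rol ⁻¹' S).Finite := hSf.preimage fun _ _ _ _ h => NLSym.rol.inj h
  refine ((hW.image Assertion.top).union ((hc.image2 Assertion.con hW).union
    ((hi.image2 Assertion.nom hW).union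
    (hr.image2 (fun r (p : Word (CanonicalDom O A) × Word (CanonicalDom O A)) =>
      Assertion.rol r p.1 p.2) (hW.prod hW))))).subset ?_
  rintro (w | ⟨X, w⟩ | ⟨a, w⟩ | ⟨r, w, z⟩) ⟨hα, hvars⟩
  · exact .inl ⟨w, hvars _ rfl, rfl⟩
  · cases hα with
    | con _ _ _ h => exact .inr (.inl ⟨X, h.1, w, hvars _ rfl, rfl⟩)
  · cases hα with
    | nom _ x h _ => exact .inr (.inr (.inl ⟨a, h, _, hvars _ rfl, rfl⟩))
  · exact .inr (.inr (.inr ⟨r, (hasRole_reduct.1 (hasRole_unfold_tail (R := .name r) hα)).1, (w, z),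
      ⟨hvars _ (.inl rfl), hvars _ (.inr rfl)⟩, rfl⟩))

theorem commonSig_subset {O₁ O₂ : Ontology} {A B : ℕ} :
    commonSig O₁ O₂ A B ⊆ (O₁ ∪ O₂).sig ∪ {NLSym.con A} := by
  rintro s ⟨⟨c, hc, h⟩ | h, -⟩
  · exact .inl ⟨c, Finset.mem_union_left _ hc, h⟩
  · exact .inr h

/-- Point 2 implies Point 3. The homomorphism from the canonical model gives the inclusion of `A` in
the concept, and `entails_truncABox` that of the concept in `B`. -/
theorem truncABox_isWitness {O₁ O₂ : Ontology} {A B : ℕ} {L : Dialect} (h₁ : O₁.IsNormal)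
    (h₂ : O₂.IsNormal) (h : ABox.Entails (O₁ ∪ O₂)
      (canonicalABox (O₁ ∪ O₂) A (commonSig O₁ O₂ A B) L) B (canonicalRoot (O₁ ∪ O₂) A)) :
    IsWitness L O₁ O₂ A B (2 ^ 2 ^ sizePoly.eval (O₁ ∪ O₂).size)
      (truncABox (O₁ ∪ O₂) A (commonSig O₁ O₂ A B) L) := by
  have hO : (O₁ ∪ O₂).IsNormal := fun c hc => (Finset.mem_union.1 hc).elim (h₁ c) (h₂ c)
  have hS := commonSig_subset (O₁ := O₁) (O₂ := O₂) (A := A) (B := B)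
  set O := O₁ ∪ O₂
  set S := commonSig O₁ O₂ A B with hSdef
  obtain ⟨hfin, hcard⟩ := truncWords_finite_card hS
  have hWfin : (selWords O A S L).Finite := hfin.subset (select_subset L)
  refine ⟨truncABox_finite hS L, truncABox_subset L, ?_, ?_⟩
  · refine le_trans (Set.ncard_le_ncard ?_ hfin) hcard
    rintro w ⟨α, hα, hw⟩
    exact select_subset L (hα.2 w hw)
  · obtain ⟨C, hC⟩ := exists_corresponds L (S := S) (𝒞 := reduct O A S) (𝒲 := selWords O A S L)
      (x₀ := canonicalRoot O A) hWfin (truncABox_finite hS L) (fun w hw => (select_subset L hw).1)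
      (fun w R x => select_prefix L (fun w hw => hw.1) truncWords_prefix)
      (root_mem_select L (base_mem_truncWords (Nat.zero_le _))) (top_mem_reduct _)
      (fun X x hX => hX.1) (fun R x y hR => (hasRole_reduct.1 hR).1)
      (by rintro rfl w hw; exact reach_select hw)
    refine ⟨C, hC, hC.admits, hC.sig_subset, fun I hI d hd => ?_, fun I hI d hd => ?_⟩
    · refine (hC.ext_iff I d).2 (satAt_unfold hI (fun a ha => ?_) hd fun α hα => hα.1)
      rcases hS ha with h | h
      · exact h
      · cases h
    · obtain ⟨v, rfl, hv⟩ := (hC.ext_iff I d).1 hd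
      exact entails_truncABox hO hS h I hI v hv

theorem interpolant_tfae (L : Dialect) (O₁ O₂ : Ontology) (A B : ℕ) (h₁ : O₁.IsNormal)
    (h₂ : O₂.IsNormal) :
    List.TFAE [
      ∃ C : Concept, IsInterpolant L O₁ O₂ (.name A) (.name B) C,
      ABox.Entails (O₁ ∪ O₂) (canonicalABox (O₁ ∪ O₂) A (commonSig O₁ O₂ A B) L) B
        (canonicalRoot (O₁ ∪ O₂) A),
      ∃ 𝒜, IsWitness L O₁ O₂ A B (2 ^ 2 ^ sizePoly.eval (O₁ ∪ O₂).size) 𝒜] := by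
  have hO : (O₁ ∪ O₂).IsNormal := fun c hc => (Finset.mem_union.1 hc).elim (h₁ c) (h₂ c)
  tfae_have 1 → 2 := fun ⟨C, hC⟩ =>
    entails_of_interpolant hO hC.admits hC.sig_subset hC.left hC.right
  tfae_have 2 → 3 := fun h => ⟨_, truncABox_isWitness h₁ h₂ h⟩
  tfae_have 3 → 1 := fun ⟨_, h⟩ => by
    obtain ⟨C, -, hC⟩ := h.interpolant
    exact ⟨C, hC⟩
  tfae_finish

end Truncation
end DescrLogic

/-! ### Resource-bounded functions on programs -/

namespace DescrLogic

/-! ## Programs that transform the contents of one variable -/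

/-- Started with `x` in variable `0`, the program `P` stops after at most `t` steps with `y` in
variable `0`, and it leaves all variables from `k` on unchanged. -/
def Prog.Runs (P : Prog) (k : ℕ) (x y : Data) (t : ℕ) : Prop :=
  ∀ s : Store, s 0 = x → ∃ n ≤ t, ∃ s' : Store, P.Exec s n s' ∧ s' 0 = y ∧ ∀ j, k ≤ j → s' j = s j

theorem Data.one_le_size (x : Data) : 1 ≤ x.size := by cases x <;> simp [Data.size]

theorem Data.size_hd_le (x : Data) : x.hd.size ≤ x.size := by
  cases x <;> simp only [Data.hd, Data.size] <;> omega

theorem Data.size_tl_le (x : Data) : x.tl.size ≤ x.size := by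
  cases x <;> simp only [Data.tl, Data.size] <;> omega

theorem Expr.size_eval_le (s : Store) (e : Expr) : (e.eval s).size ≤ e.cost s := by
  induction e with
  | var i => exact le_rfl
  | nil => exact le_rfl
  | cons e f ihe ihf => simp only [eval, cost, Data.size]; omega
  | hd e ih => exact (Data.size_hd_le _).trans (ih.trans (Nat.le_succ _))
  | tl e ih => exact (Data.size_tl_le _).trans (ih.trans (Nat.le_succ _))

/-- An assignment costs at least the size of the value that it stores, so contents can outgrow the
input only by the running time. Time bounds therefore yield output bounds. -/
theorem Prog.Exec.size_le {P : Prog} {s s' : Store} {n : ℕ} (h : P.Exec s n s') {M : ℕ}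
    (hM : ∀ i, (s i).size ≤ M) (i : ℕ) : (s' i).size ≤ M + n := by
  induction h generalizing M i with
  | assign j e s =>
    by_cases hij : i = j
    · subst hij
      have := e.size_eval_le s
      simp only [Function.update_self]
      omega
    · rw [Function.update_of_ne hij]
      exact (hM i).trans (Nat.le_add_right _ _)
  | seq _ _ ih1 ih2 => exact (ih2 (ih1 hM) i).trans (by omega)
  | condTrue _ _ ih => exact (ih hM i).trans (by omega)
  | condFalse _ _ ih => exact (ih hM i).trans (by omega)
  | loopStop _ => exact (hM i).trans (by omega)
  | loopStep _ _ _ ih1 ih2 => exact (ih2 (ih1 hM) i).trans (by omega)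

namespace Prog

theorem Runs.size_le {P : Prog} {k t : ℕ} {x y : Data} (h : P.Runs k x y t) :
    y.size ≤ x.size + t := by
  obtain ⟨n, hn, s', he, rfl, -⟩ := h (Function.update (fun _ => Data.nil) 0 x) (by simp)
  refine (he.size_le (M := x.size) (fun i => ?_) 0).trans (by omega)
  by_cases hi : i = 0
  · simp [hi]
  · simpa [hi, Data.size] using x.one_le_size

theorem Runs.mono {P : Prog} {k k' t t' : ℕ} {x y : Data} (h : P.Runs k x y t) (hk : k ≤ k')
    (ht : t ≤ t') : P.Runs k' x y t' := fun s hs => by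
  obtain ⟨n, hn, s', h1, h2, h3⟩ := h s hs
  exact ⟨n, hn.trans ht, s', h1, h2, fun j hj => h3 j (hk.trans hj)⟩

theorem Runs.assign {e : Expr} {x y : Data} {t : ℕ}
    (h : ∀ s : Store, s 0 = x → e.eval s = y ∧ e.cost s + 1 ≤ t) : (Prog.assign 0 e).Runs 1 x y t :=
  fun s hs => ⟨_, (h s hs).2, _, .assign 0 e s, by simp [(h s hs).1], fun j hj => by
    rw [Function.update_of_ne (by omega)]⟩

theorem Runs.seq {P Q : Prog} {k t u : ℕ} {x y z : Data} (hP : P.Runs k x y t)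
    (hQ : Q.Runs k y z u) : (Prog.seq P Q).Runs k x z (t + u + 1) := fun s hs => by
  obtain ⟨n, hn, s', h1, h2, h3⟩ := hP s hs
  obtain ⟨m, hm, s'', h4, h5, h6⟩ := hQ s' h2
  exact ⟨_, by omega, s'', .seq h1 h4, h5, fun j hj => (h6 j hj).trans (h3 j hj)⟩

/-- Runs two programs on the same input and pairs the results. -/
def pair (P Q : Prog) (k : ℕ) : Prog :=
  .seq (.assign k (.var 0)) (.seq P (.seq (.assign (k + 1) (.var 0)) (.seq (.assign 0 (.var k))
    (.seq Q (.assign 0 (.cons (.var (k + 1)) (.var 0)))))))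

/-- Both programs leave the variables from `k` on alone, so the copy of the input in `k` and the
first result in `k + 1` survive. -/
theorem Runs.pair {P Q : Prog} {k t u : ℕ} {x y z : Data} (hk : 1 ≤ k) (hP : P.Runs k x y t)
    (hQ : Q.Runs k x z u) :
    (P.pair Q k).Runs (k + 2) x (.cons y z) (t + u + 2 * (x.size + y.size + z.size) + 20) :=
  fun s hs => by
  obtain ⟨n, hn, s₁, h1, h2, h3⟩ := hP (Function.update s k x)
    (by rw [Function.update_of_ne (by omega), hs])
  obtain ⟨m, hm, s₂, h4, h5, h6⟩ := hQ (Function.update (Function.update s₁ (k + 1) y) 0 x) (by simp)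
  have hk1 : s₁ k = x := by rw [h3 k le_rfl]; simp
  have hk2 : s₂ (k + 1) = y := by
    rw [h6 (k + 1) (by omega), Function.update_of_ne (by omega), Function.update_self]
  have e1 : Prog.Exec (.assign k (.var 0)) s (x.size + 1) (Function.update s k x) := by
    have := Prog.Exec.assign k (.var 0) s
    simpa only [Expr.cost, Expr.eval, hs] using this
  have e2 : Prog.Exec (.assign (k + 1) (.var 0)) s₁ (y.size + 1) (Function.update s₁ (k + 1) y) := by
    have := Prog.Exec.assign (k + 1) (.var 0) s₁
    simpa only [Expr.cost, Expr.eval, h2] using this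
  have e3 : Prog.Exec (.assign 0 (.var k)) (Function.update s₁ (k + 1) y) (x.size + 1)
      (Function.update (Function.update s₁ (k + 1) y) 0 x) := by
    have := Prog.Exec.assign 0 (.var k) (Function.update s₁ (k + 1) y)
    have hkk : Function.update s₁ (k + 1) y k = x := by
      rw [Function.update_of_ne (by omega), hk1]
    simpa only [Expr.cost, Expr.eval, hkk] using this
  have e4 : Prog.Exec (.assign 0 (.cons (.var (k + 1)) (.var 0))) s₂ (y.size + z.size + 1 + 1)
      (Function.update s₂ 0 (.cons y z)) := by
    have := Prog.Exec.assign 0 (.cons (.var (k + 1)) (.var 0)) s₂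
    simpa only [Expr.cost, Expr.eval, hk2, h5] using this
  refine ⟨_, ?_, _, .seq e1 (.seq h1 (.seq e2 (.seq e3 (.seq h4 e4)))), by simp, fun j hj => ?_⟩
  · omega
  · rw [Function.update_of_ne (by omega), h6 j (by omega), Function.update_of_ne (by omega),
      Function.update_of_ne (by omega), h3 j (by omega), Function.update_of_ne (by omega)]

/-- Branches on whether the first component of the input is `nil`. -/
def branch (P Q : Prog) : Prog :=
  .seq (.assign 1 (.hd (.var 0))) (.seq (.assign 0 (.tl (.var 0))) (.cond 1 P Q))

theorem Runs.branch {P Q : Prog} {k t : ℕ} {b x y : Data} (hk : 2 ≤ k)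
    (hP : b ≠ .nil → P.Runs k x y t) (hQ : b = .nil → Q.Runs k x y t) :
    (P.branch Q).Runs k (.cons b x) y (t + 2 * (b.size + x.size) + 20) := fun s hs => by
  let s₁ := Function.update (Function.update s 1 b) 0 x
  have e1 : Prog.Exec (.assign 1 (.hd (.var 0))) s (b.size + x.size + 1 + 1 + 1)
      (Function.update s 1 b) := by
    have := Prog.Exec.assign 1 (.hd (.var 0)) s
    simpa only [Expr.cost, Expr.eval, hs, Data.size, Data.hd] using this
  have h0 : Function.update s 1 b 0 = .cons b x := by rw [Function.update_of_ne (by omega), hs]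
  have e2 : Prog.Exec (.assign 0 (.tl (.var 0))) (Function.update s 1 b)
      (b.size + x.size + 1 + 1 + 1) s₁ := by
    have := Prog.Exec.assign 0 (.tl (.var 0)) (Function.update s 1 b)
    simpa only [Expr.cost, Expr.eval, h0, Data.size, Data.tl] using this
  have h1 : s₁ 1 = b := by simp [s₁]
  have hframe : ∀ j, k ≤ j → s₁ j = s j := fun j hj => by
    simp only [s₁]
    rw [Function.update_of_ne (by omega), Function.update_of_ne (by omega)]
  by_cases hb : b = .nil
  · obtain ⟨n, hn, s', h2, h3, h4⟩ := hQ hb s₁ (by simp [s₁])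
    exact ⟨_, by omega, s', .seq e1 (.seq e2 (.condFalse (h1.trans hb) h2)), h3,
      fun j hj => (h4 j hj).trans (hframe j hj)⟩
  · obtain ⟨n, hn, s', h2, h3, h4⟩ := hP hb s₁ (by simp [s₁])
    exact ⟨_, by omega, s', .seq e1 (.seq e2 (.condTrue (h1.trans_ne hb) h2)), h3,
      fun j hj => (h4 j hj).trans (hframe j hj)⟩

/-- Repeats `P` as long as the first component of variable `0` is not `nil`. -/
def iterate (P : Prog) : Prog :=
  .seq (.assign 1 (.hd (.var 0))) (.loop 1 (.seq P (.assign 1 (.hd (.var 0)))))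

/-- Each round costs the body and a fresh copy of the test, whose cost the bound `M` on the
intermediate data controls. -/
theorem Runs.iterate {P : Prog} {k t M m : ℕ} {x : ℕ → Data} (hk : 2 ≤ k)
    (hM : ∀ i ≤ m, (x i).size ≤ M) (hx : ∀ i < m, (x i).hd ≠ .nil)
    (hP : ∀ i < m, P.Runs k (x i) (x (i + 1)) t) (hm : (x m).hd = .nil) :
    P.iterate.Runs k (x 0) (x m) ((m + 1) * (t + M + 10)) := by
  have key : ∀ m (x : ℕ → Data), (∀ i ≤ m, (x i).size ≤ M) → (∀ i < m, (x i).hd ≠ .nil) →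
      (∀ i < m, P.Runs k (x i) (x (i + 1)) t) → (x m).hd = .nil → ∀ s : Store, s 0 = x 0 →
      s 1 = (x 0).hd → ∃ n ≤ m * (t + M + 10) + 1, ∃ s' : Store,
        (Prog.loop 1 (.seq P (.assign 1 (.hd (.var 0))))).Exec s n s' ∧ s' 0 = x m ∧
        ∀ j, k ≤ j → s' j = s j := by
    intro m
    induction m with
    | zero =>
      intro x _ _ _ hm s h0 h1
      exact ⟨1, by omega, s, .loopStop (h1.trans hm), h0, fun _ _ => rfl⟩
    | succ m ih =>
      intro x hM hx hP hm s h0 h1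
      obtain ⟨n, hn, s₁, h2, h3, h4⟩ := hP 0 (by omega) s h0
      have e1 : Prog.Exec (.assign 1 (.hd (.var 0))) s₁ ((x 1).size + 1 + 1)
          (Function.update s₁ 1 (x 1).hd) := by
        have := Prog.Exec.assign 1 (.hd (.var 0)) s₁
        simpa only [Expr.cost, Expr.eval, h3, zero_add] using this
      obtain ⟨n', hn', s₂, h5, h6, h7⟩ := ih (fun i => x (i + 1)) (fun i hi => hM _ (by omega))
        (fun i hi => hx _ (by omega)) (fun i hi => hP _ (by omega)) hm
        (Function.update s₁ 1 (x 1).hd) (by rw [Function.update_of_ne (by omega)]; exact h3) (by simp)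
      refine ⟨_, ?_, s₂, .loopStep (h1.trans_ne (hx 0 (by omega))) (.seq h2 e1) h5, h6,
        fun j hj => ?_⟩
      · have := hM 1 (by omega)
        have e : (m + 1) * (t + M + 10) = m * (t + M + 10) + (t + M + 10) := by ring
        omega
      · rw [h7 j hj, Function.update_of_ne (by omega), h4 j hj]
  intro s hs
  have e1 : Prog.Exec (.assign 1 (.hd (.var 0))) s ((x 0).size + 1 + 1)
      (Function.update s 1 (x 0).hd) := by
    have := Prog.Exec.assign 1 (.hd (.var 0)) s
    simpa only [Expr.cost, Expr.eval, hs] using this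
  obtain ⟨n, hn, s', h1, h2, h3⟩ := key m x hM hx hP hm (Function.update s 1 (x 0).hd)
    (by rw [Function.update_of_ne (by omega), hs]) (by simp)
  refine ⟨_, ?_, s', .seq e1 h1, h2, fun j hj => ?_⟩
  · have := hM 0 (by omega)
    have e : (m + 1) * (t + M + 10) = m * (t + M + 10) + (t + M + 10) := by ring
    omega
  · rw [h3 j hj, Function.update_of_ne (by omega)]

end Prog

/-! ## Encodings and resource-bounded functions -/

/-- An encoding of the elements of a type as binary trees. -/
class Enc (α : Type) where
  enc : α → Data
  inj : Function.Injective enc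

/-- The size of the encoding. -/
def esize {α : Type} [Enc α] (a : α) : ℕ := (Enc.enc a).size

theorem polynomial_eval_mono (q : Polynomial ℕ) : Monotone fun n : ℕ => q.eval n := by
  intro m n h
  induction q using Polynomial.induction_on' with
  | add p q hp hq => simpa only [Polynomial.eval_add] using Nat.add_le_add hp hq
  | monomial k a =>
    simpa only [Polynomial.eval_monomial] using Nat.mul_le_mul_left a (Nat.pow_le_pow_left h k)

/-- A rate of growth that absorbs polynomials. -/
class Growth (E : ℕ → ℕ) : Prop where
  mono : Monotone E
  le_self : ∀ n, n ≤ E n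
  poly : ∀ r : Polynomial ℕ, ∃ q : Polynomial ℕ, ∀ n, r.eval (E n) ≤ E (q.eval n)

instance : Growth id := ⟨monotone_id, fun _ => le_rfl, fun r => ⟨r, fun _ => le_rfl⟩⟩

/-- Doubly exponential growth. -/
def dexp (n : ℕ) : ℕ := 2 ^ 2 ^ n

theorem exists_polynomial_le_pow (r : Polynomial ℕ) : ∃ c, ∀ m : ℕ, r.eval m ≤ (m + 2) ^ c := by
  induction r using Polynomial.induction_on' with
  | add p q hp hq =>
    obtain ⟨c, hc⟩ := hp
    obtain ⟨d, hd⟩ := hq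
    refine ⟨c + d + 1, fun m => ?_⟩
    rw [Polynomial.eval_add]
    have h1 : (m + 2) ^ c ≤ (m + 2) ^ (c + d) := Nat.pow_le_pow_right (by omega) (by omega)
    have h2 : (m + 2) ^ d ≤ (m + 2) ^ (c + d) := Nat.pow_le_pow_right (by omega) (by omega)
    calc _ ≤ (m + 2) ^ (c + d) + (m + 2) ^ (c + d) := by
          exact Nat.add_le_add ((hc m).trans h1) ((hd m).trans h2)
      _ = (m + 2) ^ (c + d) * 2 := by ring
      _ ≤ (m + 2) ^ (c + d) * (m + 2) := by gcongr; omega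
      _ = (m + 2) ^ (c + d + 1) := by ring
  | monomial k a =>
    refine ⟨a + k, fun m => ?_⟩
    rw [Polynomial.eval_monomial, pow_add]
    refine Nat.mul_le_mul ?_ (Nat.pow_le_pow_left (by omega) k)
    exact Nat.lt_two_pow_self.le.trans (Nat.pow_le_pow_left (by omega) a)

/-- A polynomial is at most `(m + 2) ^ c`, and `(dexp n + 2) ^ c ≤ 2 ^ (2 ^ (n + 2) * c) ≤ dexp (n +
(c + 2))`. -/
instance : Growth dexp where
  mono := fun m n h => Nat.pow_le_pow_right (by norm_num) (Nat.pow_le_pow_right (by norm_num) h)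
  le_self := fun n => Nat.lt_two_pow_self.le.trans
    (Nat.pow_le_pow_right (by norm_num) Nat.lt_two_pow_self.le)
  poly := fun r => by
    obtain ⟨c, hc⟩ := exists_polynomial_le_pow r
    refine ⟨Polynomial.X + Polynomial.C (c + 2), fun n => (hc _).trans ?_⟩
    have h1 : dexp n + 2 ≤ 2 ^ (2 ^ (n + 2)) := by
      have h2 : 2 ^ (n + 2) = 2 ^ n + 3 * 2 ^ n := by ring
      have h3 : 1 ≤ 2 ^ n := Nat.one_le_two_pow
      have h4 : 2 ^ (2 ^ n + 3) ≤ 2 ^ (2 ^ (n + 2)) := Nat.pow_le_pow_right (by norm_num) (by omega)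
      have h5 : 2 ^ (2 ^ n + 3) = 8 * 2 ^ (2 ^ n) := by ring
      have h6 : 1 ≤ 2 ^ (2 ^ n) := Nat.one_le_two_pow
      unfold dexp
      omega
    refine (Nat.pow_le_pow_left h1 c).trans ?_
    rw [← pow_mul]
    refine Nat.pow_le_pow_right (by norm_num) ?_
    simp only [Polynomial.eval_add, Polynomial.eval_X, Polynomial.eval_C]
    calc 2 ^ (n + 2) * c ≤ 2 ^ (n + 2) * 2 ^ c := by gcongr; exact Nat.lt_two_pow_self.le
      _ = 2 ^ (n + (c + 2)) := by rw [← pow_add]; congr 1; omega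

/-- The function `g` has growth rate `E`, up to a polynomial in the size of the argument. -/
def Bdd (E : ℕ → ℕ) {α : Type} [Enc α] (g : α → ℕ) : Prop :=
  ∃ q : Polynomial ℕ, ∀ a, g a ≤ E (q.eval (esize a))

set_option linter.unusedSectionVars false

section Bdd

variable {E : ℕ → ℕ} [Growth E] {α : Type} [Enc α] {g h : α → ℕ}

theorem Bdd.mono (hg : Bdd E g) (hle : ∀ a, h a ≤ g a) : Bdd E h := by
  obtain ⟨q, hq⟩ := hg
  exact ⟨q, fun a => (hle a).trans (hq a)⟩

theorem Bdd.eval (hg : Bdd E g) (r : Polynomial ℕ) : Bdd E fun a => r.eval (g a) := by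
  obtain ⟨q, hq⟩ := hg
  obtain ⟨r', hr'⟩ := Growth.poly (E := E) r
  refine ⟨r'.comp q, fun a => ?_⟩
  rw [Polynomial.eval_comp]
  exact (polynomial_eval_mono r (hq a)).trans (hr' _)

theorem bdd_const (c : ℕ) : Bdd E fun _ : α => c :=
  ⟨Polynomial.C c, fun _ => by simpa using Growth.le_self c⟩

theorem bdd_size : Bdd E fun a : α => esize a :=
  ⟨Polynomial.X, fun _ => by simpa using Growth.le_self _⟩

theorem Bdd.max (hg : Bdd E g) (hh : Bdd E h) : Bdd E fun a => max (g a) (h a) := by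
  obtain ⟨q, hq⟩ := hg
  obtain ⟨r, hr⟩ := hh
  refine ⟨q + r, fun a => max_le ((hq a).trans ?_) ((hr a).trans ?_)⟩ <;>
  · refine Growth.mono (E := E) ?_
    rw [Polynomial.eval_add]
    omega

theorem Bdd.add (hg : Bdd E g) (hh : Bdd E h) : Bdd E fun a => g a + h a :=
  ((hg.max hh).eval (2 * Polynomial.X)).mono fun a => by
    simp only [Polynomial.eval_mul, Polynomial.eval_ofNat, Polynomial.eval_X]
    omega

theorem Bdd.mul (hg : Bdd E g) (hh : Bdd E h) : Bdd E fun a => g a * h a :=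
  ((hg.max hh).eval (Polynomial.X * Polynomial.X)).mono fun a => by
    simp only [Polynomial.eval_mul, Polynomial.eval_X]
    exact Nat.mul_le_mul (le_max_left _ _) (le_max_right _ _)

theorem Bdd.of_id (hg : Bdd id g) : Bdd E g := by
  obtain ⟨q, hq⟩ := hg
  exact ⟨q, fun a => (hq a).trans (Growth.le_self _)⟩

theorem Bdd.comp_id {β : Type} [Enc β] {g : β → ℕ} (hg : Bdd id g) {f : α → β}
    (hf : Bdd E fun a => esize (f a)) : Bdd E fun a => g (f a) := by
  obtain ⟨q, hq⟩ := hg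
  exact (hf.eval q).mono fun a => hq _

end Bdd

/-- The function is computed by a program in time of growth rate `E`. -/
def Cmp (E : ℕ → ℕ) {α β : Type} [Enc α] [Enc β] (f : α → β) : Prop :=
  ∃ (P : Prog) (k : ℕ) (T : α → ℕ), Bdd E T ∧ ∀ a, P.Runs k (Enc.enc a) (Enc.enc (f a)) (T a)

/-- The function is computable in polynomial time. -/
abbrev PT {α β : Type} [Enc α] [Enc β] (f : α → β) : Prop := Cmp id f

section Cmp

variable {E : ℕ → ℕ} [Growth E] {α β γ δ : Type} [Enc α] [Enc β] [Enc γ] [Enc δ]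

theorem Cmp.bdd {f : α → β} (hf : Cmp E f) : Bdd E fun a => esize (f a) := by
  obtain ⟨P, k, T, hT, h⟩ := hf
  exact (bdd_size.add hT).mono fun a => (h a).size_le

theorem PT.cmp {f : α → β} (hf : PT f) : Cmp E f := by
  obtain ⟨P, k, T, hT, h⟩ := hf
  exact ⟨P, k, T, hT.of_id, h⟩

/-- Only the outer function has to be polynomial: the rate `E` absorbs polynomials, but need not be
closed under composition with itself. -/
theorem PT.comp {g : β → γ} {f : α → β} (hg : PT g) (hf : Cmp E f) : Cmp E fun a => g (f a) := by
  have hb := hf.bdd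
  obtain ⟨P, k, T, hT, h⟩ := hf
  obtain ⟨Q, l, U, hU, h'⟩ := hg
  refine ⟨.seq P Q, max k l, fun a => T a + U (f a) + 1, (hT.add (hU.comp_id hb)).add (bdd_const 1),
    fun a => ?_⟩
  exact ((h a).mono (le_max_left _ _) le_rfl).seq ((h' (f a)).mono (le_max_right _ _) le_rfl)

instance : Enc Data := ⟨id, fun _ _ h => h⟩

instance : Enc (α × β) := ⟨fun p => .cons (Enc.enc p.1) (Enc.enc p.2), fun _ _ h => by
  injection h with h1 h2
  exact Prod.ext (Enc.inj h1) (Enc.inj h2)⟩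

theorem esize_prod (a : α) (b : β) : esize (a, b) = esize a + esize b + 1 := rfl

theorem Cmp.pair {f : α → β} {g : α → γ} (hf : Cmp E f) (hg : Cmp E g) :
    Cmp E fun a => (f a, g a) := by
  have hbf := hf.bdd
  have hbg := hg.bdd
  obtain ⟨P, k, T, hT, h⟩ := hf
  obtain ⟨Q, l, U, hU, h'⟩ := hg
  refine ⟨P.pair Q (k + l + 1), k + l + 1 + 2, _,
    ((hT.add hU).add ((bdd_const 2).mul ((bdd_size.add hbf).add hbg))).add (bdd_const 20), fun a => ?_⟩
  exact Prog.Runs.pair (by omega) ((h a).mono (by omega) le_rfl) ((h' a).mono (by omega) le_rfl)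

/-- The expression only uses variable `0`. -/
def Expr.OnlyZero : Expr → Prop
  | .var i => i = 0
  | .nil => True
  | .cons e f => e.OnlyZero ∧ f.OnlyZero
  | .hd e => e.OnlyZero
  | .tl e => e.OnlyZero

theorem Expr.OnlyZero.cost_le {e : Expr} (h : e.OnlyZero) :
    ∃ K, ∀ s : Store, e.cost s ≤ K * (s 0).size := by
  induction e with
  | var i => cases h; exact ⟨1, fun s => by simp [Expr.cost]⟩
  | nil => exact ⟨1, fun s => by simpa [Expr.cost] using (s 0).one_le_size⟩
  | cons e f ihe ihf =>
    obtain ⟨K, hK⟩ := ihe h.1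
    obtain ⟨K', hK'⟩ := ihf h.2
    refine ⟨K + K' + 1, fun s => ?_⟩
    have h1 := hK s
    have h2 := hK' s
    have h3 := (s 0).one_le_size
    simp only [Expr.cost, add_mul]
    omega
  | hd e ih | tl e ih =>
    obtain ⟨K, hK⟩ := ih h
    refine ⟨K + 1, fun s => ?_⟩
    have h1 := hK s
    have h3 := (s 0).one_le_size
    simp only [Expr.cost, add_mul]
    omega

theorem PT.expr {f : α → β} (e : Expr) (he : e.OnlyZero)
    (h : ∀ a (s : Store), s 0 = Enc.enc a → e.eval s = Enc.enc (f a)) : PT f := by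
  obtain ⟨K, hK⟩ := he.cost_le
  refine ⟨.assign 0 e, 1, fun a => K * esize a + 1, ((bdd_const K).mul bdd_size).add (bdd_const 1),
    fun a => Prog.Runs.assign fun s hs => ⟨h a s hs, ?_⟩⟩
  have := hK s
  rw [hs] at this
  exact Nat.succ_le_succ this

theorem PT.id' : PT fun a : α => a := PT.expr (.var 0) rfl fun _ _ h => h

/-- An expression for a binary tree. -/
def Data.toExpr : Data → Expr
  | .nil => .nil
  | .cons x y => .cons x.toExpr y.toExpr

theorem Data.toExpr_onlyZero (x : Data) : x.toExpr.OnlyZero := by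
  induction x with
  | nil => trivial
  | cons x y hx hy => exact ⟨hx, hy⟩

theorem Data.eval_toExpr (x : Data) (s : Store) : x.toExpr.eval s = x := by
  induction x with
  | nil => rfl
  | cons x y hx hy => simp only [toExpr, Expr.eval, hx, hy]

theorem Cmp.const (b : β) : Cmp E fun _ : α => b :=
  (PT.expr _ (Enc.enc b).toExpr_onlyZero fun _ s _ => Data.eval_toExpr _ s : PT _).cmp

theorem Cmp.fst {f : α → β × γ} (hf : Cmp E f) : Cmp E fun a => (f a).1 :=
  (PT.expr (.hd (.var 0)) rfl fun p s h => by simp only [Expr.eval, h]; rfl :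
    PT fun p : β × γ => p.1).comp hf

theorem Cmp.snd {f : α → β × γ} (hf : Cmp E f) : Cmp E fun a => (f a).2 :=
  (PT.expr (.tl (.var 0)) rfl fun p s h => by simp only [Expr.eval, h]; rfl :
    PT fun p : β × γ => p.2).comp hf

theorem Cmp.hd {f : α → Data} (hf : Cmp E f) : Cmp E fun a => (f a).hd :=
  (PT.expr (.hd (.var 0)) rfl fun p s h => by simp only [Expr.eval, h]; rfl :
    PT fun p : Data => p.hd).comp hf

theorem Cmp.tl {f : α → Data} (hf : Cmp E f) : Cmp E fun a => (f a).tl :=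
  (PT.expr (.tl (.var 0)) rfl fun p s h => by simp only [Expr.eval, h]; rfl :
    PT fun p : Data => p.tl).comp hf

theorem Cmp.enc {f : α → β} (hf : Cmp E f) : Cmp E fun a => (Enc.enc (f a) : Data) := hf

theorem Cmp.of_enc {f : α → β} {F : α → Data} (hF : Cmp E F) (h : ∀ a, F a = Enc.enc (f a)) :
    Cmp E f := by
  obtain ⟨P, k, T, hT, hP⟩ := hF
  exact ⟨P, k, T, hT, fun a => by rw [← h a]; exact hP a⟩

theorem Cmp.data_cons {f g : α → Data} (hf : Cmp E f) (hg : Cmp E g) :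
    Cmp E fun a => Data.cons (f a) (g a) :=
  Cmp.of_enc (f := fun a => Data.cons (f a) (g a)) (F := fun a => Enc.enc (f a, g a))
    (hf.pair hg).enc fun _ => rfl

/-- Case distinction on `nil`. -/
def Data.caseNil {β : Type} (t : Data) (x y : β) : β :=
  match t with
  | .nil => x
  | .cons _ _ => y

theorem Cmp.caseNil {t : α → Data} {f g : α → β} (ht : PT t) (hf : PT f) (hg : PT g) :
    PT fun a => (t a).caseNil (f a) (g a) := by
  have hp := ht.pair PT.id'
  have hb := hp.bdd
  obtain ⟨P, k, T, hT, h⟩ := hp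
  obtain ⟨Q, l, U, hU, h'⟩ := hf
  obtain ⟨Q', l', U', hU', h''⟩ := hg
  have hbr : ∀ a, (Q'.branch Q).Runs (l + l' + 2) (.cons (t a) (Enc.enc a))
      (Enc.enc ((t a).caseNil (f a) (g a))) (U a + U' a + 2 * ((t a).size + esize a) + 20) := by
    intro a
    refine Prog.Runs.branch (by omega) (fun hne => ?_) fun he => ?_
    · have : (t a).caseNil (f a) (g a) = g a := by
        cases h : t a with
        | nil => exact absurd h hne
        | cons _ _ => rfl
      rw [this]
      exact (h'' a).mono (by omega) (by omega)
    · rw [he]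
      exact (h' a).mono (by omega) (by omega)
  have hbt := ht.bdd
  refine ⟨.seq P (Q'.branch Q), k + (l + l' + 2), _, (hT.add (((hU.add hU').add
    ((bdd_const 2).mul (hbt.add bdd_size))).add (bdd_const 20))).add (bdd_const 1), fun a => ?_⟩
  exact ((h a).mono (by omega) le_rfl).seq ((hbr a).mono (by omega) le_rfl)

instance : Enc Bool := ⟨encBool, fun a b h => by cases a <;> cases b <;> first | rfl | cases h⟩

theorem PT.cond {c : α → Bool} {f g : α → β} (hc : PT c) (hf : PT f) (hg : PT g) :
    PT fun a => bif c a then f a else g a := by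
  have := Cmp.caseNil hc.enc hg hf
  convert this using 2 with a
  cases c a <;> rfl

theorem PT.and {f g : α → Bool} (hf : PT f) (hg : PT g) : PT fun a => f a && g a := by
  have := hf.cond hg (Cmp.const false)
  convert this using 2 with a
  cases f a <;> rfl

theorem PT.or {f g : α → Bool} (hf : PT f) (hg : PT g) : PT fun a => f a || g a := by
  have := hf.cond (Cmp.const true) hg
  convert this using 2 with a
  cases f a <;> rfl

theorem PT.not {f : α → Bool} (hf : PT f) : PT fun a => !f a := by
  have := hf.cond (Cmp.const false) (Cmp.const true)
  convert this using 2 with a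
  cases f a <;> rfl

/-- Loops: the function is iterated until the first component of the data is `nil`. -/
theorem PT.iterate {F : Data → Data} (hF : PT F) {N M : α → ℕ} {f : α → Data} (hf : PT f)
    (hN : Bdd id N) (hM : Bdd id M) (hsize : ∀ a, ∀ i ≤ N a, (F^[i] (f a)).size ≤ M a)
    (hne : ∀ a, ∀ i < N a, (F^[i] (f a)).hd ≠ .nil) (hnil : ∀ a, (F^[N a] (f a)).hd = .nil) :
    PT fun a => F^[N a] (f a) := by
  obtain ⟨P, k, T, hT, h⟩ := hF
  obtain ⟨Q, l, U, hU, h'⟩ := hf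
  obtain ⟨q, hq⟩ := hT
  refine ⟨.seq Q P.iterate, k + l + 2, _, (hU.add ((hN.add (bdd_const 1)).mul
    (((hM.eval q).add hM).add (bdd_const 10)))).add (bdd_const 1), fun a => ?_⟩
  refine ((h' a).mono (by omega) le_rfl).seq ?_
  refine Prog.Runs.iterate (x := fun i => F^[i] (f a)) (by omega) (hsize a) (hne a)
    (fun i hi => ?_) (hnil a)
  have := h (F^[i] (f a))
  rw [← Function.iterate_succ_apply' F i (f a)] at this
  exact this.mono (by omega) ((hq _).trans (polynomial_eval_mono q (hsize a i hi.le)))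

/-! ### Lists -/

theorem encList_injective {f : α → Data} (hf : Function.Injective f) :
    Function.Injective (encList f) := by
  intro l
  induction l with
  | nil =>
    rintro (_ | ⟨a, l'⟩) h
    · rfl
    · cases h
  | cons a l ih =>
    rintro (_ | ⟨a', l'⟩) h
    · cases h
    · injection h with h1 h2
      rw [hf h1, ih h2]

instance : Enc (List α) := ⟨encList Enc.enc, encList_injective Enc.inj⟩

theorem Cmp.cons {f : α → β} {g : α → List β} (hf : Cmp E f) (hg : Cmp E g) :
    Cmp E fun a => f a :: g a := Cmp.of_enc (hf.data_cons hg.enc) fun _ => rfl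

theorem esize_nil : esize ([] : List α) = 1 := rfl

theorem esize_cons (a : α) (l : List α) : esize (a :: l) = esize a + esize l + 1 := rfl

theorem one_le_esize (a : α) : 1 ≤ esize a := Data.one_le_size _

theorem esize_append (l l' : List α) : esize (l ++ l') + 1 = esize l + esize l' := by
  induction l with
  | nil => rw [List.nil_append, esize_nil, add_comm]
  | cons a l ih => rw [List.cons_append, esize_cons, esize_cons]; omega

theorem length_le_esize (l : List α) : l.length ≤ esize l := by
  induction l with
  | nil => exact Nat.zero_le _
  | cons a l ih => rw [List.length_cons, esize_cons]; omega

theorem esize_le_of_mem {a : α} {l : List α} (h : a ∈ l) : esize a ≤ esize l := by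
  induction l with
  | nil => cases h
  | cons b l ih =>
    rw [esize_cons]
    rcases List.mem_cons.1 h with rfl | h
    · omega
    · have := ih h; omega

theorem esize_reverse (l : List α) : esize l.reverse = esize l := by
  induction l with
  | nil => rfl
  | cons a l ih =>
    have := esize_append l.reverse [a]
    rw [List.reverse_cons, esize_cons]
    rw [esize_cons, esize_nil] at this
    omega

theorem esize_le_of_sublist {l l' : List α} (h : l.Sublist l') : esize l ≤ esize l' := by
  induction h with
  | slnil => exact le_rfl
  | cons a _ ih => rw [esize_cons]; omega
  | cons_cons a _ ih => rw [esize_cons, esize_cons]; omega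

/-- Folding a list, with a step function that is computable in polynomial time and accumulators
of bounded size. -/
theorem Cmp.foldl {f : α → List β} {init : α → γ} {p : α → δ} {g : δ → γ → β → γ} (hf : Cmp E f)
    (hinit : Cmp E init) (hp : Cmp E p) (hg : PT fun x : δ × γ × β => g x.1 x.2.1 x.2.2)
    (hM : ∃ M : α → ℕ, Bdd E M ∧
      ∀ a i, esize (((f a).take i).foldl (g (p a)) (init a)) ≤ M a) :
    Cmp E fun a => (f a).foldl (g (p a)) (init a) := by
  obtain ⟨M, hM, hacc⟩ := hM
  have hbf := hf.bdd
  have hbp := hp.bdd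
  have hbi := hinit.bdd
  obtain ⟨Q, l, U, hU, h'⟩ := hf.pair (hinit.pair hp)
  obtain ⟨P, k, T, ⟨q, hq⟩, h⟩ := hg
  -- The state consists of the remaining list, the accumulator and the parameter. The expression `e`
  -- rearranges it into the argument of `g`, and `Z` bounds its size.
  let e : Expr := .cons (.tl (.tl (.var 0))) (.cons (.hd (.tl (.var 0))) (.hd (.hd (.var 0))))
  let step : Prog := .pair (.assign 0 (.tl (.hd (.var 0))))
    (.pair (.seq (.assign 0 e) P) (.assign 0 (.tl (.tl (.var 0)))) (k + 1)) (k + 3)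
  let Z : α → ℕ := fun a => esize (f a) + (M a + esize (p a) + 1) + 1
  have hZ : Bdd E Z := (hbf.add ((hM.add hbp).add (bdd_const 1))).add (bdd_const 1)
  have hrun : ∀ a, (step.iterate).Runs (k + 5) (Enc.enc (f a, init a, p a))
      (Enc.enc (([] : List β), (f a).foldl (g (p a)) (init a), p a))
      (((f a).length + 1) * ((q.eval (Z a) + 100 * Z a + 100) + Z a + 10)) := by
    intro a
    let x : ℕ → Data := fun i =>
      Enc.enc ((f a).drop i, ((f a).take i).foldl (g (p a)) (init a), p a)
    have hx0 : x 0 = Enc.enc (f a, init a, p a) := rfl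
    have hxm : x (f a).length =
        Enc.enc (([] : List β), (f a).foldl (g (p a)) (init a), p a) := by simp [x]
    rw [← hx0, ← hxm]
    refine Prog.Runs.iterate (by omega) (fun i hi => ?_) (fun i hi => ?_) (fun i hi => ?_) ?_
    · change esize _ ≤ _
      rw [esize_prod, esize_prod]
      have := esize_le_of_sublist (List.drop_sublist i (f a))
      have := hacc a i
      simp only [Z]
      omega
    · simp only [x]
      rw [List.drop_eq_getElem_cons hi]
      exact fun h => by cases h
    · have e1 : (f a).drop i = (f a)[i] :: (f a).drop (i + 1) := List.drop_eq_getElem_cons hi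
      have e2 : ((f a).take (i + 1)).foldl (g (p a)) (init a) =
          g (p a) (((f a).take i).foldl (g (p a)) (init a)) (f a)[i] := by
        rw [← List.take_concat_get' _ _ hi, List.foldl_append]
        rfl
      have hl1 := esize_le_of_sublist (List.drop_sublist i (f a))
      have hm1 := hacc a i
      have hm2 := hacc a (i + 1)
      rw [e2] at hm2
      simp only [x]
      rw [e2, e1]
      rw [e1, esize_cons] at hl1
      set b := (f a)[i]
      set rest := (f a).drop (i + 1)
      set c := ((f a).take i).foldl (g (p a)) (init a)
      have s1 : (Enc.enc (b :: rest, c, p a)).size = esize b + esize rest + 1 + (esize c + esize (p a) + 1) + 1 := rfl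
      have r1 : (Prog.assign 0 (.tl (.hd (.var 0)))).Runs 1 (Enc.enc (b :: rest, c, p a))
          (Enc.enc rest) (Z a + 3) := Prog.Runs.assign fun s hs => by
        refine ⟨by simp only [Expr.eval, hs]; rfl, ?_⟩
        simp only [Expr.cost, hs, s1, Z]
        omega
      have r2 : (Prog.assign 0 (.tl (.tl (.var 0)))).Runs 1 (Enc.enc (b :: rest, c, p a))
          (Enc.enc (p a)) (Z a + 3) := Prog.Runs.assign fun s hs => by
        refine ⟨by simp only [Expr.eval, hs]; rfl, ?_⟩
        simp only [Expr.cost, hs, s1, Z]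
        omega
      have r3 : (Prog.assign 0 e).Runs 1 (Enc.enc (b :: rest, c, p a))
          (Enc.enc (p a, c, b)) (3 * Z a + 9) := Prog.Runs.assign fun s hs => by
        refine ⟨by simp only [e, Expr.eval, hs]; rfl, ?_⟩
        simp only [e, Expr.cost, hs, s1, Z]
        omega
      have r4 : P.Runs k (Enc.enc (p a, c, b)) (Enc.enc (g (p a) c b)) (q.eval (Z a)) := by
        refine (h (p a, c, b)).mono le_rfl ((hq _).trans (polynomial_eval_mono q ?_))
        rw [esize_prod, esize_prod]
        simp only [Z]
        omega
      have r5 := (r3.mono (Nat.le_add_left 1 k) le_rfl).seq (r4.mono (Nat.le_add_right k 1) le_rfl)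
      have r6 := Prog.Runs.pair (Nat.le_add_left 1 k) r5 (r2.mono (Nat.le_add_left 1 k) le_rfl)
      have r7 := Prog.Runs.pair (k := k + 3) (by omega) (r1.mono (by omega) le_rfl) r6
      refine r7.mono le_rfl ?_
      have s2 : (Data.cons (Enc.enc (g (p a) c b)) (Enc.enc (p a))).size =
        esize (g (p a) c b) + esize (p a) + 1 := rfl
      have s3 : (Enc.enc rest).size = esize rest := rfl
      have s4 : (Enc.enc (p a)).size = esize (p a) := rfl
      have s5 : (Enc.enc (g (p a) c b)).size = esize (g (p a) c b) := rfl
      rw [s2, s3, s4, s5, s1]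
      have : esize b + esize rest + esize c + esize (p a) + 3 ≤ Z a := by simp only [Z]; omega
      have : esize (g (p a) c b) + esize (p a) + esize rest ≤ Z a := by simp only [Z]; omega
      omega
    · simp only [x]
      rw [List.drop_length]
      rfl
  have hall : Cmp E fun a => (([] : List β), (f a).foldl (g (p a)) (init a), p a) := by
    refine ⟨.seq Q step.iterate, l + (k + 5), _, (hU.add (((hbf.add (bdd_const 1)).mul
      ((((hZ.eval q).add ((bdd_const 100).mul hZ)).add (bdd_const 100)).add hZ |>.add
        (bdd_const 10))))).add (bdd_const 1), fun a => ?_⟩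
    refine ((h' a).mono (by omega) le_rfl).seq ((hrun a).mono (by omega) ?_)
    exact Nat.mul_le_mul_right _ (Nat.succ_le_succ (length_le_esize _))
  exact hall.snd.fst

theorem foldl_cons_eq (l acc : List α) :
    l.foldl (fun acc b => b :: acc) acc = l.reverse ++ acc := by
  induction l generalizing acc with
  | nil => rfl
  | cons a l ih => rw [List.foldl_cons, ih, List.reverse_cons, List.append_assoc]; rfl

theorem Cmp.reverse {f : α → List β} (hf : Cmp E f) : Cmp E fun a => (f a).reverse := by
  have h : PT fun l : List β => l.reverse := by
    have := Cmp.foldl (E := id) (f := fun l : List β => l) (init := fun _ => ([] : List β))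
      (p := fun l => l) (g := fun _ acc b => b :: acc) PT.id' (Cmp.const []) PT.id'
      (PT.id'.snd.snd.cons PT.id'.snd.fst) ⟨_, bdd_size, fun l i => by
        rw [foldl_cons_eq, List.append_nil, esize_reverse]
        exact esize_le_of_sublist (List.take_sublist _ _)⟩
    convert this using 2 with l
    rw [foldl_cons_eq, List.append_nil]
  exact h.comp hf

/-- Folding a list from the right. -/
theorem Cmp.foldr {f : α → List β} {init : α → γ} {p : α → δ} {g : δ → β → γ → γ} (hf : Cmp E f)
    (hinit : Cmp E init) (hp : Cmp E p) (hg : PT fun x : δ × β × γ => g x.1 x.2.1 x.2.2)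
    (hM : ∃ M : α → ℕ, Bdd E M ∧
      ∀ a i, esize (((f a).drop i).foldr (g (p a)) (init a)) ≤ M a) :
    Cmp E fun a => (f a).foldr (g (p a)) (init a) := by
  obtain ⟨M, hM, h⟩ := hM
  have hg' : PT fun x : δ × γ × β => g x.1 x.2.2 x.2.1 :=
    hg.comp (PT.id'.fst.pair (PT.id'.snd.snd.pair PT.id'.snd.fst))
  have := Cmp.foldl (g := fun d c b => g d b c) hf.reverse hinit hp hg' ⟨M, hM, fun a i => by
    rw [List.take_reverse, List.foldl_reverse]
    exact h a _⟩
  convert this using 2 with a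
  rw [List.foldl_reverse]

end Cmp
end DescrLogic

namespace DescrLogic

/-! ### Polynomial time -/

/-- The function is computable in polynomial time. -/
@[fun_prop]
def PolyTime {α β : Type} [Enc α] [Enc β] (f : α → β) : Prop := PT f

set_option linter.unusedSectionVars false

section Lists

variable {α β γ δ : Type} [Enc α] [Enc β] [Enc γ] [Enc δ]

namespace PolyTime

@[fun_prop]
theorem id_fun : PolyTime fun a : α => a := PT.id'

@[fun_prop]
theorem const (b : β) : PolyTime fun _ : α => b := Cmp.const b

@[fun_prop]
theorem comp {g : β → γ} {f : α → β} (hg : PolyTime g) (hf : PolyTime f) :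
    PolyTime fun a => g (f a) := PT.comp hg hf

@[fun_prop]
theorem fst : PolyTime fun p : α × β => p.1 := Cmp.fst PT.id'

@[fun_prop]
theorem snd : PolyTime fun p : α × β => p.2 := Cmp.snd PT.id'

@[fun_prop]
theorem pair {f : α → β} {g : α → γ} (hf : PolyTime f) (hg : PolyTime g) :
    PolyTime fun a => (f a, g a) := Cmp.pair hf hg

@[fun_prop]
theorem hd : PolyTime Data.hd := Cmp.hd PT.id'

@[fun_prop]
theorem tl : PolyTime Data.tl := Cmp.tl PT.id'

@[fun_prop]
theorem data_cons {f g : α → Data} (hf : PolyTime f) (hg : PolyTime g) :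
    PolyTime fun a => Data.cons (f a) (g a) := Cmp.data_cons hf hg

@[fun_prop]
theorem enc : PolyTime fun a : α => Enc.enc a := Cmp.enc PT.id'

@[fun_prop]
theorem cond {c : α → Bool} {f g : α → β} (hc : PolyTime c) (hf : PolyTime f)
    (hg : PolyTime g) : PolyTime fun a => bif c a then f a else g a := PT.cond hc hf hg

@[fun_prop]
theorem and {f g : α → Bool} (hf : PolyTime f) (hg : PolyTime g) :
    PolyTime fun a => f a && g a := PT.and hf hg

@[fun_prop]
theorem or {f g : α → Bool} (hf : PolyTime f) (hg : PolyTime g) :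
    PolyTime fun a => f a || g a := PT.or hf hg

@[fun_prop]
theorem not {f : α → Bool} (hf : PolyTime f) : PolyTime fun a => !f a := PT.not hf

@[fun_prop]
theorem cons {f : α → β} {g : α → List β} (hf : PolyTime f) (hg : PolyTime g) :
    PolyTime fun a => f a :: g a := Cmp.cons hf hg

end PolyTime

theorem append_eq_foldr (l l' : List α) : l ++ l' = l.foldr (fun a s => a :: s) l' := by
  induction l with
  | nil => rfl
  | cons a l ih => rw [List.foldr_cons, ← ih]; rfl

@[fun_prop]
theorem PolyTime.append {f g : α → List β} (hf : PolyTime f) (hg : PolyTime g) :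
    PolyTime fun a => f a ++ g a := by
  have := Cmp.foldr (E := id) (p := fun _ => Data.nil) (g := fun _ (b : β) s => b :: s)
    hf hg (Cmp.const _) (show PolyTime _ by fun_prop)
    ⟨_, (Cmp.bdd hf).add (Cmp.bdd hg), fun a i => by
      rw [← append_eq_foldr]
      have h1 := esize_append ((f a).drop i) (g a)
      have h2 := esize_le_of_sublist (List.drop_sublist i (f a))
      omega⟩
  unfold PolyTime
  convert this using 2 with a
  exact append_eq_foldr _ _

theorem flatMap_eq_foldr (l : List α) (g : α → List β) :
    l.flatMap g = l.foldr (fun a s => g a ++ s) [] := by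
  induction l with
  | nil => rfl
  | cons a l ih => rw [List.foldr_cons, ← ih]; rfl

theorem esize_flatMap_le (l : List α) (g : α → List β) (M : ℕ) (h : ∀ a ∈ l, esize (g a) ≤ M) :
    esize (l.flatMap g) ≤ l.length * M + 1 := by
  induction l with
  | nil => simp [esize_nil]
  | cons a l ih =>
    have h1 := esize_append (g a) (l.flatMap g)
    have h2 := ih fun b hb => h b (List.mem_cons_of_mem _ hb)
    have h3 := h a List.mem_cons_self
    rw [List.flatMap_cons, List.length_cons, add_mul]
    omega

@[fun_prop]
theorem PolyTime.flatMap {f : α → List β} {g : α → β → List γ} (hf : PolyTime f)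
    (hg : PolyTime fun p : α × β => g p.1 p.2) : PolyTime fun a => (f a).flatMap (g a) := by
  obtain ⟨q, hq⟩ := Cmp.bdd hg
  have hbf := Cmp.bdd hf
  have hg' : PolyTime fun x : α × β × List γ => g x.1 x.2.1 ++ x.2.2 :=
    append (comp hg (by fun_prop : PolyTime fun x : α × β × List γ => (x.1, x.2.1))) (by fun_prop)
  have := Cmp.foldr (E := id) (p := fun a : α => a) (g := fun a b s => g a b ++ s) hf (Cmp.const [])
    PT.id' hg'
    ⟨_, (hbf.mul (((bdd_size.add hbf).add (bdd_const 1)).eval q)).add (bdd_const 1), fun a i => by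
      rw [← flatMap_eq_foldr]
      refine (esize_flatMap_le _ _ (q.eval (esize a + esize (f a) + 1)) fun b hb => ?_).trans ?_
      · refine (hq (a, b)).trans (polynomial_eval_mono q ?_)
        have h1 := esize_le_of_mem (List.mem_of_mem_drop hb)
        rw [esize_prod]
        omega
      · have h1 := length_le_esize ((f a).drop i)
        have h2 := esize_le_of_sublist (List.drop_sublist i (f a))
        exact Nat.succ_le_succ (Nat.mul_le_mul_right _ (h1.trans h2))⟩
  unfold PolyTime
  convert this using 2 with a
  exact flatMap_eq_foldr _ _

@[fun_prop]
theorem PolyTime.map {f : α → List β} {g : α → β → γ} (hf : PolyTime f)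
    (hg : PolyTime fun p : α × β => g p.1 p.2) : PolyTime fun a => (f a).map (g a) := by
  have h : PolyTime fun a => (f a).flatMap fun b => [g a b] := by fun_prop
  convert h using 2 with a
  exact List.map_eq_flatMap

@[fun_prop]
theorem PolyTime.filter {f : α → List β} {g : α → β → Bool} (hf : PolyTime f)
    (hg : PolyTime fun p : α × β => g p.1 p.2) : PolyTime fun a => (f a).filter (g a) := by
  have h : PolyTime fun a => (f a).flatMap fun b => bif g a b then [b] else [] := by fun_prop
  convert h using 2 with a
  induction f a with
  | nil => rfl
  | cons b l ih =>
    rw [List.filter_cons, List.flatMap_cons, ← ih]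
    cases g a b <;> rfl

@[fun_prop]
theorem PolyTime.any {f : α → List β} {g : α → β → Bool} (hf : PolyTime f)
    (hg : PolyTime fun p : α × β => g p.1 p.2) : PolyTime fun a => (f a).any (g a) := by
  have hg' : PolyTime fun x : α × β × Bool => g x.1 x.2.1 || x.2.2 :=
    or (comp hg (by fun_prop : PolyTime fun x : α × β × Bool => (x.1, x.2.1))) (by fun_prop)
  have := Cmp.foldr (E := id) (p := fun a : α => a) (g := fun a b s => g a b || s) hf
    (Cmp.const false) PT.id' hg'
    ⟨_, bdd_const 3, fun a i => by
      cases ((f a).drop i).foldr (fun b s => g a b || s) false <;>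
        simp [esize, Enc.enc, encBool, Data.size]⟩
  unfold PolyTime
  convert this using 2 with a
  induction f a with
  | nil => rfl
  | cons b l ih => rw [List.any_cons, List.foldr_cons, ih]

@[fun_prop]
theorem PolyTime.all {f : α → List β} {g : α → β → Bool} (hf : PolyTime f)
    (hg : PolyTime fun p : α × β => g p.1 p.2) : PolyTime fun a => (f a).all (g a) := by
  have h : PolyTime fun a => !((f a).any fun b => !g a b) := by fun_prop
  simpa only [List.not_any_eq_all_not, Bool.not_not] using h

end Lists
end DescrLogic

namespace DescrLogic

/-! ### Decision of equality on encodings, and encodings of the syntax -/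

/-! ### Equality tests -/

section Equality

variable {α β : Type} [Enc α] [Enc β]

theorem PolyTime.of_enc {f : α → β} {F : α → Data} (hF : PolyTime F)
    (h : ∀ a, F a = Enc.enc (f a)) : PolyTime f := Cmp.of_enc hF h

@[fun_prop]
theorem PolyTime.caseNil {t : α → Data} {f g : α → β} (ht : PolyTime t) (hf : PolyTime f)
    (hg : PolyTime g) : PolyTime fun a => (t a).caseNil (f a) (g a) := Cmp.caseNil ht hf hg

/-- One step of a comparison of trees: a stack of pairs that remain to be compared, and the
verdict so far. -/
def compareStep : List (Data × Data) × Bool → List (Data × Data) × Bool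
  | ([], b) => ([], b)
  | ((.nil, .nil) :: l, b) => (l, b)
  | ((.nil, .cons _ _) :: _, _) => ([], false)
  | ((.cons _ _, .nil) :: _, _) => ([], false)
  | ((.cons x y, .cons x' y') :: l, b) => ((x, x') :: (y, y') :: l, b)

/-- The effect of `compareStep` on encodings. -/
def compareData (d : Data) : Data :=
  d.hd.hd.hd.caseNil
    (d.hd.hd.tl.caseNil (.cons d.hd.tl d.tl) (.cons .nil .nil))
    (d.hd.hd.tl.caseNil (.cons .nil .nil)
      (.cons (.cons (.cons d.hd.hd.hd.hd d.hd.hd.tl.hd)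
        (.cons (.cons d.hd.hd.hd.tl d.hd.hd.tl.tl) d.hd.tl)) d.tl))

theorem compareData_enc (s : List (Data × Data) × Bool) :
    compareData (Enc.enc s) = Enc.enc (compareStep s) := by
  rcases s with ⟨_ | ⟨⟨_ | ⟨x, y⟩, _ | ⟨x', y'⟩⟩, l⟩, b⟩ <;> rfl

theorem polyTime_compareData : PolyTime compareData := by
  unfold compareData
  fun_prop

theorem esize_compareStep_le (s : List (Data × Data) × Bool) :
    esize (compareStep s) ≤ esize s := by
  have h1 : esize false = 1 := rfl
  have h2 : ∀ x y, esize (Data.cons x y) = esize x + esize y + 1 := fun _ _ => rfl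
  rcases s with ⟨_ | ⟨⟨_ | ⟨x, y⟩, _ | ⟨x', y'⟩⟩, l⟩, b⟩ <;>
    simp only [compareStep, esize_prod, esize_cons, esize_nil, h1, h2, le_refl] <;>
    have := one_le_esize b <;> omega

/-- The total size of the first trees of the stack. -/
def stackSize (l : List (Data × Data)) : ℕ := (l.map fun p => p.1.size).sum

/-- Every step removes or splits a first tree, or empties the stack, so at least one node
disappears; the number of steps is bounded by the size of the first tree. -/
theorem stackSize_compareStep (s : List (Data × Data) × Bool) (h : s.1 ≠ []) :
    stackSize (compareStep s).1 < stackSize s.1 := by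
  rcases s with ⟨_ | ⟨⟨_ | ⟨x, y⟩, _ | ⟨x', y'⟩⟩, l⟩, b⟩
  · exact absurd rfl h
  all_goals
    simp only [compareStep, stackSize, List.map_cons, List.map_nil, List.sum_cons, List.sum_nil,
      Data.size]
    omega

theorem exists_compareStep_nil (n : ℕ) (s : List (Data × Data) × Bool) (h : stackSize s.1 ≤ n) :
    ∃ m ≤ n, (compareStep^[m] s).1 = [] := by
  induction n generalizing s with
  | zero =>
    refine ⟨0, le_rfl, ?_⟩
    by_contra hne
    have := stackSize_compareStep s hne
    omega
  | succ n ih =>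
    by_cases hs : s.1 = []
    · exact ⟨0, by omega, hs⟩
    · have := stackSize_compareStep s hs
      obtain ⟨m, hm, h⟩ := ih (compareStep s) (by omega)
      exact ⟨m + 1, by omega, h⟩

/-- The comparison will succeed. -/
def CompareOk (s : List (Data × Data) × Bool) : Prop := s.2 = true ∧ ∀ p ∈ s.1, p.1 = p.2

/-- An invariant: once the stack is empty, it says just that the verdict is positive, whereas at the
start it says that the two trees are equal. -/
theorem compareOk_step (s : List (Data × Data) × Bool) : CompareOk (compareStep s) ↔ CompareOk s := by
  rcases s with ⟨_ | ⟨⟨_ | ⟨x, y⟩, _ | ⟨x', y'⟩⟩, l⟩, b⟩ <;>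
    simp [compareStep, CompareOk, and_assoc]

theorem compareOk_iterate (n : ℕ) (s : List (Data × Data) × Bool) :
    CompareOk (compareStep^[n] s) ↔ CompareOk s := by
  induction n generalizing s with
  | zero => rfl
  | succ n ih => exact (ih _).trans (compareOk_step s)

open Classical in
/-- Equality as a Boolean. -/
noncomputable def eqb {α : Type} (a b : α) : Bool := decide (a = b)

@[simp]
theorem eqb_eq_true {α : Type} (a b : α) : eqb a b = true ↔ a = b := by simp [eqb]

theorem PolyTime.eqb_data : PolyTime fun p : Data × Data => eqb p.1 p.2 := by
  classical
  let init : Data × Data → List (Data × Data) × Bool := fun p => ([p], true)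
  have hex : ∀ p : Data × Data, ∃ m ≤ esize p, (compareStep^[m] (init p)).1 = [] := fun p =>
    exists_compareStep_nil _ _ (by
      simp only [init, stackSize, List.map_cons, List.map_nil, List.sum_cons, List.sum_nil]
      exact (Nat.le_add_right p.1.size (esize p.2)).trans (Nat.le_succ _))
  have hex' : ∀ p : Data × Data, ∃ m, (compareStep^[m] (init p)).1 = [] := fun p =>
    (hex p).imp fun _ h => h.2
  have hsemi : ∀ (n : ℕ) s, compareData^[n] (Enc.enc s) = Enc.enc (compareStep^[n] s) := fun n =>
    (Function.Semiconj.iterate_right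
      (f := (Enc.enc : List (Data × Data) × Bool → Data)) (fun s => (compareData_enc s).symm) n · |>.symm)
  have hle : ∀ n s, esize (compareStep^[n] s) ≤ esize s := fun n => by
    induction n with
    | zero => exact fun _ => le_rfl
    | succ n ih => exact fun s => (ih _).trans (esize_compareStep_le s)
  have hinit : PolyTime init := by fun_prop
  -- The number of rounds is the first time at which the stack is empty. The loop detects it, as the
  -- empty stack is encoded by `nil` in the first component.
  have key : PT fun p => compareData^[Nat.find (hex' p)] (Enc.enc (init p)) := by
    refine PT.iterate polyTime_compareData (Cmp.enc hinit) (M := fun p => esize (init p))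
      ?_ (Cmp.bdd hinit) ?_ ?_ ?_
    · refine bdd_size.mono fun p => ?_
      obtain ⟨m, hm, h⟩ := hex p
      exact (Nat.find_min' (hex' p) h).trans hm
    · intro p i _
      rw [hsemi]
      exact hle i _
    · intro p i hi h
      refine Nat.find_min (hex' p) hi ?_
      rw [hsemi] at h
      cases h' : (compareStep^[i] (init p)).1 with
      | nil => rfl
      | cons q l =>
        change Enc.enc (compareStep^[i] (init p)).1 = Data.nil at h
        rw [h'] at h
        cases h
    · intro p
      rw [hsemi]
      change Enc.enc (compareStep^[_] (init p)).1 = Data.nil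
      rw [Nat.find_spec (hex' p)]
      rfl
  refine PolyTime.of_enc (F := fun p => (compareData^[Nat.find (hex' p)] (Enc.enc (init p))).tl)
    (PolyTime.tl.comp key) fun p => ?_
  rw [hsemi]
  change Enc.enc (compareStep^[_] (init p)).2 = _
  congr 1
  have h1 := compareOk_iterate (Nat.find (hex' p)) (init p)
  have h2 := Nat.find_spec (hex' p)
  rw [Bool.eq_iff_iff, eqb_eq_true]
  simpa [CompareOk, h2, init] using h1

@[fun_prop]
theorem PolyTime.eqb {f g : α → β} (hf : PolyTime f) (hg : PolyTime g) :
    PolyTime fun a => eqb (f a) (g a) := by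
  have := PolyTime.eqb_data.comp (f := fun a => (Enc.enc (f a), Enc.enc (g a)))
    ((enc.comp hf).pair (enc.comp hg))
  convert this using 2 with a
  rw [Bool.eq_iff_iff, eqb_eq_true, eqb_eq_true, Enc.inj.eq_iff]

/-- Membership as a Boolean. -/
noncomputable def elemb {α : Type} (a : α) (l : List α) : Bool := l.any fun b => DescrLogic.eqb a b

@[simp]
theorem elemb_eq_true {α : Type} (a : α) (l : List α) : elemb a l = true ↔ a ∈ l := by
  simp [elemb]

@[fun_prop]
theorem PolyTime.elemb {f : α → β} {g : α → List β} (hf : PolyTime f) (hg : PolyTime g) :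
    PolyTime fun a => elemb (f a) (g a) := by
  unfold DescrLogic.elemb
  fun_prop

/-- Inclusion as a Boolean. -/
noncomputable def subb {α : Type} (l l' : List α) : Bool := l.all fun a => DescrLogic.elemb a l'

@[simp]
theorem subb_eq_true {α : Type} (l l' : List α) : subb l l' = true ↔ l ⊆ l' := by
  simp [subb, List.subset_def]

@[fun_prop]
theorem PolyTime.subb {f g : α → List β} (hf : PolyTime f) (hg : PolyTime g) :
    PolyTime fun a => subb (f a) (g a) := by
  unfold DescrLogic.subb
  fun_prop

/-- Implication of Booleans. -/
def impb (a b : Bool) : Bool := !a || b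

@[simp]
theorem impb_eq_true (a b : Bool) : impb a b = true ↔ (a = true → b = true) := by
  cases a <;> cases b <;> simp [impb]

@[fun_prop]
theorem PolyTime.impb {f g : α → Bool} (hf : PolyTime f) (hg : PolyTime g) :
    PolyTime fun a => impb (f a) (g a) := by
  unfold DescrLogic.impb
  fun_prop

/-- Equivalence of Booleans. -/
def iffb (a b : Bool) : Bool := impb a b && impb b a

@[simp]
theorem iffb_eq_true (a b : Bool) : iffb a b = true ↔ (a = true ↔ b = true) := by
  cases a <;> cases b <;> simp [iffb]

@[fun_prop]
theorem PolyTime.iffb {f g : α → Bool} (hf : PolyTime f) (hg : PolyTime g) :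
    PolyTime fun a => iffb (f a) (g a) := by
  unfold DescrLogic.iffb
  fun_prop

/-- Removal of duplicates. -/
noncomputable def nub {α : Type} (l : List α) : List α :=
  l.foldr (fun a s => bif elemb a s then s else a :: s) []

theorem nub_sublist {α : Type} (l : List α) : (nub l).Sublist l := by
  induction l with
  | nil => exact List.Sublist.slnil
  | cons a l ih =>
    change (bif elemb a (nub l) then nub l else a :: nub l).Sublist _
    cases elemb a (nub l)
    · exact ih.cons_cons a
    · exact ih.cons a

@[simp]
theorem mem_nub {α : Type} {a : α} {l : List α} : a ∈ nub l ↔ a ∈ l := by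
  induction l with
  | nil => rfl
  | cons b l ih =>
    change a ∈ (bif elemb b (nub l) then nub l else b :: nub l) ↔ _
    by_cases h : b ∈ nub l
    · rw [(elemb_eq_true b _).2 h, cond_true, ih, List.mem_cons]
      refine ⟨Or.inr, ?_⟩
      rintro (rfl | h')
      · exact ih.1 h
      · exact h'
    · rw [Bool.eq_false_iff.2 (mt (elemb_eq_true b _).1 h), cond_false, List.mem_cons, List.mem_cons, ih]

theorem nodup_nub {α : Type} (l : List α) : (nub l).Nodup := by
  induction l with
  | nil => exact List.nodup_nil
  | cons b l ih =>
    change (bif elemb b (nub l) then nub l else b :: nub l).Nodup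
    by_cases h : b ∈ nub l
    · rwa [(elemb_eq_true b _).2 h]
    · rw [Bool.eq_false_iff.2 (mt (elemb_eq_true b _).1 h)]
      exact List.nodup_cons.2 ⟨h, ih⟩

@[fun_prop]
theorem PolyTime.nub {f : α → List β} (hf : PolyTime f) : PolyTime fun a => nub (f a) := by
  have := Cmp.foldr (E := id) (p := fun _ => Data.nil)
    (g := fun _ (a : β) s => bif DescrLogic.elemb a s then s else a :: s)
    hf (Cmp.const []) (Cmp.const _) (show PolyTime _ by fun_prop)
    ⟨_, Cmp.bdd hf, fun a i => esize_le_of_sublist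
      ((nub_sublist _).trans (List.drop_sublist i (f a)))⟩
  exact this

end Equality
end DescrLogic

namespace DescrLogic

/-! ### Encodings -/

theorem encUnary_injective : Function.Injective encUnary := by
  intro m
  induction m with
  | zero => rintro (_ | n) h <;> first | rfl | cases h
  | succ m ih =>
    rintro (_ | n) h
    · cases h
    · injection h with _ h
      rw [ih h]

theorem encTag_inj {k k' : ℕ} {t t' : Data} : encTag k t = encTag k' t' ↔ k = k' ∧ t = t' := by
  refine ⟨fun h => ?_, by rintro ⟨rfl, rfl⟩; rfl⟩
  injection h with h1 h2
  exact ⟨encUnary_injective h1, h2⟩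

theorem Data.cons_inj {x x' y y' : Data} : Data.cons x y = Data.cons x' y' ↔ x = x' ∧ y = y' := by
  rw [Data.cons.injEq]

theorem bits_injective : Function.Injective Nat.bits := by
  intro m
  induction m using Nat.strong_induction_on with
  | _ m ih =>
    intro n h
    by_cases hm : m = 0
    · subst hm
      have h1 := Nat.size_eq_bits_len n
      rw [← h, Nat.zero_bits, List.length_nil] at h1
      exact (Nat.size_eq_zero.1 h1.symm).symm
    · have h1 : m.bodd = n.bodd := by rw [Nat.bodd_eq_bits_head, Nat.bodd_eq_bits_head, h]
      have h2 : m.div2 = n.div2 := ih _ (by rw [Nat.div2_val]; omega)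
        (by rw [Nat.div2_bits_eq_tail, Nat.div2_bits_eq_tail, h])
      rw [← Nat.bodd_add_div2 m, ← Nat.bodd_add_div2 n, h1, h2]

instance : Enc ℕ := ⟨encNat, fun m n h => by
  have h' := encList_injective (Enc.inj (α := Bool)) h
  exact bits_injective h'⟩

instance : Enc Role := ⟨encRole, fun R R' h => by
  cases R <;> cases R' <;> simp only [encRole, encTag_inj] at h
  · rw [Enc.inj (α := ℕ) h.2]
  · omega
  · omega
  · rw [Enc.inj (α := ℕ) h.2]⟩

theorem encConcept_injective : Function.Injective encConcept := by
  intro C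
  induction C with
  | top => intro C' h; cases C' <;> simp [encConcept, encTag_inj] at h ⊢
  | name A =>
    intro C' h
    cases C' <;> simp [encConcept, encTag_inj] at h ⊢
    exact Enc.inj (α := ℕ) h
  | nom a =>
    intro C' h
    cases C' <;> simp [encConcept, encTag_inj] at h ⊢
    exact Enc.inj (α := ℕ) h
  | and C D ihC ihD =>
    intro C' h
    cases C' <;> simp [encConcept, encTag_inj] at h ⊢
    exact ⟨ihC h.1, ihD h.2⟩
  | ex R C ih =>
    intro C' h
    cases C' <;> simp [encConcept, encTag_inj] at h ⊢
    exact ⟨Enc.inj (α := Role) h.1, ih h.2⟩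
  | exU C ih =>
    intro C' h
    cases C' <;> simp [encConcept, encTag_inj] at h ⊢
    exact ih h

instance : Enc Concept := ⟨encConcept, encConcept_injective⟩

instance : Enc Inclusion := ⟨encInclusion, fun c d h => by
  cases c
  cases d
  injection h with h1 h2
  cases encConcept_injective h1
  cases encConcept_injective h2
  rfl⟩

section Words

variable {α X : Type} [Enc α] [Enc X]

theorem encWord_injective : Function.Injective (encWord (Enc.enc : X → Data)) := by
  intro w
  induction w with
  | base x =>
    intro w' h
    cases w' <;> simp only [encWord, encTag_inj] at h
    · rw [Enc.inj h.2]
    · omega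
  | snoc w R x ih =>
    intro w' h
    cases w' <;> simp only [encWord, encTag_inj, Data.cons_inj] at h
    · omega
    · rw [ih h.2.1, Enc.inj (α := Role) h.2.2.1, Enc.inj h.2.2.2]

instance : Enc (Word X) := ⟨encWord Enc.enc, encWord_injective⟩

instance : Enc (Assertion X) := ⟨encAssertion Enc.enc, fun x y h => by
  cases x <;> cases y <;> simp only [encAssertion, encTag_inj, Data.cons_inj] at h <;> try omega
  · rw [Enc.inj h.2]
  · rw [Enc.inj (α := ℕ) h.2.1, Enc.inj h.2.2]
  · rw [Enc.inj (α := ℕ) h.2.1, Enc.inj h.2.2]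
  · rw [Enc.inj (α := ℕ) h.2.1, Enc.inj h.2.2.1, Enc.inj h.2.2.2]⟩

namespace PolyTime

@[fun_prop]
theorem tag {f : α → Data} (k : ℕ) (hf : PolyTime f) : PolyTime fun a => encTag k (f a) :=
  (const (encUnary k)).data_cons hf

/-! Constructors -/

@[fun_prop]
theorem role_name {f : α → ℕ} (hf : PolyTime f) : PolyTime fun a => Role.name (f a) :=
  of_enc ((enc.comp hf).tag 0) fun _ => rfl

@[fun_prop]
theorem role_inv {f : α → ℕ} (hf : PolyTime f) : PolyTime fun a => Role.inv (f a) :=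
  of_enc ((enc.comp hf).tag 1) fun _ => rfl

@[fun_prop]
theorem concept_name {f : α → ℕ} (hf : PolyTime f) : PolyTime fun a => Concept.name (f a) :=
  of_enc ((enc.comp hf).tag 1) fun _ => rfl

@[fun_prop]
theorem concept_nom {f : α → ℕ} (hf : PolyTime f) : PolyTime fun a => Concept.nom (f a) :=
  of_enc ((enc.comp hf).tag 2) fun _ => rfl

@[fun_prop]
theorem concept_and {f g : α → Concept} (hf : PolyTime f) (hg : PolyTime g) :
    PolyTime fun a => Concept.and (f a) (g a) :=
  of_enc (((enc.comp hf).data_cons (enc.comp hg)).tag 3) fun _ => rfl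

@[fun_prop]
theorem concept_ex {f : α → Role} {g : α → Concept} (hf : PolyTime f) (hg : PolyTime g) :
    PolyTime fun a => Concept.ex (f a) (g a) :=
  of_enc (((enc.comp hf).data_cons (enc.comp hg)).tag 4) fun _ => rfl

@[fun_prop]
theorem concept_exU {f : α → Concept} (hf : PolyTime f) : PolyTime fun a => Concept.exU (f a) :=
  of_enc ((enc.comp hf).tag 5) fun _ => rfl

@[fun_prop]
theorem word_base {f : α → X} (hf : PolyTime f) : PolyTime fun a => Word.base (f a) :=
  of_enc ((enc.comp hf).tag 0) fun _ => rfl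

@[fun_prop]
theorem word_snoc {f : α → Word X} {g : α → Role} {h : α → X} (hf : PolyTime f)
    (hg : PolyTime g) (hh : PolyTime h) : PolyTime fun a => Word.snoc (f a) (g a) (h a) :=
  of_enc (((enc.comp hf).data_cons ((enc.comp hg).data_cons (enc.comp hh))).tag 1) fun _ => rfl

@[fun_prop]
theorem assertion_top {f : α → X} (hf : PolyTime f) : PolyTime fun a => Assertion.top (f a) :=
  of_enc ((enc.comp hf).tag 0) fun _ => rfl

@[fun_prop]
theorem assertion_con {f : α → ℕ} {g : α → X} (hf : PolyTime f) (hg : PolyTime g) :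
    PolyTime fun a => Assertion.con (f a) (g a) :=
  of_enc (((enc.comp hf).data_cons (enc.comp hg)).tag 1) fun _ => rfl

@[fun_prop]
theorem assertion_nom {f : α → ℕ} {g : α → X} (hf : PolyTime f) (hg : PolyTime g) :
    PolyTime fun a => Assertion.nom (f a) (g a) :=
  of_enc (((enc.comp hf).data_cons (enc.comp hg)).tag 2) fun _ => rfl

@[fun_prop]
theorem assertion_rol {f : α → ℕ} {g h : α → X} (hf : PolyTime f) (hg : PolyTime g)
    (hh : PolyTime h) : PolyTime fun a => Assertion.rol (f a) (g a) (h a) :=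
  of_enc (((enc.comp hf).data_cons ((enc.comp hg).data_cons (enc.comp hh))).tag 3) fun _ => rfl

/-! Destructors -/

@[fun_prop]
theorem inclusion_lhs : PolyTime Inclusion.lhs := of_enc (hd.comp enc) fun _ => rfl

@[fun_prop]
theorem inclusion_rhs : PolyTime Inclusion.rhs := of_enc (tl.comp enc) fun _ => rfl

@[fun_prop]
theorem role_base : PolyTime Role.base := of_enc (tl.comp enc) fun R => by cases R <;> rfl

@[fun_prop]
theorem role_flip : PolyTime Role.flip :=
  of_enc (F := fun R => Data.cons ((Enc.enc R).hd.caseNil (encUnary 1) .nil) (Enc.enc R).tl)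
    (by fun_prop) fun R => by cases R <;> rfl

@[fun_prop]
theorem word_tail : PolyTime (Word.tail : Word X → X) :=
  of_enc (F := fun w => (Enc.enc w).hd.caseNil (Enc.enc w).tl (Enc.enc w).tl.tl.tl)
    (by fun_prop) fun w => by cases w <;> rfl

end PolyTime

end Words

namespace Concept

/-- The immediate subconcepts. -/
def children : Concept → List Concept
  | and C D => [C, D]
  | ex _ C => [C]
  | exU C => [C]
  | _ => []

/-- The role in front of the concept, if there is one. -/
def headRole : Concept → List Role
  | ex R _ => [R]
  | _ => []

/-- The index of a concept name. -/
def conIndex : Concept → List ℕ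
  | name A => [A]
  | _ => []

/-- The index of a nominal. -/
def nomIndex : Concept → List ℕ
  | nom a => [a]
  | _ => []

end Concept

namespace PolyTime

-- The unary tag of the encoding is read by nested case distinctions, one for each constructor.
@[fun_prop]
theorem concept_children : PolyTime Concept.children :=
  of_enc (F := fun C => (Enc.enc C).hd.caseNil .nil ((Enc.enc C).hd.tl.caseNil .nil
    ((Enc.enc C).hd.tl.tl.caseNil .nil ((Enc.enc C).hd.tl.tl.tl.caseNil
      (.cons (Enc.enc C).tl.hd (.cons (Enc.enc C).tl.tl .nil))
      ((Enc.enc C).hd.tl.tl.tl.tl.caseNil (.cons (Enc.enc C).tl.tl .nil)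
        (.cons (Enc.enc C).tl .nil))))))
    (by fun_prop) fun C => by cases C <;> rfl

@[fun_prop]
theorem concept_headRole : PolyTime Concept.headRole :=
  of_enc (F := fun C => (Enc.enc C).hd.tl.tl.tl.caseNil .nil
    ((Enc.enc C).hd.tl.tl.tl.tl.caseNil (.cons (Enc.enc C).tl.hd .nil) .nil))
    (by fun_prop) fun C => by cases C <;> rfl

@[fun_prop]
theorem concept_conIndex : PolyTime Concept.conIndex :=
  of_enc (F := fun C => (Enc.enc C).hd.caseNil .nil
    ((Enc.enc C).hd.tl.caseNil (.cons (Enc.enc C).tl .nil) .nil))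
    (by fun_prop) fun C => by cases C <;> rfl

@[fun_prop]
theorem concept_nomIndex : PolyTime Concept.nomIndex :=
  of_enc (F := fun C => (Enc.enc C).hd.tl.caseNil .nil
    ((Enc.enc C).hd.tl.tl.caseNil (.cons (Enc.enc C).tl .nil) .nil))
    (by fun_prop) fun C => by cases C <;> rfl

end PolyTime
end DescrLogic

namespace DescrLogic

/-! ### Doubly exponential time -/

set_option linter.unusedSectionVars false

section Dexp

variable {α β γ δ X : Type} [Enc α] [Enc β] [Enc γ] [Enc δ] [Enc X]

theorem esize_foldr_le {g : β → γ → γ} {R : ℕ} (l : List β) (c : γ) (hR : 1 ≤ R)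
    (h : ∀ b ∈ l, ∀ c, esize (g b c) ≤ R * esize c) {n : ℕ} (hn : l.length ≤ n) :
    esize (l.foldr g c) ≤ R ^ n * esize c := by
  refine le_trans ?_ (Nat.mul_le_mul_right _ (Nat.pow_le_pow_right hR hn))
  clear hn
  induction l with
  | nil => simp
  | cons b l ih =>
    have h1 := h b List.mem_cons_self (l.foldr g c)
    have h2 := ih fun b hb => h b (List.mem_cons_of_mem _ hb)
    rw [List.foldr_cons, List.length_cons, pow_succ']
    calc _ ≤ R * (R ^ l.length * esize c) := h1.trans (Nat.mul_le_mul_left _ h2)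
      _ = _ := by ring

/-- Folding a list of at most exponential length, where every step multiplies the size of the
accumulator. -/
theorem Cmp.foldr_dexp {f : α → List β} {init : α → γ} {p : α → δ} {g : δ → β → γ → γ}
    (hf : Cmp dexp f) (hlen : ∃ q : Polynomial ℕ, ∀ a, (f a).length ≤ 2 ^ q.eval (esize a))
    (hinit : Cmp dexp init) (hp : Cmp dexp p)
    (hg : PolyTime fun x : δ × β × γ => g x.1 x.2.1 x.2.2)
    (hr : ∃ r : Polynomial ℕ, ∀ d b c, esize (g d b c) ≤ r.eval (esize d + esize b) * esize c) :
    Cmp dexp fun a => (f a).foldr (g (p a)) (init a) := by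
  obtain ⟨q, hq⟩ := hlen
  obtain ⟨r, hr⟩ := hr
  obtain ⟨q', hq'⟩ := ((hp.bdd.add hf.bdd).eval r).add (bdd_const 1)
  -- A doubly exponential factor, repeated exponentially often, stays doubly exponential: the inner
  -- exponents add up.
  have hpow : Bdd dexp fun a : α => dexp (q'.eval (esize a)) ^ 2 ^ q.eval (esize a) := by
    refine ⟨q' + q, fun a => ?_⟩
    simp only [dexp, Polynomial.eval_add, ← pow_mul, ← pow_add, le_refl]
  refine Cmp.foldr hf hinit hp hg ⟨_, hpow.mul hinit.bdd, fun a i => ?_⟩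
  refine esize_foldr_le _ _ Nat.one_le_two_pow (fun b hb c => (hr _ _ _).trans ?_) ?_
  · refine Nat.mul_le_mul_right _ (le_trans ?_ (hq' a))
    refine (polynomial_eval_mono r (Nat.add_le_add_left ?_ _)).trans (Nat.le_succ _)
    exact esize_le_of_mem (List.mem_of_mem_drop hb)
  · rw [List.length_drop]
    exact (Nat.sub_le _ _).trans (hq a)

theorem esize_map_cons_le (a : α) (s : List (List α)) :
    esize (s.map (List.cons a)) ≤ (esize a + 2) * esize s := by
  induction s with
  | nil => simp only [List.map_nil, esize_nil]; omega
  | cons l s ih =>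
    rw [List.map_cons, esize_cons, esize_cons, esize_cons]
    have := Nat.zero_le ((esize a + 1) * esize l)
    nlinarith

/-- Every element of the list roughly doubles the result, apart from a factor for its own size. -/
theorem Cmp.sublists' {f : α → List β} (hf : Cmp dexp f)
    (hlen : ∃ q : Polynomial ℕ, ∀ a, (f a).length ≤ 2 ^ q.eval (esize a)) :
    Cmp dexp fun a => (f a).sublists' := by
  have := Cmp.foldr_dexp (p := fun _ => Data.nil) (init := fun _ => [[]])
    (g := fun _ (b : β) (s : List (List β)) => s ++ s.map fun l => b :: l) hf hlen
    (Cmp.const _) (Cmp.const _) (by fun_prop) ⟨Polynomial.X + 3, fun d b s => by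
      have h1 := esize_append s (s.map fun l => b :: l)
      have h2 := esize_map_cons_le b s
      simp only [Polynomial.eval_add, Polynomial.eval_X, Polynomial.eval_ofNat]
      nlinarith [one_le_esize d, one_le_esize s]⟩
  convert this using 2 with a
  induction f a with
  | nil => rfl
  | cons b l ih => rw [List.sublists'_cons, List.foldr_cons, ← ih]

/-- The words of length at most `n + 1` that extend words of length at most `n`. -/
noncomputable def extendWords (base : List X) (table : List ((X × Role) × X)) (ws : List (Word X)) :
    List (Word X) :=
  base.map Word.base ++ ws.flatMap fun w =>
    (table.filter fun e => eqb e.1.1 w.tail).map fun e => .snoc w e.1.2 e.2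

/-- The words over a table of steps whose length is at most that of `clock`. -/
noncomputable def wordsUpTo (base : List X) (table : List ((X × Role) × X)) (clock : List β) :
    List (Word X) :=
  clock.foldr (fun _ ws => extendWords base table ws) (base.map Word.base)

@[fun_prop]
theorem PolyTime.extendWords {f : α → List X} {g : α → List ((X × Role) × X)}
    {h : α → List (Word X)} (hf : PolyTime f) (hg : PolyTime g) (hh : PolyTime h) :
    PolyTime fun a => extendWords (f a) (g a) (h a) := by
  unfold DescrLogic.extendWords
  fun_prop

theorem esize_flatMap_le_mul (l : List α) (g : α → List β) {K : ℕ} (hK : 1 ≤ K)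
    (h : ∀ a ∈ l, esize (g a) ≤ K * (esize a + 1)) : esize (l.flatMap g) ≤ K * esize l := by
  induction l with
  | nil => simpa [esize_nil] using hK
  | cons a l ih =>
    have h1 := esize_append (g a) (l.flatMap g)
    have h2 := ih fun b hb => h b (List.mem_cons_of_mem _ hb)
    have h3 := h a List.mem_cons_self
    rw [List.flatMap_cons, esize_cons]
    nlinarith

theorem esize_map_le (l : List α) (g : α → β) (M : ℕ) (h : ∀ a ∈ l, esize (g a) ≤ M) :
    esize (l.map g) ≤ l.length * (M + 1) + 1 := by
  induction l with
  | nil => simp [esize_nil]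
  | cons a l ih =>
    have h2 := ih fun b hb => h b (List.mem_cons_of_mem _ hb)
    have h3 := h a List.mem_cons_self
    rw [List.map_cons, List.length_cons, esize_cons, add_mul]
    omega

theorem esize_base (x : X) : esize (Word.base x) = esize x + 2 := by
  change 1 + esize x + 1 = _
  omega

theorem esize_snoc (w : Word X) (R : Role) (x : X) :
    esize (Word.snoc w R x) = esize w + esize R + esize x + 6 := by
  change 1 + 1 + 1 + (esize w + (esize R + esize x + 1) + 1) + 1 = _
  omega

/-- The bound is linear in `ws`, with a factor that depends only on the letters and the table, as
`Cmp.foldr_dexp` demands. -/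
theorem esize_extendWords_le (base : List X) (table : List ((X × Role) × X))
    (ws : List (Word X)) : esize (extendWords base table ws) ≤
      (esize table * (esize table + 8) + 4 * esize base + 2) * esize ws := by
  have h1 : esize (base.map (Word.base : X → Word X)) ≤ 4 * esize base := by
    induction base with
    | nil => simp [esize_nil]
    | cons x l ih => rw [List.map_cons, esize_cons, esize_cons, esize_base]; omega
  have h2 : esize (ws.flatMap fun w => (table.filter fun e => eqb e.1.1 w.tail).map
      fun e => Word.snoc w e.1.2 e.2) ≤ (esize table * (esize table + 8) + 1) * esize ws := by
    refine esize_flatMap_le_mul _ _ (by omega) fun w _ => ?_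
    refine (esize_map_le _ _ (esize w + esize table + 7) fun e he => ?_).trans ?_
    · have := esize_le_of_mem (List.mem_of_mem_filter he)
      rw [show e = ((e.1.1, e.1.2), e.2) from rfl, esize_prod, esize_prod] at this
      rw [esize_snoc]
      omega
    · have h3 := (List.length_filter_le (fun e => eqb e.1.1 w.tail) table).trans
        (length_le_esize table)
      have h4 := Nat.mul_le_mul_right (esize w + esize table + 7 + 1) h3
      have h5 := Nat.zero_le (esize table * (esize table + 7) * esize w)
      nlinarith
  have h3 := esize_append (base.map (Word.base : X → Word X)) (ws.flatMap fun w =>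
    (table.filter fun e => eqb e.1.1 w.tail).map fun e => Word.snoc w e.1.2 e.2)
  have h4 := Nat.mul_le_mul_left (4 * esize base) (one_le_esize ws)
  unfold extendWords
  nlinarith

theorem Cmp.wordsUpTo {f : α → List X} {g : α → List ((X × Role) × X)} {c : α → List β}
    (hf : Cmp dexp f) (hg : Cmp dexp g) (hc : Cmp dexp c)
    (hlen : ∃ q : Polynomial ℕ, ∀ a, (c a).length ≤ 2 ^ q.eval (esize a)) :
    Cmp dexp fun a => wordsUpTo (f a) (g a) (c a) := by
  refine Cmp.foldr_dexp (p := fun a => (f a, g a)) (init := fun a => (f a).map Word.base)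
    (g := fun p (_ : β) ws => extendWords p.1 p.2 ws) hc hlen
    (PT.comp (show PolyTime fun l : List X => l.map Word.base by fun_prop) hf) (hf.pair hg)
    (by fun_prop) ⟨Polynomial.X * (Polynomial.X + 8) + 4 * Polynomial.X + 2, fun p b ws => ?_⟩
  refine (esize_extendWords_le _ _ _).trans (Nat.mul_le_mul_right _ ?_)
  simp only [Polynomial.eval_add, Polynomial.eval_mul, Polynomial.eval_X, Polynomial.eval_ofNat]
  rw [show p = (p.1, p.2) from rfl, esize_prod]
  gcongr <;> simp only <;> omega

/-- A predicate on words is determined by its one-letter words and its single steps; the clock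
contributes the bound on the length. -/
theorem mem_wordsUpTo {base : List X} {table : List ((X × Role) × X)} {clock : List β}
    {P : Word X → Prop} (hbase : ∀ x, P (.base x) ↔ x ∈ base)
    (hsnoc : ∀ w R x, P (.snoc w R x) ↔ P w ∧ ((w.tail, R), x) ∈ table) {w : Word X} :
    w ∈ wordsUpTo base table clock ↔ P w ∧ w.len ≤ clock.length := by
  induction clock generalizing w with
  | nil =>
    change w ∈ base.map Word.base ↔ _
    cases w with
    | base x => simp [hbase, Word.len]
    | snoc w R x => simp [Word.len]
  | cons c clock ih =>
    change w ∈ extendWords base table (wordsUpTo base table clock) ↔ _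
    rw [extendWords, List.mem_append, List.mem_flatMap]
    cases w with
    | base x => simp [hbase, Word.len]
    | snoc w R x =>
      simp only [List.mem_map, reduceCtorEq, and_false, exists_false, false_or, List.mem_filter,
        eqb_eq_true, Word.snoc.injEq, hsnoc, Word.len, List.length_cons, Nat.add_le_add_iff_right]
      constructor
      · rintro ⟨w', hw', e, ⟨he, he'⟩, rfl, rfl, rfl⟩
        obtain ⟨h1, h2⟩ := ih.1 hw'
        exact ⟨⟨h1, by rw [← he']; exact he⟩, h2⟩
      · rintro ⟨⟨h1, h2⟩, h3⟩
        exact ⟨w, ih.2 ⟨h1, h3⟩, _, ⟨h2, rfl⟩, rfl, rfl, rfl⟩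

end Dexp
end DescrLogic

/-! ### The algorithm: entailment by filtration, and computation of the truncation -/

namespace DescrLogic

/-! ### Deciding entailment by filtration -/

/-- A set of concepts together with a mark for one further condition. -/
abbrev MarkedType : Type := List Concept × Bool

/-- The list is closed under subconcepts. -/
def SubClosed (cl : List Concept) : Prop := ∀ C ∈ cl, ∀ D ∈ C.sub, D ∈ cl

section Filtration

variable (cl : List Concept) (R₀ : Role) (τ₀ : List Concept)

/-- No concept of `cl`, nor the mark for `∃R₀.⊓τ₀`, excludes an `R`-edge from `x` to `y`. -/
noncomputable def compatb (R : Role) (x y : MarkedType) : Bool :=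
  (cl.all fun C =>
    impb (elemb (Concept.ex R C) cl && elemb C y.1) (elemb (Concept.ex R C) x.1) &&
    impb (elemb (Concept.ex R.flip C) cl && elemb C x.1) (elemb (Concept.ex R.flip C) y.1)) &&
  (impb (eqb R R₀ && subb τ₀ y.1) x.2 && impb (eqb R R₀.flip && subb τ₀ x.1) y.2)

/-- The marked types in `W` are those of the elements of an interpretation. -/
noncomputable def goodb (ol : List Inclusion) (W : List MarkedType) : Bool :=
  (W.all fun x =>
    impb (elemb Concept.top cl) (elemb Concept.top x.1) &&
    (cl.all fun C =>
      (cl.all fun D => impb (elemb (Concept.and C D) cl)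
        (iffb (elemb (Concept.and C D) x.1) (elemb C x.1 && elemb D x.1))) &&
      impb (elemb (Concept.exU C) cl)
        (iffb (elemb (Concept.exU C) x.1) (W.any fun y => elemb C y.1)) &&
      ((cl.flatMap Concept.headRole).all fun R => impb (elemb (Concept.ex R C) x.1)
        (W.any fun y => compatb cl R₀ τ₀ R x y && elemb C y.1))) &&
    impb x.2 (W.any fun y => compatb cl R₀ τ₀ R₀ x y && subb τ₀ y.1) &&
    (ol.all fun c => impb (elemb c.lhs x.1) (elemb c.rhs x.1))) &&
  ((cl.flatMap Concept.nomIndex).all fun a =>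
    (W.any fun x => elemb (Concept.nom a) x.1) &&
    (W.all fun x => W.all fun y =>
      impb (elemb (Concept.nom a) x.1 && elemb (Concept.nom a) y.1) (eqb x y)))

/-- All sets of marked types. -/
def allWorlds : List (List MarkedType) :=
  (cl.sublists'.flatMap fun t => [(t, true), (t, false)]).sublists'

/-- `f` maps the elements of `I` onto the marked types in `W`, and it is exact. -/
structure IsFiltration (I : Interpretation) (W : List MarkedType) (f : I.Dom → MarkedType) :
    Prop where
  mem : ∀ d, f d ∈ W
  surj : ∀ x ∈ W, ∃ d, f d = x
  iff : ∀ d, ∀ C ∈ cl, d ∈ I.ext C ↔ C ∈ (f d).1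
  mark : ∀ d, (∃ e, I.rel R₀ d e ∧ e ∈ I.extAll {C | C ∈ τ₀}) ↔ (f d).2 = true

variable {cl R₀ τ₀}

theorem compatb_eq_true {R : Role} {x y : MarkedType} : compatb cl R₀ τ₀ R x y = true ↔
    (∀ C ∈ cl, (Concept.ex R C ∈ cl → C ∈ y.1 → Concept.ex R C ∈ x.1) ∧
      (Concept.ex R.flip C ∈ cl → C ∈ x.1 → Concept.ex R.flip C ∈ y.1)) ∧
    (R = R₀ → τ₀ ⊆ y.1 → x.2 = true) ∧ (R = R₀.flip → τ₀ ⊆ x.1 → y.2 = true) := by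
  simp [compatb]

theorem compatb_flip {R : Role} {x y : MarkedType} :
    compatb cl R₀ τ₀ R.flip x y = true ↔ compatb cl R₀ τ₀ R y x = true := by
  have h : R.flip = R₀ ↔ R = R₀.flip := by
    constructor <;> rintro rfl <;> simp
  have h' : R.flip = R₀.flip ↔ R = R₀ := by
    constructor
    · intro h
      rw [← R.flip_flip, h, R₀.flip_flip]
    · rintro rfl; rfl
  rw [compatb_eq_true, compatb_eq_true, h, h', Role.flip_flip]
  constructor <;> rintro ⟨h1, h2, h3⟩ <;> exact ⟨fun C hC => (h1 C hC).symm, h3, h2⟩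

/-- Closure of `cl` under subconcepts makes the bounded quantifiers of the Boolean test equivalent
to unbounded ones. -/
theorem goodb_eq_true {ol : List Inclusion} {W : List MarkedType} (hcl : SubClosed cl)
    (hW : ∀ x ∈ W, x.1 ⊆ cl) : goodb cl R₀ τ₀ ol W = true ↔
    (∀ x ∈ W, (Concept.top ∈ cl → Concept.top ∈ x.1) ∧
      (∀ C D, Concept.and C D ∈ cl → (Concept.and C D ∈ x.1 ↔ C ∈ x.1 ∧ D ∈ x.1)) ∧
      (∀ C, Concept.exU C ∈ cl → (Concept.exU C ∈ x.1 ↔ ∃ y ∈ W, C ∈ y.1)) ∧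
      (∀ R C, Concept.ex R C ∈ x.1 → ∃ y ∈ W, compatb cl R₀ τ₀ R x y = true ∧ C ∈ y.1) ∧
      (x.2 = true → ∃ y ∈ W, compatb cl R₀ τ₀ R₀ x y = true ∧ τ₀ ⊆ y.1) ∧
      ∀ c ∈ ol, c.lhs ∈ x.1 → c.rhs ∈ x.1) ∧
    ∀ a, Concept.nom a ∈ cl → (∃ x ∈ W, Concept.nom a ∈ x.1) ∧
      ∀ x ∈ W, ∀ y ∈ W, Concept.nom a ∈ x.1 → Concept.nom a ∈ y.1 → x = y := by
  have hroles : ∀ R, R ∈ cl.flatMap Concept.headRole ↔ ∃ C, Concept.ex R C ∈ cl := by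
    intro R
    rw [List.mem_flatMap]
    constructor
    · rintro ⟨C, hC, hR⟩
      cases C <;> simp [Concept.headRole] at hR
      subst hR
      exact ⟨_, hC⟩
    · rintro ⟨C, hC⟩
      exact ⟨_, hC, by simp [Concept.headRole]⟩
  have hinds : ∀ a, a ∈ cl.flatMap Concept.nomIndex ↔ Concept.nom a ∈ cl := by
    intro a
    rw [List.mem_flatMap]
    constructor
    · rintro ⟨C, hC, ha⟩
      cases C <;> simp [Concept.nomIndex] at ha
      subst ha
      exact hC
    · exact fun h => ⟨_, h, by simp [Concept.nomIndex]⟩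
  have h1 : ∀ C D, Concept.and C D ∈ cl → C ∈ cl ∧ D ∈ cl := fun C D h =>
    ⟨hcl _ h _ (by simp [Concept.sub, Concept.mem_sub_self]),
      hcl _ h _ (by simp [Concept.sub, Concept.mem_sub_self])⟩
  have h2 : ∀ C, Concept.exU C ∈ cl → C ∈ cl := fun C h =>
    hcl _ h _ (by simp [Concept.sub, Concept.mem_sub_self])
  have h3 : ∀ R C, Concept.ex R C ∈ cl → C ∈ cl := fun R C h =>
    hcl _ h _ (by simp [Concept.sub, Concept.mem_sub_self])
  simp only [goodb, Bool.and_eq_true, List.all_eq_true, impb_eq_true, elemb_eq_true, eqb_eq_true,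
    iffb_eq_true, List.any_eq_true, subb_eq_true, hinds, hroles]
  refine and_congr (forall₂_congr fun x hx => ?_) (forall₂_congr fun a _ => and_congr Iff.rfl
    ⟨fun h x hx y hy h1 h2 => h x hx y hy ⟨h1, h2⟩, fun h x hx y hy h1 => h x hx y hy h1.1 h1.2⟩)
  constructor
  · rintro ⟨⟨⟨ht, h⟩, hm⟩, ho⟩
    exact ⟨ht, fun C D hCD => ((h C (h1 C D hCD).1).1.1) D (h1 C D hCD).2 hCD,
      fun C hC => (h C (h2 C hC)).1.2 hC,
      fun R C hC => (h C (h3 R C (hW x hx hC))).2 R ⟨C, hW x hx hC⟩ hC, hm, ho⟩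
  · rintro ⟨ht, ha, hu, he, hm, ho⟩
    exact ⟨⟨⟨ht, fun C _ => ⟨⟨fun D _ => ha C D, hu C⟩, fun R _ => he R C⟩⟩, hm⟩, ho⟩

-- The marked types themselves are the elements, and all compatible pairs are edges. Compatibility
-- prevents unwanted truth of existential restrictions, and the witnesses required by `goodb`
-- provide the wanted one, so truth coincides with membership by induction on concepts. The point
-- `x₀` only interprets individual names outside `cl`.
open Classical in
theorem exists_filtration_of_good {ol : List Inclusion} {O : Ontology} (hO : ∀ c, c ∈ ol ↔ c ∈ O)
    (hcl : SubClosed cl) (hOcl : ∀ c ∈ O, c.lhs ∈ cl ∧ c.rhs ∈ cl) (hτ₀ : τ₀ ⊆ cl)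
    {W : List MarkedType} (hW : ∀ x ∈ W, x.1 ⊆ cl) (hgood : goodb cl R₀ τ₀ ol W = true)
    {x₀ : MarkedType} (hx₀ : x₀ ∈ W) :
    ∃ I : Interpretation, I.IsModel O ∧ ∃ f, IsFiltration cl R₀ τ₀ I W f := by
  obtain ⟨hall, hnom⟩ := (goodb_eq_true hcl hW).1 hgood
  let I : Interpretation :=
    { Dom := {x // x ∈ W}
      con := fun A => {x | Concept.name A ∈ x.1.1}
      rol := fun r x y => compatb cl R₀ τ₀ (.name r) x.1 y.1 = true
      ind := fun a => if h : ∃ x ∈ W, Concept.nom a ∈ x.1 then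
        ⟨h.choose, h.choose_spec.1⟩ else ⟨x₀, hx₀⟩ }
  have hrel : ∀ R (x y : I.Dom), I.rel R x y ↔ compatb cl R₀ τ₀ R x.1 y.1 = true := by
    rintro (r | r) x y
    · exact Iff.rfl
    · exact (compatb_flip (R := .name r)).symm
  have truth : ∀ C ∈ cl, ∀ x : I.Dom, x ∈ I.ext C ↔ C ∈ x.1.1 := by
    intro C
    induction C with
    | top => exact fun hC x => ⟨fun _ => (hall x.1 x.2).1 hC, fun _ => trivial⟩
    | name A => exact fun _ x => Iff.rfl
    | nom a =>
      intro hC x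
      have hex := (hnom a hC).1
      have hind : I.ind a = ⟨hex.choose, hex.choose_spec.1⟩ := dif_pos hex
      change x = I.ind a ↔ _
      rw [hind]
      constructor
      · rintro rfl
        exact hex.choose_spec.2
      · exact fun h => Subtype.ext
          ((hnom a hC).2 _ x.2 _ hex.choose_spec.1 h hex.choose_spec.2)
    | and C D ihC ihD =>
      intro hCD x
      rw [(hall x.1 x.2).2.1 C D hCD,
        ← ihC (hcl _ hCD _ (by simp [Concept.sub, Concept.mem_sub_self])) x,
        ← ihD (hcl _ hCD _ (by simp [Concept.sub, Concept.mem_sub_self])) x]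
      rfl
    | ex R C ih =>
      intro hC x
      have hC' : C ∈ cl := hcl _ hC _ (by simp [Concept.sub, Concept.mem_sub_self])
      constructor
      · rintro ⟨e, he, heC⟩
        exact (((compatb_eq_true.1 ((hrel R x e).1 he)).1 C hC').1) hC ((ih hC' e).1 heC)
      · intro h
        obtain ⟨y, hy, hcomp, hCy⟩ := (hall x.1 x.2).2.2.2.1 R C h
        exact ⟨⟨y, hy⟩, (hrel R _ _).2 hcomp, (ih hC' ⟨y, hy⟩).2 hCy⟩
    | exU C ih =>
      intro hC x
      have hC' : C ∈ cl := hcl _ hC _ (by simp [Concept.sub, Concept.mem_sub_self])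
      rw [(hall x.1 x.2).2.2.1 C hC]
      constructor
      · rintro ⟨e, he⟩
        exact ⟨e.1, e.2, (ih hC' e).1 he⟩
      · rintro ⟨y, hy, hCy⟩
        exact ⟨⟨y, hy⟩, (ih hC' ⟨y, hy⟩).2 hCy⟩
  have htau : ∀ e : I.Dom, e ∈ I.extAll {C | C ∈ τ₀} ↔ τ₀ ⊆ e.1.1 := fun e =>
    ⟨fun h C hC => (truth C (hτ₀ hC) e).1 (h C hC), fun h C hC => (truth C (hτ₀ hC) e).2 (h hC)⟩
  refine ⟨I, fun c hc x hx => ?_, fun x => x.1, fun x => x.2, fun x hx => ⟨⟨x, hx⟩, rfl⟩,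
    fun d C hC => truth C hC d, fun d => ⟨?_, fun h => ?_⟩⟩
  · exact (truth _ (hOcl c hc).2 x).2 ((hall x.1 x.2).2.2.2.2.2 c ((hO c).2 hc)
      ((truth _ (hOcl c hc).1 x).1 hx))
  · rintro ⟨e, he, heτ⟩
    exact (compatb_eq_true.1 ((hrel R₀ d e).1 he)).2.1 rfl ((htau e).1 heτ)
  · obtain ⟨y, hy, hcomp, hsub⟩ := (hall d.1 d.2).2.2.2.2.1 h
    exact ⟨⟨y, hy⟩, (hrel _ _ _).2 hcomp, (htau _).2 hsub⟩

theorem subset_of_mem_allWorlds {W : List MarkedType} (h : W ∈ allWorlds cl) :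
    ∀ x ∈ W, x.1 ⊆ cl := by
  intro x hx
  have h1 := (List.mem_sublists'.1 h).subset hx
  obtain ⟨t, ht, hx⟩ := List.mem_flatMap.1 h1
  have ht := (List.mem_sublists'.1 ht).subset
  simp only [List.mem_cons, List.not_mem_nil, or_false] at hx
  rcases hx with rfl | rfl <;> exact ht

-- Each element is sent to the set of concepts of `cl` that it satisfies, together with the mark.
-- Edges become compatible pairs, and a type with `{a}` can only stem from the individual `a`.
open Classical in
theorem exists_good_of_model {ol : List Inclusion} {O : Ontology} (hO : ∀ c, c ∈ ol ↔ c ∈ O)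
    (hcl : SubClosed cl) (hOcl : ∀ c ∈ O, c.lhs ∈ cl ∧ c.rhs ∈ cl) (hτ₀ : τ₀ ⊆ cl)
    {I : Interpretation} (hI : I.IsModel O) :
    ∃ W ∈ allWorlds cl, goodb cl R₀ τ₀ ol W = true ∧ ∃ f, IsFiltration cl R₀ τ₀ I W f := by
  let f : I.Dom → MarkedType := fun d => (cl.filter fun C => d ∈ I.ext C,
    decide (∃ e, I.rel R₀ d e ∧ e ∈ I.extAll {C | C ∈ τ₀}))
  let W : List MarkedType := (cl.sublists'.flatMap fun t => [(t, true), (t, false)]).filter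
    fun x => ∃ d, f d = x
  have hiff : ∀ d, ∀ C ∈ cl, d ∈ I.ext C ↔ C ∈ (f d).1 := fun d C hC => by
    simp [f, hC]
  have hmark : ∀ d, (∃ e, I.rel R₀ d e ∧ e ∈ I.extAll {C | C ∈ τ₀}) ↔ (f d).2 = true :=
    fun d => by simp [f]
  have hfW : ∀ x, x ∈ W ↔ ∃ d, f d = x := by
    intro x
    simp only [W, List.mem_filter, decide_eq_true_eq, and_iff_right_iff_imp]
    rintro ⟨d, rfl⟩
    refine List.mem_flatMap.2 ⟨(f d).1, List.mem_sublists'.2 List.filter_sublist, ?_⟩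
    rw [show f d = ((f d).1, (f d).2) from rfl]
    cases (f d).2 <;> simp
  have hW : W ∈ allWorlds cl := List.mem_sublists'.2 List.filter_sublist
  have hsub := subset_of_mem_allWorlds hW
  have htau : ∀ e : I.Dom, e ∈ I.extAll {C | C ∈ τ₀} ↔ τ₀ ⊆ (f e).1 := fun e =>
    ⟨fun h C hC => (hiff e C (hτ₀ hC)).1 (h C hC), fun h C hC => (hiff e C (hτ₀ hC)).2 (h hC)⟩
  have hrel' : ∀ R d e, I.rel R d e → ∀ C ∈ cl, Concept.ex R C ∈ cl → C ∈ (f e).1 →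
      Concept.ex R C ∈ (f d).1 := fun R d e h C hC hRC hCe =>
    (hiff d _ hRC).1 ⟨e, h, (hiff e C hC).2 hCe⟩
  have hcompat : ∀ R d e, I.rel R d e → compatb cl R₀ τ₀ R (f d) (f e) = true := by
    intro R d e h
    have h' : I.rel R.flip e d := by rwa [I.rel_flip]
    refine compatb_eq_true.2 ⟨fun C hC => ⟨hrel' R d e h C hC, hrel' R.flip e d h' C hC⟩, ?_, ?_⟩
    · rintro rfl h1
      exact (hmark d).1 ⟨e, h, (htau e).2 h1⟩
    · rintro rfl h1
      rw [Role.flip_flip] at h'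
      exact (hmark e).1 ⟨d, h', (htau d).2 h1⟩
  refine ⟨W, hW, (goodb_eq_true hcl hsub).2 ⟨fun x hx => ?_, fun a ha => ⟨?_, ?_⟩⟩, f,
    fun d => (hfW _).2 ⟨d, rfl⟩, fun x hx => (hfW x).1 hx, hiff, hmark⟩
  · obtain ⟨d, rfl⟩ := (hfW x).1 hx
    refine ⟨fun h => (hiff d _ h).1 trivial, fun C D hCD => ?_, fun C hC => ?_, fun R C hC => ?_,
      fun hm => ?_, fun c hc hl => ?_⟩
    · rw [← hiff d _ hCD, ← hiff d C (hcl _ hCD _ (by simp [Concept.sub, Concept.mem_sub_self])),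
        ← hiff d D (hcl _ hCD _ (by simp [Concept.sub, Concept.mem_sub_self]))]
      rfl
    · have hC' : C ∈ cl := hcl _ hC _ (by simp [Concept.sub, Concept.mem_sub_self])
      rw [← hiff d _ hC]
      constructor
      · rintro ⟨e, he⟩
        exact ⟨f e, (hfW _).2 ⟨e, rfl⟩, (hiff e C hC').1 he⟩
      · rintro ⟨y, hy, hCy⟩
        obtain ⟨e, rfl⟩ := (hfW y).1 hy
        exact ⟨e, (hiff e C hC').2 hCy⟩
    · have hRC := hsub _ hx hC
      have hC' : C ∈ cl := hcl _ hRC _ (by simp [Concept.sub, Concept.mem_sub_self])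
      obtain ⟨e, he, heC⟩ := (hiff d _ hRC).2 hC
      exact ⟨f e, (hfW _).2 ⟨e, rfl⟩, hcompat R d e he, (hiff e C hC').1 heC⟩
    · obtain ⟨e, he, heτ⟩ := (hmark d).2 hm
      exact ⟨f e, (hfW _).2 ⟨e, rfl⟩, hcompat _ d e he, (htau e).1 heτ⟩
    · have hc' := (hO c).1 hc
      exact (hiff d _ (hOcl c hc').2).1 (hI c hc' ((hiff d _ (hOcl c hc').1).2 hl))
  · exact ⟨f (I.ind a), (hfW _).2 ⟨_, rfl⟩, (hiff _ _ ha).1 rfl⟩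
  · intro x hx y hy hax hay
    obtain ⟨d, rfl⟩ := (hfW x).1 hx
    obtain ⟨e, rfl⟩ := (hfW y).1 hy
    have h1 : d = I.ind a := (hiff d _ ha).2 hax
    have h2 : e = I.ind a := (hiff e _ ha).2 hay
    rw [h1, h2]

end Filtration
end DescrLogic

namespace DescrLogic

/-! ### The algorithm -/

/-- The data that the algorithm computes first. -/
structure Context : Type where
  name : ℕ
  ontology : List Inclusion
  cl : List Concept
  types : List (List Concept)
  worlds : List (List MarkedType)

instance : Enc Context :=
  ⟨fun E => Enc.enc (E.name, E.ontology, E.cl, E.types, E.worlds), fun E E' h => by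
    have h := Enc.inj h
    cases E
    cases E'
    simpa using h⟩

namespace Context

@[fun_prop] theorem polyTime_name : PolyTime name :=
  .of_enc (F := fun E => (Enc.enc E).hd) (by fun_prop) fun _ => rfl

@[fun_prop] theorem polyTime_ontology : PolyTime ontology :=
  .of_enc (F := fun E => (Enc.enc E).tl.hd) (by fun_prop) fun _ => rfl

@[fun_prop] theorem polyTime_cl : PolyTime cl :=
  .of_enc (F := fun E => (Enc.enc E).tl.tl.hd) (by fun_prop) fun _ => rfl

@[fun_prop] theorem polyTime_types : PolyTime types :=
  .of_enc (F := fun E => (Enc.enc E).tl.tl.tl.hd) (by fun_prop) fun _ => rfl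

@[fun_prop] theorem polyTime_worlds : PolyTime worlds :=
  .of_enc (F := fun E => (Enc.enc E).tl.tl.tl.tl) (by fun_prop) fun _ => rfl

end Context

section Tests

variable {α : Type} [Enc α]

@[fun_prop]
theorem PolyTime.compatb {c : α → List Concept} {R₀ R : α → Role} {τ : α → List Concept}
    {x y : α → MarkedType} (hc : PolyTime c) (hR₀ : PolyTime R₀) (hτ : PolyTime τ)
    (hR : PolyTime R) (hx : PolyTime x) (hy : PolyTime y) :
    PolyTime fun a => compatb (c a) (R₀ a) (τ a) (R a) (x a) (y a) := by
  unfold DescrLogic.compatb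
  fun_prop

@[fun_prop]
theorem PolyTime.goodb {c : α → List Concept} {R₀ : α → Role} {τ : α → List Concept}
    {o : α → List Inclusion} {W : α → List MarkedType} (hc : PolyTime c) (hR₀ : PolyTime R₀)
    (hτ : PolyTime τ) (ho : PolyTime o) (hW : PolyTime W) :
    PolyTime fun a => goodb (c a) (R₀ a) (τ a) (o a) (W a) := by
  unfold DescrLogic.goodb
  fun_prop

namespace Context

/-- Entailment of `C` by the conjunction of `τ`. -/
noncomputable def entb (E : Context) (τ : List Concept) (C : Concept) : Bool :=
  E.worlds.all fun W => impb (goodb E.cl (.name 0) [] E.ontology W)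
    (W.all fun x => impb (subb τ x.1) (elemb C x.1))

/-- Entailment of `∃R.⊓σ` by the conjunction of `τ`. -/
noncomputable def succb (E : Context) (R : Role) (τ σ : List Concept) : Bool :=
  E.worlds.all fun W => impb (goodb E.cl R σ E.ontology W)
    (W.all fun x => impb (subb τ x.1) x.2)

/-- Entailment of `∃u.B` by `A`. -/
noncomputable def exUb (E : Context) (B : ℕ) : Bool :=
  E.worlds.all fun W => impb (goodb E.cl (.name 0) [] E.ontology W)
    (W.all fun x => impb (elemb (Concept.name E.name) x.1)
      (W.any fun y => elemb (Concept.name B) y.1))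

/-- Closure under consequence. -/
noncomputable def typeb (E : Context) (τ : List Concept) : Bool :=
  E.cl.all fun C => impb (E.entb τ C) (elemb C τ)

/-- The least type with `C` and `∃u.A`. -/
noncomputable def least (E : Context) (C : Concept) : List Concept :=
  E.cl.filter fun D => E.entb [C, .exU (.name E.name)] D

/-- The individual names. -/
def inds (E : Context) : List ℕ := E.cl.flatMap Concept.nomIndex

/-- The types of the individual names. -/
noncomputable def nomTypes (E : Context) : List (List Concept) :=
  E.inds.map fun a => E.least (.nom a)

/-- The types of the concept names. -/
noncomputable def conTypes (E : Context) : List (List Concept) :=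
  ((E.cl.flatMap Concept.conIndex).filter fun B => E.exUb B).map fun B => E.least (.name B)

/-- The test for `TypeSucc`. -/
noncomputable def typeSuccb (E : Context) (R : Role) (τ σ : List Concept) : Bool :=
  (E.typeb σ && E.succb R τ σ) &&
    E.types.all fun σ' => impb ((E.typeb σ' && E.succb R τ σ') && subb σ σ') (subb σ' σ)

/-- The steps between the letters of canonical words. -/
noncomputable def typeTable (E : Context) : List ((List Concept × Role) × List Concept) :=
  E.types.flatMap fun τ =>
    (E.cl.flatMap fun C => C.headRole.flatMap fun R => [R, R.flip]).flatMap fun R =>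
      (E.types.filter fun σ => !elemb σ E.nomTypes && E.typeSuccb R τ σ).map fun σ => ((τ, R), σ)

/-- The role name `r` in the canonical model. -/
noncomputable def relb (E : Context) (r : ℕ) (x y : Word (List Concept)) : Bool :=
  (eqb y (.snoc x (.name r) y.tail) || eqb x (.snoc y (.inv r) x.tail)) ||
  ((E.inds.any fun a => elemb (.ex (.name r) (.nom a)) x.tail && eqb y (.base (E.least (.nom a)))) ||
  (E.inds.any fun a => elemb (.ex (.inv r) (.nom a)) y.tail && eqb x (.base (E.least (.nom a)))))

/-- The test for nominals from `Γ`. -/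
noncomputable def nominalb (E : Context) (Γ : List ℕ) (x : Word (List Concept)) : Bool :=
  Γ.any fun a => eqb x (.base (E.least (.nom a)))

/-- The steps between the letters of the words of the unfolding. -/
noncomputable def roleTable (E : Context) (Γ P : List ℕ) (V : List (Word (List Concept))) :
    List ((Word (List Concept) × Role) × Word (List Concept)) :=
  V.flatMap fun x => P.flatMap fun r =>
    (V.filter fun y => !E.nominalb Γ y && E.relb r x y).map (fun y => ((x, .name r), y)) ++
    (V.filter fun y => !E.nominalb Γ y && E.relb r y x).map (fun y => ((x, .inv r), y))

/-- The role name `r` in the unfolding. -/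
noncomputable def wordRolb (E : Context) (Γ : List ℕ) (r : ℕ) (w z : Word (Word (List Concept))) :
    Bool :=
  (eqb z (.snoc w (.name r) z.tail) || eqb w (.snoc z (.inv r) w.tail)) ||
  (((eqb z (.base z.tail) && E.nominalb Γ z.tail) || (eqb w (.base w.tail) && E.nominalb Γ w.tail)) &&
    E.relb r w.tail z.tail)

/-- The words that can be reached from a list of words in one step. -/
noncomputable def reachStep (E : Context) (Γ P : List ℕ) (V S : List (Word (Word (List Concept)))) :
    List (Word (Word (List Concept))) :=
  V.filter fun w => elemb w S ||
    S.any fun z => P.any fun r => E.wordRolb Γ r w z || E.wordRolb Γ r z w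

/-- The word `ρ_A` of the unfolding. -/
noncomputable def root (E : Context) : Word (Word (List Concept)) :=
  .base (.base (E.least (.name E.name)))

/-- The words that can be reached from `ρ_A`. -/
noncomputable def reach (E : Context) (Γ P : List ℕ) (V : List (Word (Word (List Concept)))) :
    List (Word (Word (List Concept))) :=
  V.foldr (fun _ S => E.reachStep Γ P V S) [E.root]

/-- The assertions of the unfolding for a list of words. -/
noncomputable def assertions (E : Context) (X Γ P : List ℕ) (W : List (Word (Word (List Concept)))) :
    ABoxCode :=
  W.flatMap fun w => .top w ::
    ((X.filter fun B => elemb (.name B) w.tail.tail).map (fun B => .con B w) ++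
    ((Γ.filter fun a => eqb w (.base (.base (E.least (.nom a))))).map (fun a => .nom a w) ++
    P.flatMap fun r => (W.filter fun z => E.wordRolb Γ r w z).map fun z => .rol r w z))

section PolyTime

variable {e : α → Context} {τ σ : α → List Concept} {R : α → Role} {n : α → ℕ}
  {Γ P : α → List ℕ}

@[fun_prop]
theorem polyTime_entb {C : α → Concept} (he : PolyTime e) (hτ : PolyTime τ) (hC : PolyTime C) :
    PolyTime fun a => (e a).entb (τ a) (C a) := by
  unfold entb
  fun_prop

@[fun_prop]
theorem polyTime_succb (he : PolyTime e) (hR : PolyTime R) (hτ : PolyTime τ) (hσ : PolyTime σ) :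
    PolyTime fun a => (e a).succb (R a) (τ a) (σ a) := by
  unfold succb
  fun_prop

@[fun_prop]
theorem polyTime_exUb (he : PolyTime e) (hn : PolyTime n) :
    PolyTime fun a => (e a).exUb (n a) := by
  unfold exUb
  fun_prop

@[fun_prop]
theorem polyTime_typeb (he : PolyTime e) (hτ : PolyTime τ) :
    PolyTime fun a => (e a).typeb (τ a) := by
  unfold typeb
  fun_prop

@[fun_prop]
theorem polyTime_least {C : α → Concept} (he : PolyTime e) (hC : PolyTime C) :
    PolyTime fun a => (e a).least (C a) := by
  unfold least
  fun_prop

@[fun_prop]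
theorem polyTime_inds : PolyTime inds := by
  unfold inds
  fun_prop

@[fun_prop]
theorem polyTime_nomTypes : PolyTime nomTypes := by
  unfold nomTypes
  fun_prop

@[fun_prop]
theorem polyTime_conTypes : PolyTime conTypes := by
  unfold conTypes
  fun_prop

@[fun_prop]
theorem polyTime_typeSuccb (he : PolyTime e) (hR : PolyTime R) (hτ : PolyTime τ)
    (hσ : PolyTime σ) : PolyTime fun a => (e a).typeSuccb (R a) (τ a) (σ a) := by
  unfold typeSuccb
  fun_prop

@[fun_prop]
theorem polyTime_typeTable : PolyTime typeTable := by
  unfold typeTable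
  fun_prop

@[fun_prop]
theorem polyTime_relb {x y : α → Word (List Concept)} (he : PolyTime e) (hn : PolyTime n)
    (hx : PolyTime x) (hy : PolyTime y) : PolyTime fun a => (e a).relb (n a) (x a) (y a) := by
  unfold relb
  fun_prop

@[fun_prop]
theorem polyTime_nominalb {x : α → Word (List Concept)} (he : PolyTime e) (hΓ : PolyTime Γ)
    (hx : PolyTime x) : PolyTime fun a => (e a).nominalb (Γ a) (x a) := by
  unfold nominalb
  fun_prop

@[fun_prop]
theorem polyTime_roleTable {V : α → List (Word (List Concept))} (he : PolyTime e)
    (hΓ : PolyTime Γ) (hP : PolyTime P) (hV : PolyTime V) :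
    PolyTime fun a => (e a).roleTable (Γ a) (P a) (V a) := by
  unfold roleTable
  fun_prop

@[fun_prop]
theorem polyTime_wordRolb {w z : α → Word (Word (List Concept))} (he : PolyTime e)
    (hΓ : PolyTime Γ) (hn : PolyTime n) (hw : PolyTime w) (hz : PolyTime z) :
    PolyTime fun a => (e a).wordRolb (Γ a) (n a) (w a) (z a) := by
  unfold wordRolb
  fun_prop

@[fun_prop]
theorem polyTime_reachStep {V S : α → List (Word (Word (List Concept)))} (he : PolyTime e)
    (hΓ : PolyTime Γ) (hP : PolyTime P) (hV : PolyTime V) (hS : PolyTime S) :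
    PolyTime fun a => (e a).reachStep (Γ a) (P a) (V a) (S a) := by
  unfold reachStep
  fun_prop

@[fun_prop]
theorem polyTime_root : PolyTime root := by
  unfold root
  fun_prop

@[fun_prop]
theorem polyTime_reach {V : α → List (Word (Word (List Concept)))} (he : PolyTime e)
    (hΓ : PolyTime Γ) (hP : PolyTime P) (hV : PolyTime V) :
    PolyTime fun a => (e a).reach (Γ a) (P a) (V a) := by
  have hroot : PolyTime fun a => [(e a).root] := by fun_prop
  refine Cmp.foldr (E := id) (p := fun a => (e a, Γ a, P a, V a)) (init := fun a => [(e a).root])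
    (g := fun p _ S => p.1.reachStep p.2.1 p.2.2.1 p.2.2.2 S) hV hroot
    (show PolyTime _ by fun_prop) (show PolyTime _ by fun_prop)
    ⟨_, (Cmp.bdd hroot).add (Cmp.bdd hV), fun a i => ?_⟩
  -- Every step filters `V`, so the accumulators never outgrow it.
  cases (V a).drop i with
  | nil => exact Nat.le_add_right _ _
  | cons w l => exact (esize_le_of_sublist List.filter_sublist).trans (Nat.le_add_left _ _)

@[fun_prop]
theorem polyTime_assertions {X : α → List ℕ} {W : α → List (Word (Word (List Concept)))}
    (he : PolyTime e) (hX : PolyTime X) (hΓ : PolyTime Γ) (hP : PolyTime P) (hW : PolyTime W) :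
    PolyTime fun a => (e a).assertions (X a) (Γ a) (P a) (W a) := by
  unfold assertions
  fun_prop

end PolyTime

end Context

end Tests

/-! The input -/

/-- Two lists of inclusions and two concept names. -/
abbrev Input : Type := (List Inclusion × List Inclusion) × ℕ × ℕ

/-- The subconcepts, for inclusions in normal form. -/
def subconcepts (l : List Inclusion) : List Concept :=
  l.flatMap fun c => (c.lhs :: c.lhs.children) ++ (c.rhs :: c.rhs.children)

namespace Input

/-- The concepts that types consist of. -/
noncomputable def concepts (i : Input) : List Concept :=
  let s := subconcepts (i.1.1 ++ i.1.2)
  nub ((s ++ (s.flatMap fun C => C.headRole.flatMap fun R => [R, R.flip]).flatMap fun R =>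
    (s.flatMap Concept.nomIndex).map fun a => .ex R (.nom a)) ++
    [.name i.2.1, .exU (.name i.2.1)])

/-- The concept names of the common signature. -/
noncomputable def conNames (i : Input) : List ℕ :=
  (i.2.1 :: (subconcepts i.1.1).flatMap Concept.conIndex).filter fun B =>
    elemb B (i.2.2 :: (subconcepts i.1.2).flatMap Concept.conIndex)

/-- The individual names of the common signature. -/
noncomputable def indNames (i : Input) : List ℕ :=
  ((subconcepts i.1.1).flatMap Concept.nomIndex).filter fun a =>
    elemb a ((subconcepts i.1.2).flatMap Concept.nomIndex)

/-- The role names of the common signature. -/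
noncomputable def rolNames (i : Input) : List ℕ :=
  ((subconcepts i.1.1).flatMap fun C => C.headRole.map Role.base).filter fun r =>
    elemb r ((subconcepts i.1.2).flatMap fun C => C.headRole.map Role.base)

/-- The context for the input. -/
noncomputable def context (i : Input) : Context :=
  ⟨i.2.1, i.1.1 ++ i.1.2, i.concepts, i.concepts.sublists', allWorlds i.concepts⟩

/-- A list whose length is the bound for the lengths of words. -/
noncomputable def clock (i : Input) : List (List Concept) :=
  (i.concepts ++ (i.concepts ++ (i.concepts ++ (i.concepts ++
    List.replicate 6 Concept.top)))).sublists'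

/-- The canonical words of bounded length. -/
noncomputable def canonicalWords (i : Input) : List (Word (List Concept)) :=
  wordsUpTo (i.context.conTypes ++ i.context.nomTypes) i.context.typeTable i.clock

/-- The words of bounded length of the unfolding. -/
noncomputable def unfoldWords (i : Input) : List (Word (Word (List Concept))) :=
  wordsUpTo i.canonicalWords (i.context.roleTable i.indNames i.rolNames i.canonicalWords) i.clock

/-- The words that are selected for a language. -/
noncomputable def selectedWords (L : Dialect) (i : Input) : List (Word (Word (List Concept))) :=
  match L with
  | .eliou => i.unfoldWords
  | .elio => i.context.reach i.indNames i.rolNames i.unfoldWords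

/-- The output of the algorithm. -/
noncomputable def output (L : Dialect) (i : Input) : ABoxCode :=
  i.context.assertions i.conNames i.indNames i.rolNames (i.selectedWords L)

end Input

section Time

variable {α : Type} [Enc α]

@[fun_prop]
theorem polyTime_subconcepts : PolyTime subconcepts := by
  unfold subconcepts
  fun_prop

namespace Input

@[fun_prop]
theorem polyTime_concepts : PolyTime concepts := by
  unfold concepts
  fun_prop

@[fun_prop]
theorem polyTime_conNames : PolyTime conNames := by
  unfold conNames
  fun_prop

@[fun_prop]
theorem polyTime_indNames : PolyTime indNames := by
  unfold indNames
  fun_prop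

@[fun_prop]
theorem polyTime_rolNames : PolyTime rolNames := by
  unfold rolNames
  fun_prop

theorem _root_.DescrLogic.PolyTime.length_le {β : Type} [Enc β] {f : α → List β}
    (hf : PolyTime f) : ∃ q : Polynomial ℕ, ∀ a, (f a).length ≤ q.eval (esize a) := by
  obtain ⟨q, hq⟩ := Cmp.bdd hf
  exact ⟨q, fun a => (length_le_esize _).trans (hq a)⟩

theorem _root_.DescrLogic.PolyTime.sublists' {β : Type} [Enc β] {f : α → List β}
    (hf : PolyTime f) : Cmp dexp fun a => (f a).sublists' := by
  obtain ⟨q, hq⟩ := hf.length_le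
  exact Cmp.sublists' (PT.cmp hf) ⟨q, fun a => (hq a).trans Nat.lt_two_pow_self.le⟩

/-- Over `c` concepts there are `2 ^ (c + 1)` marked types, an exponential number as `Cmp.sublists'`
allows, so the list of all worlds is doubly exponential. -/
theorem cmp_context : Cmp dexp context := by
  have h1 : Cmp dexp fun i : Input => i.concepts.sublists' := polyTime_concepts.sublists'
  have h2 : Cmp dexp fun i : Input =>
      i.concepts.sublists'.flatMap fun t => [(t, true), (t, false)] :=
    PT.comp (show PolyTime fun s : List (List Concept) =>
      s.flatMap fun t => [(t, true), (t, false)] by fun_prop) h1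
  have h3 : Cmp dexp fun i : Input => allWorlds i.concepts := by
    obtain ⟨q, hq⟩ := polyTime_concepts.length_le
    refine h2.sublists' ⟨q + 1, fun i => ?_⟩
    have : (i.concepts.sublists'.flatMap fun t => [(t, true), (t, false)]).length =
        2 ^ (i.concepts.length + 1) := by
      simp [pow_succ]
    rw [this, Polynomial.eval_add, Polynomial.eval_one]
    exact Nat.pow_le_pow_right (by norm_num) (Nat.succ_le_succ (hq i))
  have hname : PolyTime fun i : Input => i.2.1 := by fun_prop
  have hont : PolyTime fun i : Input => i.1.1 ++ i.1.2 := by fun_prop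
  have h4 := (PT.cmp (E := dexp) hname).pair ((PT.cmp hont).pair
    ((PT.cmp polyTime_concepts).pair (h1.pair h3)))
  exact Cmp.of_enc h4.enc fun i => rfl

theorem cmp_clock : Cmp dexp clock :=
  PolyTime.sublists' (f := fun i : Input => i.concepts ++ (i.concepts ++ (i.concepts ++
    (i.concepts ++ List.replicate 6 Concept.top)))) (by fun_prop)

/-- A list of `4 * c + 6` elements has exactly as many sublists as `truncBound` demands; the list of
sublists serves as the counter. -/
theorem length_clock (i : Input) : i.clock.length = 2 ^ (4 * i.concepts.length + 6) := by
  simp only [clock, List.length_sublists', List.length_append, List.length_replicate]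
  congr 1
  ring

theorem clock_length_le : ∃ q : Polynomial ℕ, ∀ i : Input, i.clock.length ≤ 2 ^ q.eval (esize i) := by
  obtain ⟨q, hq⟩ := polyTime_concepts.length_le
  refine ⟨4 * q + 6, fun i => ?_⟩
  rw [length_clock]
  refine Nat.pow_le_pow_right (by norm_num) ?_
  simp only [Polynomial.eval_add, Polynomial.eval_mul, Polynomial.eval_ofNat]
  have := hq i
  omega

theorem cmp_canonicalWords : Cmp dexp canonicalWords :=
  Cmp.wordsUpTo (PT.comp (show PolyTime fun E : Context => E.conTypes ++ E.nomTypes by fun_prop)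
    cmp_context) (PT.comp Context.polyTime_typeTable cmp_context) cmp_clock clock_length_le

theorem cmp_unfoldWords : Cmp dexp unfoldWords := by
  have hg : PolyTime fun p : Input × Context × List (Word (List Concept)) =>
      p.2.1.roleTable p.1.indNames p.1.rolNames p.2.2 := by fun_prop
  have hf : Cmp dexp fun i : Input => (i, i.context, i.canonicalWords) :=
    (PT.cmp PT.id').pair (cmp_context.pair cmp_canonicalWords)
  have h := PT.comp hg hf
  exact Cmp.wordsUpTo cmp_canonicalWords h cmp_clock clock_length_le

theorem cmp_selectedWords (L : Dialect) : Cmp dexp (selectedWords L) := by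
  cases L with
  | eliou => exact cmp_unfoldWords
  | elio =>
    have hg : PolyTime fun p : Input × Context × List (Word (Word (List Concept))) =>
        p.2.1.reach p.1.indNames p.1.rolNames p.2.2 := by fun_prop
    have hf : Cmp dexp fun i : Input => (i, i.context, i.unfoldWords) :=
      (PT.cmp PT.id').pair (cmp_context.pair cmp_unfoldWords)
    have h := PT.comp hg hf
    exact h

theorem cmp_output (L : Dialect) : Cmp dexp (output L) := by
  have hg : PolyTime fun p : Input × Context × List (Word (Word (List Concept))) =>
      p.2.1.assertions p.1.conNames p.1.indNames p.1.rolNames p.2.2 := by fun_prop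
  have hf : Cmp dexp fun i : Input => (i, i.context, i.selectedWords L) :=
    (PT.cmp PT.id').pair (cmp_context.pair (cmp_selectedWords L))
  have h := PT.comp hg hf
  exact h

theorem exists_prog (L : Dialect) : ∃ (P : Prog) (q : Polynomial ℕ), ∀ l₁ l₂ A B,
    P.OutputsWithin (encInput l₁ l₂ A B) (2 ^ 2 ^ q.eval (encInput l₁ l₂ A B).size)
      (encABoxCode (output L ((l₁, l₂), A, B))) := by
  obtain ⟨P, k, T, ⟨q, hq⟩, h⟩ := cmp_output L
  refine ⟨P, q, fun l₁ l₂ A B => ?_⟩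
  obtain ⟨n, hn, s, h1, h2, -⟩ := h ((l₁, l₂), A, B)
    (Function.update (fun _ => Data.nil) 0 (encInput l₁ l₂ A B)) (by simp; rfl)
  exact ⟨n, hn.trans (hq _), s, h1, h2⟩

end Input

end Time
end DescrLogic

namespace DescrLogic

/-! ### Correctness of the algorithm -/

theorem Word.map_map {X Y Z : Type} (f : X → Y) (g : Y → Z) (w : Word X) :
    (w.map f).map g = w.map (g ∘ f) := by
  induction w with
  | base x => rfl
  | snoc w R x ih => simp only [Word.map, ih, Function.comp]

theorem Word.tail_map {X Y : Type} (f : X → Y) (w : Word X) : (w.map f).tail = f w.tail := by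
  cases w <;> rfl

theorem Word.len_map {X Y : Type} (f : X → Y) (w : Word X) : (w.map f).len = w.len := by
  induction w with
  | base x => rfl
  | snoc w R x ih => simp only [Word.map, Word.len, ih]

theorem Word.map_injective {X Y : Type} {f : X → Y} (hf : Function.Injective f) :
    Function.Injective (Word.map f) := by
  intro w
  induction w with
  | base x =>
    rintro (y | ⟨w', R, y⟩) h <;> simp only [Word.map, Word.base.injEq, reduceCtorEq] at h
    rw [hf h]
  | snoc w R x ih =>
    rintro (y | ⟨w', R', y⟩) h <;> simp only [Word.map, Word.snoc.injEq, reduceCtorEq] at h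
    rw [ih h.1, h.2.1, hf h.2.2]

-- Sublists of a list without duplicates are determined by their members, so every set of concepts
-- of `cl` has exactly one representative in `types`.
open Classical in
theorem filter_mem_of_sublist {α : Type} {l l' : List α} (h : l.Sublist l') (hn : l'.Nodup) :
    l'.filter (fun a => a ∈ l) = l := by
  induction h with
  | slnil => rfl
  | @cons l l' a h ih =>
    have ha := (List.nodup_cons.1 hn).1
    rw [List.filter_cons_of_neg (by simpa using fun h' => ha (h.subset h')),
      ih (List.nodup_cons.1 hn).2]
  | @cons_cons l l' a h ih =>
    have ha := (List.nodup_cons.1 hn).1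
    rw [List.filter_cons_of_pos (by simp)]
    congr 1
    rw [← ih (List.nodup_cons.1 hn).2]
    refine List.filter_congr fun b hb => ?_
    have : b ≠ a := fun h' => ha (h' ▸ hb)
    simp [this, ih (List.nodup_cons.1 hn).2]

namespace Context

/-- The context belongs to the ontology `O` and the concept name `A`. -/
structure Fits (E : Context) (O : Ontology) (A : ℕ) : Prop where
  name_eq : E.name = A
  mem_ontology : ∀ c, c ∈ E.ontology ↔ c ∈ O
  mem_cl : ∀ C, C ∈ E.cl ↔ C ∈ typeConcepts O A
  nodup : E.cl.Nodup
  types_eq : E.types = E.cl.sublists'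
  worlds_eq : E.worlds = allWorlds E.cl

variable {E : Context} {O : Ontology} {A : ℕ}

namespace Fits

theorem subClosed (h : E.Fits O A) : SubClosed E.cl := fun C hC D hD =>
  (h.mem_cl D).2 (typeConcepts_closed ((h.mem_cl C).1 hC) hD)

theorem inclusion_mem (h : E.Fits O A) : ∀ c ∈ O, c.lhs ∈ E.cl ∧ c.rhs ∈ E.cl := fun _ hc =>
  ⟨(h.mem_cl _).2 (sub_subset_typeConcepts (Ontology.mem_sub_lhs hc)),
    (h.mem_cl _).2 (sub_subset_typeConcepts (Ontology.mem_sub_rhs hc))⟩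

/-- Facts about all elements of all models of `O` can be checked in the worlds. -/
theorem forall_iff (h : E.Fits O A) {R : Role} {σ : List Concept} (hσ : σ ⊆ E.cl)
    {p : ∀ I : Interpretation, I.Dom → Prop} {q : List MarkedType → MarkedType → Prop}
    (hpq : ∀ I W f, IsFiltration E.cl R σ I W f → ∀ d, p I d ↔ q W (f d)) :
    (∀ I : Interpretation, I.IsModel O → ∀ d, p I d) ↔
      ∀ W ∈ E.worlds, goodb E.cl R σ E.ontology W = true → ∀ x ∈ W, q W x := by
  constructor
  · intro hp W hW hg x hx
    rw [h.worlds_eq] at hW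
    obtain ⟨I, hI, f, hf⟩ := exists_filtration_of_good h.mem_ontology h.subClosed h.inclusion_mem hσ
      (subset_of_mem_allWorlds hW) hg hx
    obtain ⟨d, rfl⟩ := hf.surj x hx
    exact (hpq I W f hf d).1 (hp I hI d)
  · intro hq I hI d
    obtain ⟨W, hW, hg, f, hf⟩ := exists_good_of_model (R₀ := R) h.mem_ontology h.subClosed
      h.inclusion_mem hσ hI
    rw [← h.worlds_eq] at hW
    exact (hpq I W f hf d).2 (hq W hW hg _ (hf.mem d))

theorem extAll_iff {R : Role} {σ : List Concept} {I : Interpretation} {W : List MarkedType}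
    {f : I.Dom → MarkedType} (hf : IsFiltration E.cl R σ I W f) {τ : List Concept}
    (hτ : τ ⊆ E.cl) (d : I.Dom) : d ∈ I.extAll {C | C ∈ τ} ↔ τ ⊆ (f d).1 :=
  ⟨fun h C hC => (hf.iff d C (hτ hC)).1 (h C hC), fun h C hC => (hf.iff d C (hτ hC)).2 (h hC)⟩

theorem entb_iff (h : E.Fits O A) {τ : List Concept} (hτ : τ ⊆ E.cl) {C : Concept}
    (hC : C ∈ E.cl) : E.entb τ C = true ↔
      ∀ I : Interpretation, I.IsModel O → I.extAll {D | D ∈ τ} ⊆ I.ext C := by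
  have := h.forall_iff (R := .name 0) (σ := []) (by simp)
    (p := fun I d => d ∈ I.extAll {D | D ∈ τ} → d ∈ I.ext C)
    (q := fun _ x => τ ⊆ x.1 → C ∈ x.1)
    (fun I W f hf d => by rw [extAll_iff hf hτ, hf.iff d C hC])
  simp only [entb, List.all_eq_true, impb_eq_true, subb_eq_true, elemb_eq_true]
  exact this.symm

/-- The restriction `∃R.⊓σ` is in general not in `cl`; the mark of the filtration, taken for `R` and
`σ`, decides it. -/
theorem succb_iff (h : E.Fits O A) {R : Role} {τ σ : List Concept} (hτ : τ ⊆ E.cl)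
    (hσ : σ ⊆ E.cl) : E.succb R τ σ = true ↔
      ∀ I : Interpretation, I.IsModel O → ∀ d ∈ I.extAll {D | D ∈ τ},
        ∃ e, I.rel R d e ∧ e ∈ I.extAll {D | D ∈ σ} := by
  have := h.forall_iff (R := R) hσ
    (p := fun I d => d ∈ I.extAll {D | D ∈ τ} → ∃ e, I.rel R d e ∧ e ∈ I.extAll {D | D ∈ σ})
    (q := fun _ x => τ ⊆ x.1 → x.2 = true)
    (fun I W f hf d => by rw [extAll_iff hf hτ, hf.mark d])
  simp only [succb, List.all_eq_true, impb_eq_true, subb_eq_true]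
  exact this.symm

theorem exUb_iff (h : E.Fits O A) {B : ℕ} (hB : Concept.name B ∈ E.cl) :
    E.exUb B = true ↔ O.Entails (.name A) (.exU (.name B)) := by
  have hA : Concept.name A ∈ E.cl := (h.mem_cl _).2 name_mem_typeConcepts
  have := h.forall_iff (R := .name 0) (σ := []) (by simp)
    (p := fun I d => d ∈ I.ext (.name A) → d ∈ I.ext (.exU (.name B)))
    (q := fun W x => Concept.name A ∈ x.1 → ∃ y ∈ W, Concept.name B ∈ y.1)
    (fun I W f hf d => by
      rw [hf.iff d _ hA]
      refine imp_congr_right fun _ => ⟨?_, ?_⟩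
      · rintro ⟨e, he⟩
        exact ⟨f e, hf.mem e, (hf.iff e _ hB).1 he⟩
      · rintro ⟨y, hy, hBy⟩
        obtain ⟨e, rfl⟩ := hf.surj y hy
        exact ⟨e, (hf.iff e _ hB).2 hBy⟩)
  simp only [exUb, List.all_eq_true, impb_eq_true, elemb_eq_true, List.any_eq_true, h.name_eq]
  exact this.symm

theorem typeb_iff (h : E.Fits O A) {τ : List Concept} (hτ : τ ⊆ E.cl) :
    E.typeb τ = true ↔ IsType O A {C | C ∈ τ} := by
  simp only [typeb, List.all_eq_true, impb_eq_true, elemb_eq_true]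
  constructor
  · exact fun ht => ⟨fun C hC => (h.mem_cl C).1 (hτ hC), fun C hC hent =>
      ht C ((h.mem_cl C).2 hC) ((h.entb_iff hτ ((h.mem_cl C).2 hC)).2 hent)⟩
  · exact fun ht C hC hent => ht.2 C ((h.mem_cl C).1 hC) ((h.entb_iff hτ hC).1 hent)

end Fits

open Classical in
/-- The list that represents a type. -/
noncomputable def rep (E : Context) (τ : Set Concept) : List Concept := E.cl.filter fun C => C ∈ τ

namespace Fits

theorem mem_rep (h : E.Fits O A) {τ : Set Concept} (hτ : τ ⊆ typeConcepts O A) {C : Concept} :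
    C ∈ E.rep τ ↔ C ∈ τ := by
  simp only [rep, List.mem_filter, decide_eq_true_eq, and_iff_right_iff_imp]
  exact fun hC => (h.mem_cl C).2 (hτ hC)

theorem setOf_rep (h : E.Fits O A) {τ : Set Concept} (hτ : τ ⊆ typeConcepts O A) :
    {C | C ∈ E.rep τ} = τ := Set.ext fun _ => h.mem_rep hτ

theorem rep_subset (τ : Set Concept) : E.rep τ ⊆ E.cl := List.filter_sublist.subset

theorem mem_types (h : E.Fits O A) {σ : List Concept} :
    σ ∈ E.types ↔ ∃ τ ⊆ typeConcepts O A, E.rep τ = σ := by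
  rw [h.types_eq, List.mem_sublists']
  constructor
  · intro hσ
    exact ⟨{C | C ∈ σ}, fun C hC => (h.mem_cl C).1 (hσ.subset hC),
      by simp only [rep, Set.mem_ofPred_eq]; convert filter_mem_of_sublist hσ h.nodup⟩
  · rintro ⟨τ, -, rfl⟩
    exact List.filter_sublist

theorem rep_injOn (h : E.Fits O A) {τ σ : Set Concept} (hτ : τ ⊆ typeConcepts O A)
    (hσ : σ ⊆ typeConcepts O A) : E.rep τ = E.rep σ ↔ τ = σ := by
  refine ⟨fun he => ?_, congrArg _⟩
  rw [← h.setOf_rep hτ, ← h.setOf_rep hσ, he]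

theorem leastType_subset (C : Concept) : leastType O A C ⊆ typeConcepts O A :=
  (leastType_isType C).1

open Classical in
theorem least_eq (h : E.Fits O A) {C : Concept} (hC : C ∈ typeConcepts O A) :
    E.least C = E.rep (leastType O A C) := by
  have hsub : [C, Concept.exU (.name A)] ⊆ E.cl := by
    intro D hD
    simp only [List.mem_cons, List.not_mem_nil, or_false] at hD
    rcases hD with rfl | rfl
    · exact (h.mem_cl _).2 hC
    · exact (h.mem_cl _).2 exU_mem_typeConcepts
  unfold least rep
  refine List.filter_congr fun D hD => ?_
  rw [Bool.eq_iff_iff, decide_eq_true_eq, h.name_eq, h.entb_iff hsub hD, leastType_eq]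
  have : {D | D ∈ [C, Concept.exU (.name A)]} = ({C, .exU (.name A)} : Set Concept) := by
    ext; simp
  rw [this]
  exact ⟨fun hent => ⟨(h.mem_cl D).1 hD, hent⟩, fun hent => hent.2⟩

theorem mem_inds (h : E.Fits O A) {a : ℕ} : a ∈ E.inds ↔ NLSym.ind a ∈ O.sig := by
  rw [← nom_mem_typeConcepts_iff (A := A), ← h.mem_cl, inds, List.mem_flatMap]
  constructor
  · rintro ⟨C, hC, ha⟩
    cases C <;> simp [Concept.nomIndex] at ha
    subst ha
    exact hC
  · exact fun h => ⟨_, h, by simp [Concept.nomIndex]⟩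

theorem mem_nomTypes (h : E.Fits O A) {σ : List Concept} :
    σ ∈ E.nomTypes ↔ ∃ τ ∈ nominalTypes O A, E.rep τ = σ := by
  simp only [nomTypes, List.mem_map, h.mem_inds]
  constructor
  · rintro ⟨a, ha, rfl⟩
    exact ⟨_, ⟨a, ha, rfl⟩, (h.least_eq (nom_mem_typeConcepts ha)).symm⟩
  · rintro ⟨_, ⟨a, ha, rfl⟩, rfl⟩
    exact ⟨a, ha, h.least_eq (nom_mem_typeConcepts ha)⟩

theorem mem_conTypes (h : E.Fits O A) {σ : List Concept} :
    σ ∈ E.conTypes ↔ ∃ τ ∈ conceptTypes O A, E.rep τ = σ := by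
  have hcon : ∀ B, B ∈ E.cl.flatMap Concept.conIndex ↔ Concept.name B ∈ E.cl := by
    intro B
    rw [List.mem_flatMap]
    constructor
    · rintro ⟨C, hC, hB⟩
      cases C <;> simp [Concept.conIndex] at hB
      subst hB
      exact hC
    · exact fun h => ⟨_, h, by simp [Concept.conIndex]⟩
  simp only [conTypes, List.mem_map, List.mem_filter, hcon]
  constructor
  · rintro ⟨B, ⟨hB, hent⟩, rfl⟩
    exact ⟨_, ⟨B, (h.exUb_iff hB).1 hent, rfl⟩, (h.least_eq ((h.mem_cl _).1 hB)).symm⟩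
  · rintro ⟨_, ⟨B, hent, rfl⟩, rfl⟩
    have hB := name_mem_typeConcepts_of_entails hent
    exact ⟨B, ⟨(h.mem_cl _).2 hB, (h.exUb_iff ((h.mem_cl _).2 hB)).2 hent⟩, h.least_eq hB⟩

theorem typeSuccb_iff (h : E.Fits O A) {R : Role} {τ σ : Set Concept}
    (hτ : τ ⊆ typeConcepts O A) (hσ : σ ⊆ typeConcepts O A) :
    E.typeSuccb R (E.rep τ) (E.rep σ) = true ↔ TypeSucc O A R τ σ := by
  have key : ∀ {ρ : Set Concept}, ρ ⊆ typeConcepts O A →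
      (E.typeb (E.rep ρ) = true ∧ E.succb R (E.rep τ) (E.rep ρ) = true ↔ IsType O A ρ ∧
        ∀ I : Interpretation, I.IsModel O → ∀ d ∈ I.extAll τ, ∃ e, I.rel R d e ∧ e ∈ I.extAll ρ) := by
    intro ρ hρ
    rw [h.typeb_iff (rep_subset ρ), h.succb_iff (rep_subset τ) (rep_subset ρ), h.setOf_rep hρ,
      h.setOf_rep hτ]
  have hle : ∀ {ρ ρ' : Set Concept}, ρ ⊆ typeConcepts O A → ρ' ⊆ typeConcepts O A →
      (E.rep ρ ⊆ E.rep ρ' ↔ ρ ⊆ ρ') := by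
    intro ρ ρ' hρ hρ'
    simp only [List.subset_def, h.mem_rep hρ, h.mem_rep hρ', Set.subset_def]
  simp only [typeSuccb, Bool.and_eq_true, key hσ, List.all_eq_true, impb_eq_true, subb_eq_true]
  refine and_congr_right fun _ => ⟨fun hall ρ hρ hsub => ?_, fun hmax ρ' hρ' => ?_⟩
  · exact (hle hρ.1.1 hσ).1 (hall _ (h.mem_types.2 ⟨ρ, hρ.1.1, rfl⟩)
      ⟨(key hρ.1.1).2 hρ, (hle hσ hρ.1.1).2 hsub⟩)
  · obtain ⟨ρ, hρ, rfl⟩ := h.mem_types.1 hρ'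
    rintro ⟨h1, h2⟩
    exact (hle hρ hσ).2 (hmax ((key hρ).1 h1) ((hle hσ hρ).1 h2))

theorem mem_typeTable (h : E.Fits O A) {τ : Set Concept} (hτ : τ ⊆ typeConcepts O A) {R : Role}
    {σ : List Concept} : ((E.rep τ, R), σ) ∈ E.typeTable ↔
      ∃ ρ, E.rep ρ = σ ∧ ρ ∉ nominalTypes O A ∧ TypeSucc O A R τ ρ := by
  -- By `TypeSucc.rol_mem` no other role leads to a successor, so the finite search over roles in
  -- `cl` and their inverses is complete.
  have hroles : NLSym.rol R.base ∈ O.sig →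
      R ∈ E.cl.flatMap fun C => C.headRole.flatMap fun R => [R, R.flip] := by
    intro hR
    obtain ⟨R', C, hb, hC⟩ := Ontology.rol_mem_sig.1 hR
    refine List.mem_flatMap.2 ⟨_, (h.mem_cl _).2 (sub_subset_typeConcepts hC),
      List.mem_flatMap.2 ⟨R', by simp [Concept.headRole], ?_⟩⟩
    cases R <;> cases R' <;> simp only [Role.base] at hb <;> subst hb <;> simp [Role.flip]
  have hnom : ∀ {ρ}, ρ ⊆ typeConcepts O A → (E.rep ρ ∉ E.nomTypes ↔ ρ ∉ nominalTypes O A) := by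
    intro ρ hρ
    rw [h.mem_nomTypes, not_iff_not]
    constructor
    · rintro ⟨ρ', hρ', he⟩
      have : ρ' ⊆ typeConcepts O A := by
        obtain ⟨a, -, rfl⟩ := hρ'
        exact leastType_subset _
      rwa [← (h.rep_injOn this hρ).1 he]
    · exact fun hρ => ⟨ρ, hρ, rfl⟩
  simp only [typeTable, List.mem_flatMap, List.mem_map, List.mem_filter, Bool.and_eq_true,
    Bool.not_eq_true', Prod.mk.injEq]
  constructor
  · rintro ⟨_, -, R', -, _, ⟨hσ, hn, hs⟩, ⟨rfl, rfl⟩, rfl⟩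
    obtain ⟨ρ, hρ, rfl⟩ := h.mem_types.1 hσ
    refine ⟨ρ, rfl, (hnom hρ).1 fun hm => ?_, (h.typeSuccb_iff hτ hρ).1 hs⟩
    rw [(elemb_eq_true _ _).2 hm] at hn
    cases hn
  · rintro ⟨ρ, rfl, hn, hs⟩
    have hρ := hs.prop.1.1
    refine ⟨_, h.mem_types.2 ⟨τ, hτ, rfl⟩, R,
      by simpa only [List.mem_flatMap] using hroles (hs.rol_mem hτ), _,
      ⟨h.mem_types.2 ⟨ρ, hρ, rfl⟩, ?_, (h.typeSuccb_iff hτ hρ).2 hs⟩, ⟨rfl, rfl⟩, rfl⟩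
    exact Bool.eq_false_iff.2 fun hm => (hnom hρ).2 hn ((elemb_eq_true _ _).1 hm)

end Fits

/-- The representation of an element of the canonical model. -/
noncomputable def code (E : Context) (x : CanonicalDom O A) : Word (List Concept) := x.1.map E.rep

namespace Fits

/-- Reading the lists as sets recovers the word; hence `code` is injective, and equality tests on
codes are faithful. -/
theorem map_code (h : E.Fits O A) (x : CanonicalDom O A) :
    (E.code x).map (fun l => {C | C ∈ l}) = x.1 := by
  obtain ⟨w, hw⟩ := x
  change (w.map E.rep).map _ = w
  induction w with
  | base τ => exact congrArg Word.base (h.setOf_rep hw.isType.1)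
  | snoc w R τ ih =>
    change Word.snoc ((w.map E.rep).map _) R {C | C ∈ E.rep τ} = _
    rw [ih hw.1]
    exact congrArg _ (h.setOf_rep hw.isType.1)

theorem code_injective (h : E.Fits O A) :
    Function.Injective (E.code : CanonicalDom O A → Word (List Concept)) := fun x y he =>
  Subtype.ext (by rw [← h.map_code x, ← h.map_code y, he])

theorem mem_tail_code (h : E.Fits O A) {x : CanonicalDom O A} {C : Concept} :
    C ∈ (E.code x).tail ↔ C ∈ x.1.tail := by
  rw [code, Word.tail_map, h.mem_rep x.2.isType.1]

theorem code_eq_base (h : E.Fits O A) {x : CanonicalDom O A} {C : Concept}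
    (hC : C ∈ typeConcepts O A) : E.code x = .base (E.least C) ↔ x.1 = .base (leastType O A C) := by
  rw [h.least_eq hC]
  constructor
  · intro he
    rw [← h.map_code x, he]
    exact congrArg Word.base (h.setOf_rep (leastType_subset C))
  · intro he
    rw [code, he]
    rfl

theorem code_eq_snoc (h : E.Fits O A) {x y : CanonicalDom O A} {R : Role} :
    E.code y = .snoc (E.code x) R (E.code y).tail ↔ ∃ τ, y.1 = .snoc x.1 R τ := by
  constructor
  · intro he
    refine ⟨{C | C ∈ (E.code y).tail}, ?_⟩
    rw [← h.map_code y, ← h.map_code x]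
    exact congrArg (Word.map _) he
  · rintro ⟨τ, he⟩
    rw [code, he]
    rfl

theorem exists_code_snoc (h : E.Fits O A) {w : Word (List Concept)} {R : Role} {σ : List Concept} :
    (∃ x : CanonicalDom O A, E.code x = .snoc w R σ) ↔
      (∃ x : CanonicalDom O A, E.code x = w) ∧ ((w.tail, R), σ) ∈ E.typeTable := by
  constructor
  · rintro ⟨⟨_ | ⟨v, R', τ⟩, hv⟩, he⟩
    · cases he
    · injection he with h1 h2 h3
      subst h1 h2 h3
      refine ⟨⟨⟨v, hv.1⟩, rfl⟩, ?_⟩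
      rw [Word.tail_map, h.mem_typeTable hv.1.isType.1]
      exact ⟨τ, rfl, hv.2.1, hv.2.2⟩
  · rintro ⟨⟨x, rfl⟩, ht⟩
    rw [code, Word.tail_map, h.mem_typeTable x.2.isType.1] at ht
    obtain ⟨ρ, rfl, hn, hs⟩ := ht
    exact ⟨⟨.snoc x.1 R ρ, x.2, hn, hs⟩, rfl⟩

theorem mem_canonicalWords (h : E.Fits O A) {clock : List (List Concept)}
    {w : Word (List Concept)} : w ∈ wordsUpTo (E.conTypes ++ E.nomTypes) E.typeTable clock ↔
      ∃ x : CanonicalDom O A, x.1.len ≤ clock.length ∧ E.code x = w := by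
  rw [mem_wordsUpTo (P := fun w => ∃ x : CanonicalDom O A, E.code x = w) (fun σ => ?_)
    fun w R σ => h.exists_code_snoc]
  · constructor
    · rintro ⟨⟨x, rfl⟩, hl⟩
      rw [code, Word.len_map] at hl
      exact ⟨x, hl, rfl⟩
    · rintro ⟨x, hl, rfl⟩
      refine ⟨⟨x, rfl⟩, ?_⟩
      rwa [code, Word.len_map]
  · rw [List.mem_append, h.mem_conTypes, h.mem_nomTypes]
    constructor
    · rintro ⟨⟨τ | ⟨v, R, τ⟩, hv⟩, he⟩
      · injection he with he
        exact hv.imp (fun hv => ⟨τ, hv, he⟩) fun hv => ⟨τ, hv, he⟩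
      · cases he
    · rintro (⟨τ, hτ, rfl⟩ | ⟨τ, hτ, rfl⟩)
      · exact ⟨⟨.base τ, .inl hτ⟩, rfl⟩
      · exact ⟨⟨.base τ, .inr hτ⟩, rfl⟩

theorem relb_iff (h : E.Fits O A) {r : ℕ} {x y : CanonicalDom O A} :
    E.relb r (E.code x) (E.code y) = true ↔ (canonicalModel O A).rol r x y := by
  have key : ∀ (R : Role) (x y : CanonicalDom O A),
      (∃ a ∈ E.inds, Concept.ex R (.nom a) ∈ (E.code x).tail ∧
        E.code y = .base (E.least (.nom a))) ↔
      ∃ a, Concept.ex R (.nom a) ∈ x.1.tail ∧ y.1 = .base (leastType O A (.nom a)) := by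
    intro R x y
    simp only [h.mem_inds, h.mem_tail_code]
    constructor
    · rintro ⟨a, ha, hx, hy⟩
      exact ⟨a, hx, (h.code_eq_base (nom_mem_typeConcepts ha)).1 hy⟩
    · rintro ⟨a, hx, hy⟩
      have ha : Concept.nom a ∈ typeConcepts O A :=
        typeConcepts_closed (x.2.isType.1 hx) (.inr rfl)
      exact ⟨a, nom_mem_typeConcepts_iff.1 ha, hx, (h.code_eq_base ha).2 hy⟩
  simp only [relb, Bool.or_eq_true, List.any_eq_true, Bool.and_eq_true, eqb_eq_true, elemb_eq_true]
  rw [key, key, h.code_eq_snoc, h.code_eq_snoc, or_assoc]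
  rfl

theorem nominalb_iff (h : E.Fits O A) {S : Signature} (hS : S.indNames ⊆ O.sig.indNames)
    {Γ : List ℕ} (hΓ : ∀ a, a ∈ Γ ↔ NLSym.ind a ∈ S) {x : CanonicalDom O A} :
    E.nominalb Γ (E.code x) = true ↔ ABox.IsNominal (reduct O A S) S.indNames x := by
  simp only [nominalb, List.any_eq_true, eqb_eq_true, hΓ]
  refine exists_congr fun a => and_congr_right fun ha => ?_
  rw [h.code_eq_base (nom_mem_typeConcepts (hS ha)), nom_mem_reduct]
  have hind := canonicalModel_ind (A := A) (hS ha)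
  constructor
  · exact fun he => ⟨ha, Subtype.ext (hind.trans he.symm)⟩
  · rintro ⟨-, rfl⟩
    exact hind

end Fits

end Context
end DescrLogic

/-! ### Correctness of the computed words, reachability and assertions -/

namespace DescrLogic

/-- The members of a list that can be reached inside the list, by iteration of a step as often as
the list is long. -/
theorem mem_iterate_reach {Y : Type} {V : List Y} {y₀ : Y} (h₀ : y₀ ∈ V) {step : List Y → List Y}
    {r : Y → Y → Prop} (hstep : ∀ S y, y ∈ step S ↔ y ∈ V ∧ (y ∈ S ∨ ∃ z ∈ S, r z y)) {y : Y} :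
    y ∈ V.foldr (fun _ S => step S) [y₀] ↔
      Relation.ReflTransGen (fun a b => b ∈ V ∧ r a b) y₀ y := by
  let F : ℕ → List Y := fun n => step^[n] [y₀]
  have hfold : V.foldr (fun _ S => step S) [y₀] = F V.length := by
    have : ∀ l : List Y, l.foldr (fun _ S => step S) [y₀] = F l.length := fun l => by
      induction l with
      | nil => rfl
      | cons a l ih =>
        rw [List.foldr_cons, ih, List.length_cons]
        exact (Function.iterate_succ_apply' step _ _).symm
    exact this V
  have hsucc : ∀ n, F (n + 1) = step (F n) := fun n => Function.iterate_succ_apply' step n _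
  have hV : ∀ n, ∀ z ∈ F n, z ∈ V := fun n => by
    cases n with
    | zero => intro z hz; rw [List.mem_singleton.1 hz]; exact h₀
    | succ n => intro z hz; rw [hsucc] at hz; exact ((hstep _ _).1 hz).1
  have hmono : ∀ n, ∀ z ∈ F n, z ∈ F (n + 1) := fun n z hz => by
    rw [hsucc]
    exact (hstep _ _).2 ⟨hV n z hz, .inl hz⟩
  rw [hfold]
  constructor
  · have : ∀ n, ∀ z ∈ F n, Relation.ReflTransGen (fun a b => b ∈ V ∧ r a b) y₀ z := fun n => by
      induction n with
      | zero => intro z hz; rw [List.mem_singleton.1 hz]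
      | succ n ih =>
        intro z hz
        rw [hsucc] at hz
        obtain ⟨h1, h2 | ⟨z', h2, h3⟩⟩ := (hstep _ _).1 hz
        · exact ih z h2
        · exact (ih z' h2).tail ⟨h1, h3⟩
    exact this _ y
  -- The sets of members of `V` not yet reached decrease, so they repeat within `V.length` steps;
  -- from then on the reached set is closed under the relation.
  · obtain ⟨j, hj, hst⟩ := exists_stable_of_antitone (fun n => {z | z ∈ V ∧ z ∉ F n})
      (U := {z | z ∈ V}) V.finite_toSet (fun z hz => hz.1)
      fun n z hz => ⟨hz.1, fun h' => hz.2 (hmono n z h')⟩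
    have hjl : j ≤ V.length := by
      classical
      refine hj.trans ?_
      have : {z | z ∈ V} = (V.toFinset : Set Y) := by ext; simp
      rw [this, Set.ncard_coe_finset]
      exact V.toFinset_card_le
    have hup : ∀ k, ∀ z ∈ F j, z ∈ F (j + k) := fun k => by
      induction k with
      | zero => exact fun z hz => hz
      | succ k ih => exact fun z hz => hmono _ z (ih z hz)
    have hclosed : ∀ z, z ∈ F (j + 1) → z ∈ F j := fun z hz => by
      by_contra hn
      have : z ∈ {z | z ∈ V ∧ z ∉ F (j + 1)} := by
        rw [hst]
        exact ⟨hV _ z hz, hn⟩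
      exact this.2 hz
    have h0 : y₀ ∈ F j := by
      have : ∀ n, y₀ ∈ F n := fun n => by
        induction n with
        | zero => exact List.mem_singleton_self _
        | succ n ih => exact hmono n _ ih
      exact this j
    intro hy
    have hyj : y ∈ F j := by
      induction hy with
      | refl => exact h0
      | tail _ hab ih =>
        refine hclosed _ ?_
        rw [hsucc]
        exact (hstep _ _).2 ⟨hab.1, .inr ⟨_, ih, hab.2⟩⟩
    have := hup (V.length - j) y hyj
    rwa [Nat.add_sub_cancel' hjl] at this

namespace Context

open ABox

variable {E : Context} {O : Ontology} {A : ℕ} {S : Signature} {Γ P X : List ℕ}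

/-- The representation of a word over the canonical model. -/
noncomputable def code₂ (E : Context) (w : Word (CanonicalDom O A)) : Word (Word (List Concept)) :=
  w.map E.code

namespace Fits

theorem code₂_injective (h : E.Fits O A) :
    Function.Injective (E.code₂ : Word (CanonicalDom O A) → Word (Word (List Concept))) :=
  Word.map_injective h.code_injective

theorem tail_code₂ (w : Word (CanonicalDom O A)) : (E.code₂ w).tail = E.code w.tail :=
  Word.tail_map _ _

theorem code₂_eq_base {w : Word (CanonicalDom O A)} :
    E.code₂ w = .base (E.code₂ w).tail ↔ ∃ x, w = .base x := by
  constructor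
  · intro he
    cases w with
    | base x => exact ⟨x, rfl⟩
    | snoc w R x => cases he
  · rintro ⟨x, rfl⟩
    rfl

theorem code₂_eq_snoc (h : E.Fits O A) {w z : Word (CanonicalDom O A)} {R : Role} :
    E.code₂ z = .snoc (E.code₂ w) R (E.code₂ z).tail ↔ ∃ x, z = .snoc w R x := by
  constructor
  · intro he
    cases z with
    | base x => cases he
    | snoc z R' x =>
      injection he with h1 h2 h3
      exact ⟨x, by rw [h.code₂_injective h1, h2]⟩
  · rintro ⟨x, rfl⟩
    rfl

theorem mem_roleTable (h : E.Fits O A) (hS : S.indNames ⊆ O.sig.indNames)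
    (hΓ : ∀ a, a ∈ Γ ↔ NLSym.ind a ∈ S) (hP : ∀ r, r ∈ P ↔ NLSym.rol r ∈ S)
    {V : List (Word (List Concept))} {N : ℕ}
    (hV : ∀ w, w ∈ V ↔ ∃ x : CanonicalDom O A, x.1.len ≤ N ∧ E.code x = w)
    {x : CanonicalDom O A} (hx : x.1.len ≤ N) {R : Role} {v : Word (List Concept)} :
    ((E.code x, R), v) ∈ E.roleTable Γ P V ↔ ∃ y : CanonicalDom O A, y.1.len ≤ N ∧ E.code y = v ∧
      ¬ IsNominal (reduct O A S) S.indNames y ∧ HasRole (reduct O A S) R x y := by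
  have hnom : ∀ y : CanonicalDom O A, E.nominalb Γ (E.code y) = false ↔
      ¬ IsNominal (reduct O A S) S.indNames y := fun y => by
    rw [← h.nominalb_iff hS hΓ, Bool.not_eq_true]
  simp only [roleTable, List.mem_flatMap, List.mem_append, List.mem_map, List.mem_filter,
    Bool.and_eq_true, Bool.not_eq_true', Prod.mk.injEq]
  constructor
  · rintro ⟨_, -, r, hr, ⟨_, ⟨hv, hn, hrel⟩, ⟨rfl, rfl⟩, rfl⟩ | ⟨_, ⟨hv, hn, hrel⟩, ⟨rfl, rfl⟩, rfl⟩⟩ <;>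
    obtain ⟨y, hy, rfl⟩ := (hV _).1 hv <;>
    exact ⟨y, hy, rfl, (hnom y).1 hn, (hP r).1 hr, h.relb_iff.1 hrel⟩
  · rintro ⟨y, hy, rfl, hn, hR⟩
    rw [hasRole_reduct] at hR
    refine ⟨_, (hV _).2 ⟨x, hx, rfl⟩, R.base, (hP _).2 hR.1, ?_⟩
    cases R with
    | name r => exact .inl ⟨_, ⟨(hV _).2 ⟨y, hy, rfl⟩, (hnom y).2 hn, h.relb_iff.2 hR.2⟩, ⟨rfl, rfl⟩, rfl⟩
    | inv r => exact .inr ⟨_, ⟨(hV _).2 ⟨y, hy, rfl⟩, (hnom y).2 hn, h.relb_iff.2 hR.2⟩, ⟨rfl, rfl⟩, rfl⟩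

theorem mem_unfoldWords (h : E.Fits O A) (hS : S.indNames ⊆ O.sig.indNames)
    (hΓ : ∀ a, a ∈ Γ ↔ NLSym.ind a ∈ S) (hP : ∀ r, r ∈ P ↔ NLSym.rol r ∈ S)
    {V : List (Word (List Concept))} {clock : List (List Concept)}
    (hV : ∀ w, w ∈ V ↔ ∃ x : CanonicalDom O A, x.1.len ≤ clock.length ∧ E.code x = w)
    {z : Word (Word (List Concept))} :
    z ∈ wordsUpTo V (E.roleTable Γ P V) clock ↔
      ∃ w ∈ truncWords O A S clock.length, E.code₂ w = z := by
  -- The predicate is membership in `truncWords` without the bound on the length of the outer word,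
  -- which the clock adds. The inner words are bounded through `V`.
  rw [mem_wordsUpTo (P := fun z => ∃ w : Word (CanonicalDom O A),
    (IsUnfoldWord (reduct O A S) S.indNames w ∧ w.Over {x | x.1.len ≤ clock.length} Set.univ) ∧
      E.code₂ w = z) (fun v => ?_) fun z R v => ?_]
  · constructor
    · rintro ⟨⟨w, hw, rfl⟩, hl⟩
      rw [code₂, Word.len_map] at hl
      exact ⟨w, ⟨hw.1, hl, hw.2⟩, rfl⟩
    · rintro ⟨w, hw, rfl⟩
      refine ⟨⟨w, ⟨hw.1, hw.2.2⟩, rfl⟩, ?_⟩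
      rw [code₂, Word.len_map]
      exact hw.2.1
  · rw [hV]
    constructor
    · rintro ⟨x | ⟨w, R, x⟩, hw, he⟩
      · injection he with he
        exact ⟨x, hw.2, he⟩
      · cases he
    · rintro ⟨x, hx, rfl⟩
      exact ⟨.base x, ⟨mem_ind_reduct x, hx⟩, rfl⟩
  · constructor
    · rintro ⟨x | ⟨w, R', x⟩, hw, he⟩
      · cases he
      · injection he with h1 h2 h3
        subst h1 h2 h3
        refine ⟨⟨w, ⟨hw.1.1, hw.2.1⟩, rfl⟩, ?_⟩
        rw [← code₂, tail_code₂, h.mem_roleTable hS hΓ hP hV hw.2.1.tail_mem]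
        exact ⟨x, hw.2.2.2, rfl, hw.1.2.1, hw.1.2.2⟩
    · rintro ⟨⟨w, hw, rfl⟩, ht⟩
      rw [tail_code₂, h.mem_roleTable hS hΓ hP hV hw.2.tail_mem] at ht
      obtain ⟨y, hy, rfl, hn, hR⟩ := ht
      exact ⟨.snoc w R y, ⟨⟨hw.1, hn, hR⟩, hw.2, trivial, hy⟩, rfl⟩

/-- For words of the unfolding, a role assertion depends only on whether one word extends the other
by one step, or one is a nominal and the last letters are related. Validity of the words supplies
the remaining conditions. -/
theorem wordRolb_iff (h : E.Fits O A) (hS : S.indNames ⊆ O.sig.indNames)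
    (hΓ : ∀ a, a ∈ Γ ↔ NLSym.ind a ∈ S) {r : ℕ} (hr : NLSym.rol r ∈ S)
    {w z : Word (CanonicalDom O A)} (hw : IsUnfoldWord (reduct O A S) S.indNames w)
    (hz : IsUnfoldWord (reduct O A S) S.indNames z) :
    E.wordRolb Γ r (E.code₂ w) (E.code₂ z) = true ↔
      Assertion.rol r w z ∈ unfold (reduct O A S) S.indNames := by
  simp only [wordRolb, Bool.or_eq_true, Bool.and_eq_true, eqb_eq_true]
  rw [h.code₂_eq_snoc, h.code₂_eq_snoc, code₂_eq_base, code₂_eq_base, tail_code₂, tail_code₂,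
    h.nominalb_iff hS hΓ, h.nominalb_iff hS hΓ, h.relb_iff]
  constructor
  · rintro ((⟨x, rfl⟩ | ⟨x, rfl⟩) | ⟨⟨⟨x, rfl⟩, hn⟩ | ⟨⟨x, rfl⟩, hn⟩, hrel⟩)
    · exact .child r w x hz
    · exact .childInv r z x hw
    · exact .toNominal r w x hw hn ⟨hr, hrel⟩
    · exact .ofNominal r z x hz hn ⟨hr, hrel⟩
  · intro hf
    cases hf with
    | child _ _ x _ => exact .inl (.inl ⟨x, rfl⟩)
    | childInv _ _ x _ => exact .inl (.inr ⟨x, rfl⟩)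
    | toNominal _ _ x _ hn hrel => exact .inr ⟨.inl ⟨⟨x, rfl⟩, hn⟩, hrel.2⟩
    | ofNominal _ _ x _ hn hrel => exact .inr ⟨.inr ⟨⟨x, rfl⟩, hn⟩, hrel.2⟩

theorem rol_mem_of_unfold {r : ℕ} {w z : Word (CanonicalDom O A)}
    (hf : Assertion.rol r w z ∈ unfold (reduct O A S) S.indNames) : NLSym.rol r ∈ S := by
  cases hf with
  | child _ _ x hx => exact hx.2.2.1
  | childInv _ _ x hx => exact hx.2.2.1
  | toNominal _ _ x _ _ hrel => exact hrel.1
  | ofNominal _ _ x _ _ hrel => exact hrel.1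

theorem root_eq (h : E.Fits O A) : E.root = E.code₂ (.base (canonicalRoot O A)) := by
  rw [root, h.name_eq, ← (h.code_eq_base (x := canonicalRoot O A) name_mem_typeConcepts).2 rfl]
  rfl

theorem mem_reach (h : E.Fits O A) (hS : S.indNames ⊆ O.sig.indNames)
    (hΓ : ∀ a, a ∈ Γ ↔ NLSym.ind a ∈ S) (hP : ∀ r, r ∈ P ↔ NLSym.rol r ∈ S)
    {V : List (Word (Word (List Concept)))} {𝒲 : Set (Word (CanonicalDom O A))}
    (hV : ∀ z, z ∈ V ↔ ∃ w ∈ 𝒲, E.code₂ w = z)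
    (h𝒲 : ∀ w ∈ 𝒲, IsUnfoldWord (reduct O A S) S.indNames w)
    (hroot : .base (canonicalRoot O A) ∈ 𝒲) {z : Word (Word (List Concept))} :
    z ∈ E.reach Γ P V ↔
      ∃ w ∈ select (reduct O A S) S.indNames 𝒲 (canonicalRoot O A) .elio, E.code₂ w = z := by
  -- Testing only the role names in `P` loses nothing, as all edges of the unfolding carry role
  -- names of `S`.
  have hadj : ∀ w ∈ 𝒲, ∀ w' ∈ 𝒲, (∃ r ∈ P, E.wordRolb Γ r (E.code₂ w) (E.code₂ w') = true ∨
      E.wordRolb Γ r (E.code₂ w') (E.code₂ w) = true) ↔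
      Adj (unfoldOn (reduct O A S) S.indNames 𝒲) w w' := by
    intro w hw w' hw'
    constructor
    · rintro ⟨r, hr, hrel⟩
      rw [h.wordRolb_iff hS hΓ ((hP r).1 hr) (h𝒲 w hw) (h𝒲 w' hw'),
        h.wordRolb_iff hS hΓ ((hP r).1 hr) (h𝒲 w' hw') (h𝒲 w hw)] at hrel
      exact ⟨r, hrel.imp (fun hf => ⟨hf, by rintro y (rfl | rfl) <;> assumption⟩)
        fun hf => ⟨hf, by rintro y (rfl | rfl) <;> assumption⟩⟩
    · rintro ⟨r, hrel⟩
      have hr : NLSym.rol r ∈ S := hrel.elim (fun hf => rol_mem_of_unfold hf.1)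
        fun hf => rol_mem_of_unfold hf.1
      exact ⟨r, (hP r).2 hr, hrel.imp
        (fun hf => (h.wordRolb_iff hS hΓ hr (h𝒲 w hw) (h𝒲 w' hw')).2 hf.1)
        fun hf => (h.wordRolb_iff hS hΓ hr (h𝒲 w' hw') (h𝒲 w hw)).2 hf.1⟩
  rw [reach, h.root_eq, mem_iterate_reach ((hV _).2 ⟨_, hroot, rfl⟩)
    (r := fun z z' => ∃ r ∈ P, E.wordRolb Γ r z z' = true ∨ E.wordRolb Γ r z' z = true)
    (fun S y => by
      simp only [reachStep, List.mem_filter, Bool.or_eq_true, elemb_eq_true, List.any_eq_true]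
      simp only [or_comm])]
  constructor
  · intro hz
    induction hz with
    | refl => exact ⟨_, ⟨hroot, .refl⟩, rfl⟩
    | tail _ hab ih =>
      obtain ⟨w, hw, rfl⟩ := ih
      obtain ⟨w', hw', rfl⟩ := (hV _).1 hab.1
      exact ⟨w', ⟨hw', hw.2.tail ((hadj w hw.1 w' hw').1 hab.2)⟩, rfl⟩
  · rintro ⟨w, ⟨-, hw⟩, rfl⟩
    induction hw with
    | refl => exact .refl
    | @tail w w' _ hab ih =>
      have hmem : w ∈ 𝒲 ∧ w' ∈ 𝒲 := by
        obtain ⟨r, hf | hf⟩ := hab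
        · exact ⟨hf.2 _ (.inl rfl), hf.2 _ (.inr rfl)⟩
        · exact ⟨hf.2 _ (.inr rfl), hf.2 _ (.inl rfl)⟩
      exact ih.tail ⟨(hV _).2 ⟨w', hmem.2, rfl⟩, (hadj w hmem.1 w' hmem.2).2 hab⟩

theorem mem_assertions (h : E.Fits O A) (hS : S.indNames ⊆ O.sig.indNames)
    (hX : ∀ B, B ∈ X ↔ NLSym.con B ∈ S) (hΓ : ∀ a, a ∈ Γ ↔ NLSym.ind a ∈ S)
    (hP : ∀ r, r ∈ P ↔ NLSym.rol r ∈ S)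
    {W : List (Word (Word (List Concept)))} {𝒲 : Set (Word (CanonicalDom O A))}
    (hW : ∀ z, z ∈ W ↔ ∃ w ∈ 𝒲, E.code₂ w = z)
    (h𝒲 : ∀ w ∈ 𝒲, IsUnfoldWord (reduct O A S) S.indNames w)
    {β : Assertion (Word (Word (List Concept)))} :
    β ∈ E.assertions X Γ P W ↔
      ∃ α ∈ unfoldOn (reduct O A S) S.indNames 𝒲, α.map E.code₂ = β := by
  -- In the unfolding a nominal is named only at its one-letter word, whose code is that of `τ_a`.
  have hcode : ∀ {a} {w : Word (CanonicalDom O A)}, NLSym.ind a ∈ S →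
      (E.code₂ w = .base (.base (E.least (.nom a))) ↔
        ∃ x, w = .base x ∧ Assertion.nom a x ∈ reduct O A S) := by
    intro a w ha
    have hind := canonicalModel_ind (A := A) (hS ha)
    rw [← (h.code_eq_base (x := (canonicalModel O A).ind a) (nom_mem_typeConcepts (hS ha))).2 hind]
    constructor
    · intro he
      have := h.code₂_injective (he.trans (rfl : _ = E.code₂ (.base ((canonicalModel O A).ind a))))
      exact ⟨_, this, ha, rfl⟩
    · rintro ⟨x, rfl, -, rfl⟩
      rfl
  simp only [assertions, List.mem_flatMap, List.mem_cons, List.mem_append, List.mem_map,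
    List.mem_filter, elemb_eq_true, eqb_eq_true]
  constructor
  · rintro ⟨z, hz, hβ⟩
    obtain ⟨w, hw, rfl⟩ := (hW _).1 hz
    rcases hβ with rfl | ⟨B, ⟨hB, hBw⟩, rfl⟩ | ⟨a, ⟨ha, haw⟩, rfl⟩ | ⟨r, hr, z', ⟨hz', hrel⟩, rfl⟩
    · exact ⟨.top w, ⟨.top w (h𝒲 w hw) trivial, by rintro y rfl; exact hw⟩, rfl⟩
    · rw [tail_code₂, h.mem_tail_code] at hBw
      exact ⟨.con B w, ⟨.con B w (h𝒲 w hw) ⟨(hX B).1 hB, hBw⟩, by rintro y rfl; exact hw⟩, rfl⟩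
    · obtain ⟨x, rfl, hx⟩ := (hcode ((hΓ a).1 ha)).1 haw
      exact ⟨.nom a (.base x), ⟨.nom a x ((hΓ a).1 ha) hx, by rintro y rfl; exact hw⟩, rfl⟩
    · obtain ⟨w', hw', rfl⟩ := (hW _).1 hz'
      exact ⟨.rol r w w', ⟨(h.wordRolb_iff hS hΓ ((hP r).1 hr) (h𝒲 w hw) (h𝒲 w' hw')).1 hrel,
        by rintro y (rfl | rfl) <;> assumption⟩, rfl⟩
  · rintro ⟨α, ⟨hα, hv⟩, rfl⟩
    cases α with
    | top w => exact ⟨_, (hW _).2 ⟨w, hv w rfl, rfl⟩, .inl rfl⟩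
    | con B w =>
      refine ⟨_, (hW _).2 ⟨w, hv w rfl, rfl⟩, .inr (.inl ⟨B, ⟨?_, ?_⟩, rfl⟩)⟩
      · cases hα with | con _ _ _ hB => exact (hX B).2 hB.1
      · rw [tail_code₂, h.mem_tail_code]
        cases hα with | con _ _ _ hB => exact hB.2
    | nom a w =>
      cases hα with
      | nom _ x ha hx =>
        exact ⟨_, (hW _).2 ⟨_, hv _ rfl, rfl⟩, .inr (.inr (.inl
          ⟨a, ⟨(hΓ a).2 ha, (hcode ha).2 ⟨x, rfl, hx⟩⟩, rfl⟩))⟩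
    | rol r w z =>
      have hw := hv w (.inl rfl)
      have hz := hv z (.inr rfl)
      have hr : NLSym.rol r ∈ S := rol_mem_of_unfold hα
      exact ⟨_, (hW _).2 ⟨w, hw, rfl⟩, .inr (.inr (.inr ⟨r, (hP r).2 hr, _,
        ⟨(hW _).2 ⟨z, hz, rfl⟩, (h.wordRolb_iff hS hΓ hr (h𝒲 w hw) (h𝒲 z hz)).2 hα⟩, rfl⟩))⟩

theorem denotes (h : E.Fits O A) {c : ABoxCode} {𝒜 : ABox (Word (CanonicalDom O A))}
    (hc : ∀ β, β ∈ c ↔ ∃ α ∈ 𝒜, α.map E.code₂ = β) : c.Denotes 𝒜 := by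
  have hmap : ∀ α : Assertion (Word (CanonicalDom O A)),
      (α.map E.code₂).map (Word.map (Word.map fun l => {C : Concept | C ∈ l})) =
        α.map (Word.map Subtype.val) := by
    have hw : ∀ w : Word (CanonicalDom O A),
        (E.code₂ w).map (Word.map fun l => {C : Concept | C ∈ l}) = w.map Subtype.val := fun w => by
      rw [code₂, Word.map_map]
      exact congrArg (fun f => w.map f) (funext h.map_code)
    intro α
    cases α <;> simp only [Assertion.map, hw]
  ext γ
  constructor
  · rintro ⟨β, hβ, rfl⟩
    obtain ⟨α, hα, rfl⟩ := (hc β).1 hβ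
    exact ⟨α, hα, (hmap α).symm⟩
  · rintro ⟨α, hα, rfl⟩
    exact ⟨_, (hc _).2 ⟨α, hα, rfl⟩, (hmap α).symm⟩

end Fits

end Context

/-! The input -/

/-- In normal form each side of an inclusion is at most one constructor above names, so immediate
subconcepts suffice. -/
theorem mem_subconcepts {l : List Inclusion} {O : Ontology} (hl : O = l.toFinset)
    (hO : O.IsNormal) {C : Concept} : C ∈ subconcepts l ↔ C ∈ O.sub := by
  have key : ∀ c : Inclusion, c.IsNormal → ∀ C, (C ∈ (c.lhs :: c.lhs.children) ++
      (c.rhs :: c.rhs.children) ↔ C ∈ c.lhs.sub ∪ c.rhs.sub) := by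
    intro c hc C
    cases hc <;> simp [Concept.children, Concept.sub] <;> tauto
  subst hl
  rw [subconcepts, List.mem_flatMap]
  constructor
  · rintro ⟨c, hc, h⟩
    have hc' := List.mem_toFinset.2 hc
    exact ⟨c, hc', (key c (hO c hc') C).1 h⟩
  · rintro ⟨c, hc, h⟩
    exact ⟨c, List.mem_toFinset.1 hc, (key c (hO c hc) C).2 h⟩

section Symbols

variable {l : List Inclusion} {O : Ontology}

theorem mem_conIndices (hl : O = l.toFinset) (hO : O.IsNormal) {B : ℕ} :
    B ∈ (subconcepts l).flatMap Concept.conIndex ↔ NLSym.con B ∈ O.sig := by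
  rw [Ontology.con_mem_sig, ← mem_subconcepts hl hO, List.mem_flatMap]
  constructor
  · rintro ⟨C, hC, hB⟩
    cases C <;> simp [Concept.conIndex] at hB
    subst hB
    exact hC
  · exact fun h => ⟨_, h, by simp [Concept.conIndex]⟩

theorem mem_nomIndices (hl : O = l.toFinset) (hO : O.IsNormal) {a : ℕ} :
    a ∈ (subconcepts l).flatMap Concept.nomIndex ↔ NLSym.ind a ∈ O.sig := by
  rw [Ontology.ind_mem_sig, ← mem_subconcepts hl hO, List.mem_flatMap]
  constructor
  · rintro ⟨C, hC, ha⟩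
    cases C <;> simp [Concept.nomIndex] at ha
    subst ha
    exact hC
  · exact fun h => ⟨_, h, by simp [Concept.nomIndex]⟩

theorem mem_headRoles (hl : O = l.toFinset) (hO : O.IsNormal) {r : ℕ} :
    (r ∈ (subconcepts l).flatMap fun C => C.headRole.map Role.base) ↔ NLSym.rol r ∈ O.sig := by
  rw [Ontology.rol_mem_sig, List.mem_flatMap]
  constructor
  · rintro ⟨C, hC, hr⟩
    cases C <;> simp [Concept.headRole] at hr
    exact ⟨_, _, hr.symm, (mem_subconcepts hl hO).1 hC⟩
  · rintro ⟨R, C, rfl, hC⟩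
    exact ⟨_, (mem_subconcepts hl hO).2 hC, by simp [Concept.headRole]⟩

theorem mem_flippedRoles (hl : O = l.toFinset) (hO : O.IsNormal) {R : Role} :
    (R ∈ (subconcepts l).flatMap fun C => C.headRole.flatMap fun R => [R, R.flip]) ↔
      NLSym.rol R.base ∈ O.sig := by
  rw [← mem_headRoles hl hO]
  simp only [List.mem_flatMap, List.mem_map, List.mem_cons, List.not_mem_nil, or_false]
  refine exists_congr fun C => and_congr_right fun _ => exists_congr fun R' =>
    and_congr_right fun _ => ?_
  cases R <;> cases R' <;> simp [Role.flip, Role.base, eq_comm]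

end Symbols

namespace Input

variable {l₁ l₂ : List Inclusion} {O₁ O₂ : Ontology} {A B : ℕ}

theorem fits_context (h₁ : O₁ = l₁.toFinset) (h₂ : O₂ = l₂.toFinset) (hn₁ : O₁.IsNormal)
    (hn₂ : O₂.IsNormal) : (context ((l₁, l₂), A, B)).Fits (O₁ ∪ O₂) A := by
  have hO : (O₁ ∪ O₂).IsNormal := fun c hc => (Finset.mem_union.1 hc).elim (hn₁ c) (hn₂ c)
  have hl : O₁ ∪ O₂ = (l₁ ++ l₂).toFinset := by rw [List.toFinset_append, h₁, h₂]
  refine ⟨rfl, fun c => ?_, fun C => ?_, nodup_nub _, rfl, rfl⟩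
  · rw [hl, List.mem_toFinset]
    rfl
  · change C ∈ nub _ ↔ _
    rw [mem_nub, List.mem_append, List.mem_append, mem_subconcepts hl hO, List.mem_flatMap]
    simp only [mem_flippedRoles hl hO, List.mem_map, mem_nomIndices hl hO]
    refine or_congr (or_congr Iff.rfl ⟨?_, ?_⟩) (by simp)
    · rintro ⟨R, hR, a, ha, rfl⟩
      exact ⟨R, a, hR, ha, rfl⟩
    · rintro ⟨R, a, hR, ha, rfl⟩
      exact ⟨R, hR, a, ha, rfl⟩

/-- Duplicates have been removed, so the length of the list is the cardinality, and the clock has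
exactly the length `truncBound`. -/
theorem length_concepts (h₁ : O₁ = l₁.toFinset) (h₂ : O₂ = l₂.toFinset) (hn₁ : O₁.IsNormal)
    (hn₂ : O₂.IsNormal) :
    (concepts ((l₁, l₂), A, B)).length = (typeConcepts (O₁ ∪ O₂) A).ncard := by
  have hfit := fits_context (A := A) (B := B) h₁ h₂ hn₁ hn₂
  have : typeConcepts (O₁ ∪ O₂) A = ((concepts ((l₁, l₂), A, B)).toFinset : Set Concept) := by
    ext C
    rw [← hfit.mem_cl, List.coe_toFinset]
    rfl
  rw [this, Set.ncard_coe_finset]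
  exact (List.toFinset_card_of_nodup hfit.nodup).symm

/-- The output denotes the truncation unconditionally; the algorithm does not decide whether a
witness exists. -/
theorem denotes_output (L : Dialect) (h₁ : O₁ = l₁.toFinset) (h₂ : O₂ = l₂.toFinset)
    (hn₁ : O₁.IsNormal) (hn₂ : O₂.IsNormal) : (output L ((l₁, l₂), A, B)).Denotes
      (truncABox (O₁ ∪ O₂) A (commonSig O₁ O₂ A B) L) := by
  have hfit := fits_context (A := A) (B := B) h₁ h₂ hn₁ hn₂
  have hS : (commonSig O₁ O₂ A B).indNames ⊆ (O₁ ∪ O₂).sig.indNames := fun a ha =>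
    (commonSig_subset ha).resolve_right fun h => by cases h
  have hX : ∀ C, C ∈ conNames ((l₁, l₂), A, B) ↔ NLSym.con C ∈ commonSig O₁ O₂ A B := fun C => by
    simp only [conNames, List.mem_filter, elemb_eq_true, List.mem_cons, mem_conIndices h₁ hn₁,
      mem_conIndices h₂ hn₂]
    simp [commonSig, Concept.sig]
  have hΓ : ∀ a, a ∈ indNames ((l₁, l₂), A, B) ↔ NLSym.ind a ∈ commonSig O₁ O₂ A B := fun a => by
    simp only [indNames, List.mem_filter, elemb_eq_true, mem_nomIndices h₁ hn₁,
      mem_nomIndices h₂ hn₂]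
    simp [commonSig, Concept.sig]
  have hP : ∀ r, r ∈ rolNames ((l₁, l₂), A, B) ↔ NLSym.rol r ∈ commonSig O₁ O₂ A B := fun r => by
    simp only [rolNames, List.mem_filter, elemb_eq_true, mem_headRoles h₁ hn₁,
      mem_headRoles h₂ hn₂]
    simp [commonSig, Concept.sig]
  have hN : (clock ((l₁, l₂), A, B)).length = truncBound (O₁ ∪ O₂) A := by
    rw [length_clock, length_concepts h₁ h₂ hn₁ hn₂, truncBound]
  have hV := fun z => hfit.mem_unfoldWords hS hΓ hP (clock := clock ((l₁, l₂), A, B))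
    (fun w => hfit.mem_canonicalWords) (z := z)
  rw [hN] at hV
  refine hfit.denotes fun β => ?_
  refine hfit.mem_assertions hS hX hΓ hP (fun z => ?_)
    fun w hw => isUnfoldWord_of_mem_truncWords (ABox.select_subset L hw)
  cases L with
  | eliou => exact hV z
  | elio =>
    exact hfit.mem_reach hS hΓ hP hV (fun w hw => isUnfoldWord_of_mem_truncWords hw)
      (base_mem_truncWords (Nat.zero_le _))

end Input
end DescrLogic

theorem mainTheorem5 :
    ∃ p : Polynomial ℕ,
      (∀ (L : DescrLogic.Dialect) (O₁ O₂ : DescrLogic.Ontology) (A B : ℕ),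
        O₁.IsNormal → O₂.IsNormal →
          List.TFAE [
            ∃ C : DescrLogic.Concept,
              DescrLogic.IsInterpolant L O₁ O₂ (.name A) (.name B) C,
            DescrLogic.ABox.Entails (O₁ ∪ O₂)
              (DescrLogic.canonicalABox (O₁ ∪ O₂) A (DescrLogic.commonSig O₁ O₂ A B) L)
              B (DescrLogic.canonicalRoot (O₁ ∪ O₂) A),
            ∃ 𝒜, DescrLogic.IsWitness L O₁ O₂ A B (2 ^ 2 ^ p.eval (O₁ ∪ O₂).size) 𝒜]) ∧
      (∀ L : DescrLogic.Dialect, ∃ (P : DescrLogic.Prog) (q : Polynomial ℕ),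
        ∀ (l₁ l₂ : List DescrLogic.Inclusion) (O₁ O₂ : DescrLogic.Ontology) (A B : ℕ),
          O₁ = l₁.toFinset → O₂ = l₂.toFinset → O₁.IsNormal → O₂.IsNormal →
            ∃ y : DescrLogic.Data,
              P.OutputsWithin (DescrLogic.encInput l₁ l₂ A B)
                (2 ^ 2 ^ q.eval (DescrLogic.encInput l₁ l₂ A B).size) y ∧
              ((∃ 𝒜, DescrLogic.IsWitness L O₁ O₂ A B (2 ^ 2 ^ p.eval (O₁ ∪ O₂).size) 𝒜) →
                ∃ 𝒜, DescrLogic.IsWitness L O₁ O₂ A B (2 ^ 2 ^ p.eval (O₁ ∪ O₂).size) 𝒜 ∧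
                  ∃ c : DescrLogic.ABoxCode,
                    c.Denotes 𝒜 ∧ y = DescrLogic.encABoxCode c)) := by
  refine ⟨DescrLogic.sizePoly, DescrLogic.interpolant_tfae, fun L => ?_⟩
  obtain ⟨P, q, h⟩ := DescrLogic.Input.exists_prog L
  refine ⟨P, q, fun l₁ l₂ O₁ O₂ A B h₁ h₂ hn₁ hn₂ => ⟨_, h l₁ l₂ A B, fun hw => ?_⟩⟩
  -- Any witness yields Point 2, and Point 2 makes the truncation itself a witness, so one fixed
  -- output serves.
  have hent := ((DescrLogic.interpolant_tfae L O₁ O₂ A B hn₁ hn₂).out 2 1).1 hw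
  exact ⟨_, DescrLogic.truncABox_isWitness hn₁ hn₂ hent, _,
    DescrLogic.Input.denotes_output L h₁ h₂ hn₁ hn₂, rfl⟩
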